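/- **Setting.** Let $l\ge 1$ and let $\mathbf z=\mathbb R^l$. Let $Z\mapsto j_Z$ be a linear map into the skew endomorphisms of $\mathbb R^r$ with $j_Z^2=-|Z|^2\,\mathrm{id}$. On $\mathbf v=(\mathbb R^r)^N$ let $J_Z=(j_Z,\dots,j_Z,-j_Z,\dots,-j_Z)$ with $a$ plus signs and $J'_Z$ the same with $a'$ plus signs ($0\le a,a'\le N$); these define the Heisenberg-type groups $H^{(a,N-a)}_l$ and $H^{(a',N-a')}_l$. A vector of $\mathbf v$ is called adapted if it lies in the component of $\mathbf v$ where $J'=J$ or in the one where $J'=-J$. Let $\mathbf Q=(Q_1,\dots,Q_n)$ be one of the following. * A *changing basis*: a field $\theta\mapsto\mathbf Q(\theta)$ on unit $Z$-vectors which, on a dense open set with complement of measure $0$, is continuous and consists of adapted vectors forming a complex orthonormal basis of $(\mathbf v,J_\theta)$. * A *constant basis*: fixed adapted vectors which form a complex basis of $(\mathbf v,J_\theta)$ for at least one unit vector $\theta$. Put $z_{\theta i}(X)=\langle Q_i+\mathbf i J_\theta Q_i,X\rangle$ and $V_u=V/|V|$, and $$\mathcal F_{\mathbf Q\{p_iq_i\}}(\phi)(X,Z)=\int_{\mathbb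 R^l}e^{\mathbf i\langle Z,V\rangle}\phi(|X|,V)\prod_i z_{V_ui}^{p_i}(X)\,\overline z_{V_ui}^{q_i}(X)\,dV .$$ The operator $\kappa_{\mathbf Q}$ is the linear correspondence spanned by $\mathcal F_{\mathbf Q\{p_iq_i\}}(\phi)\mapsto\mathcal F'_{\mathbf Q\{p_iq_i\}}(\phi)$, where $\mathcal F'$ is written with $J'$ instead of $J$. Its domain is the linear span of all $\mathcal F_{\mathbf Q\{p_iq_i\}}(\phi)$, where $\phi(s,\cdot)\in L^1\cap L^2(\mathbb R^l)$ for each $s\ge0$. For a function $\phi$ on $\mathbb R^l$ let $$\mathbb L_{\pm}(\phi)(\theta,t)=\int_0^\infty e^{\mathbf i st}\phi(s\theta)\,ds+\int_0^\infty e^{-\mathbf i st}\phi(-s\theta)\,ds$$ be the function on the line $\mathbb R\theta$ given by the Laplace transforms, on the imaginary axis, of $\phi$ on the two half-lines. The dual Radon transform of an even function $g$ (that is, $g(-\theta,-t)=g(\theta,t)$) is $g_\tau(Z)=\int_{\langle\theta,Z\rangle\ge0}g(\theta,\langle\theta,Z\rangle)\,d\theta$. We write $\phi=\mathbb L_\pm^{-1}(f_{\tau^{-1}})$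 if $\phi$ is continuous, integrable on each half-line, and $g=\mathbb L_\pm(\phi)$ is continuous, bounded, even, tends to $0$ on each line as $|t|\to\infty$, and satisfies $g_\tau(Z)=f(Z)$ for all $Z\ne0$. For a complex polynomial $P$ on $\mathbf v$ let $P_\theta$ be its representation as a polynomial in $z_{\theta i},\overline z_{\theta i}$, and let $P_\theta(X,V_u)$ be obtained from it by replacing these by $z_{V_ui},\overline z_{V_ui}$. Let $T_\delta(\theta)=\{V:\langle V,\theta\rangle\ge0,\ |V-\langle V,\theta\rangle\theta|\le\delta\}$, let $\mathrm{Vol}(D_\delta)$ be the volume of a ball of radius $\delta$ in $\mathbb R^{l-1}$, and let $G(\theta)$ be the Gram determinant of $Q_1,\dots,Q_n,J_\theta Q_1,\dots,J_\theta Q_n$. Define $$A_{\varepsilon,\delta}(\phi)(X,Z)=\int_{\{\theta\in S^{l-1}:\,G(\theta)\ge\varepsilon\}}\frac1{\mathrm{Vol}(D_\delta)}\int_{T_\delta(\theta)}e^{\mathbf i\langle Z,V\rangle}\phi(|X|,V)\,P_\theta(X,V_u)\,dV\,d\theta .$$ Below, "$A\to w$" means $A_{0,\delta}\to w$ as $\delta\to0^+$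 for a changing basis (no cutoff), and $\lim_{\varepsilon\to0^+}\limsup_{\delta\to0^+}\|A_{\varepsilon,\delta}-w\|=0$ for a constant basis. "Admissible $(\varepsilon,\delta)$" means $\varepsilon=0$, $\delta>0$ for a changing basis, and all sufficiently small $\varepsilon>0$ and all $\delta>0$ for a constant basis. **Theorem.** 1. Let $f$ be a smooth function of compact support on $\mathbb R^l$. Then $\phi=\mathbb L_\pm^{-1}(f_{\tau^{-1}})$ exists, and for every polynomial $P$ the functions $A_{\varepsilon,\delta}(\phi)$ with admissible $(\varepsilon,\delta)$ belong to the domain of $\kappa_{\mathbf Q}$ (with $\phi$'s that depend on $V$ only), and $A(\phi)\to P(X)f(Z)$ in $L^2(\mathbb R^l)$ for each fixed $X$ and in $L^2(B_R\times\mathbb R^l)$ for each ball $B_R\subset\mathbf v$. For the restrictions to sphere$\times$ball-type domains, $A(\phi)\to \tilde P(X)f(Z)$ in $L^2(S_R\times B_\rho)$ for all spheres $S_R\subset\mathbf v$ and balls $B_\rho\subset\mathbb R^l$ around the origin with $R,\rho>0$, where $\tilde P=P|_{S_R}$. 2. Let $f(s,Z)$, $s\ge0$, be such that each $f(s,\cdot)$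 is smooth of compact support. Then $\phi(s,\cdot)=\mathbb L_\pm^{-1}(f(s,\cdot)_{\tau^{-1}})$ exists for each $s\ge 0$, and for every polynomial $P$ the functions $A_{\varepsilon,\delta}(\phi)$ with admissible $(\varepsilon,\delta)$ belong to the domain of $\kappa_{\mathbf Q}$, and $A(\phi)\to P(X)f(|X|,Z)$ in $L^2(\mathbb R^l)$ for each fixed $X$. If $f(|X|,Z)\in L^2(B_R\times\mathbb R^l)$ for all $R$, then the $A_{\varepsilon,\delta}(\phi)$ lie in the domain already when $\phi$'s with $\phi(|X|,V)\in L^2(B_R\times\mathbb R^l)$ for all $R$ are used, and the convergence also holds in $L^2(B_R\times\mathbb R^l)$ for all $R$. If $(1+|X|)^{\deg P}f(|X|,Z)\in L^2(\mathbf v\times\mathbb R^l)$, it also holds in $L^2(\mathbf v\times\mathbb R^l)$. 3. The part of the domain of $\kappa_{\mathbf Q}$ that is spanned by the $\mathcal F_{\mathbf Q\{p_iq_i\}}(\phi)$ with $\phi(|X|,V)=e^{-|X|^2}\sum_{j<m}|X|^j\phi_j(V)$, $\phi_j\in L^1\cap L^2(\mathbb R^l)$, is contained and dense in $L^2_{\mathbb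 C}(\mathbf v\times\mathbb R^l)$. -/

import Mathlib

open MeasureTheory Filter Topology Metric
open scoped ENNReal ContDiff

noncomputable section

/-- The Z-space. -/
abbrev ZSpace (l : ℕ) : Type := EuclideanSpace ℝ (Fin l)

/-- The X-space: `N` copies of `ℝ ^ r`. -/
abbrev XSpace (N r : ℕ) : Type := EuclideanSpace ℝ (Fin N × Fin r)

/-! ### The endomorphisms of a Heisenberg-type group -/

/-- The linear space of skew endomorphisms `j_Z` of `ℝ ^ r` with `j_Z ^ 2 = -|Z| ^ 2 id`. -/
structure IsCliffordModule {l r : ℕ} (j : ZSpace l →ₗ[ℝ] Matrix (Fin r) (Fin r) ℝ) : Prop where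
  skew : ∀ Z, (j Z).transpose = -j Z
  clifford : ∀ Z, j Z * j Z = (-(‖Z‖ ^ 2)) • (1 : Matrix (Fin r) (Fin r) ℝ)

/-- The endomorphisms `J_Z = (j_Z, …, j_Z, -j_Z, …, -j_Z)` of the group `H^{(a, N - a)}_l`:
`j_Z` on the first `a` copies of `ℝ ^ r`, and `-j_Z` on the remaining ones. -/
def hTypeJ {l N r : ℕ} (j : ZSpace l →ₗ[ℝ] Matrix (Fin r) (Fin r) ℝ) (a : ℕ)
    (V : ZSpace l) (X : XSpace N r) : XSpace N r :=
  WithLp.toLp 2 (fun c => (if c.1.val < a then (1 : ℝ) else -1) *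
    (j V).mulVec (fun i => X (c.1, i)) c.2)

/-! ### Complex bases and complex coordinates -/

section Coordinates

variable {l N r n : ℕ}

/-- The real vectors `Q_1, …, Q_n, J_θ Q_1, …, J_θ Q_n`. -/
def realFrame (J : ZSpace l → XSpace N r → XSpace N r) (Q : ZSpace l → Fin n → XSpace N r)
    (θ : ZSpace l) : Fin n ⊕ Fin n → XSpace N r :=
  Sum.elim (Q θ) (fun i => J θ (Q θ i))

/-- `Q(θ)` is a basis of the X-space as a complex vector space with complex structure `J_θ`. -/
def IsComplexBasisAt (J : ZSpace l → XSpace N r → XSpace N r)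
    (Q : ZSpace l → Fin n → XSpace N r) (θ : ZSpace l) : Prop :=
  LinearIndependent ℝ (realFrame J Q θ) ∧ Submodule.span ℝ (Set.range (realFrame J Q θ)) = ⊤

/-- `Q(θ)` is an orthonormal basis of the complex X-space with complex structure `J_θ`. -/
def IsComplexOrthonormalBasisAt (J : ZSpace l → XSpace N r → XSpace N r)
    (Q : ZSpace l → Fin n → XSpace N r) (θ : ZSpace l) : Prop :=
  Orthonormal ℝ (realFrame J Q θ) ∧ Submodule.span ℝ (Set.range (realFrame J Q θ)) = ⊤

/-- The vector `x` lies in the component of the X-space on which `J` and `J'` agree, or in the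
component on which they are opposite. -/
def IsAdaptedVector (J J' : ZSpace l → XSpace N r → XSpace N r) (x : XSpace N r) : Prop :=
  (∀ V, J' V x = J V x) ∨ (∀ V, J' V x = -J V x)

/-- A changing complex orthonormal basis field `θ ↦ Q(θ)`: it is adapted, orthonormal and
continuous on a dense open set of unit Z-vectors whose complement has measure zero. -/
def IsChangingBasis (J J' : ZSpace l → XSpace N r → XSpace N r)
    (Q : ZSpace l → Fin n → XSpace N r) : Prop :=
  ∃ U : Set (sphere (0 : ZSpace l) 1), IsOpen U ∧ Dense U ∧
    (volume : Measure (ZSpace l)).toSphere Uᶜ = 0 ∧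
    ContinuousOn (fun θ : sphere (0 : ZSpace l) 1 => Q θ) U ∧
    ∀ θ ∈ U, IsComplexOrthonormalBasisAt J Q θ ∧ ∀ i, IsAdaptedVector J J' (Q θ i)

/-- A constant adapted system of vectors, which is a complex basis for at least one of the
complex structures `J_θ`. -/
def IsConstantBasis (J J' : ZSpace l → XSpace N r → XSpace N r)
    (Q : ZSpace l → Fin n → XSpace N r) : Prop :=
  (∀ θ θ' : ZSpace l, Q θ = Q θ') ∧ (∀ θ i, IsAdaptedVector J J' (Q θ i)) ∧
    ∃ θ : ZSpace l, ‖θ‖ = 1 ∧ IsComplexBasisAt J Q θ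

/-- The complex coordinate `z_{θ i}(X) = ⟨Q_i + 𝐢 J_θ(Q_i), X⟩`. -/
def zCoord (J : ZSpace l → XSpace N r → XSpace N r) (Q : ZSpace l → Fin n → XSpace N r)
    (θ : ZSpace l) (i : Fin n) (X : XSpace N r) : ℂ :=
  (inner ℝ (Q θ i) X : ℂ) + Complex.I * (inner ℝ (J θ (Q θ i)) X : ℂ)

/-- The value at `X` of a polynomial `R` in the complex coordinates `z_{θ i}` (left variables) and
their conjugates (right variables). -/
def evalCoord (J : ZSpace l → XSpace N r → XSpace N r) (Q : ZSpace l → Fin n → XSpace N r)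
    (R : MvPolynomial (Fin n ⊕ Fin n) ℂ) (θ : ZSpace l) (X : XSpace N r) : ℂ :=
  MvPolynomial.eval
    (Sum.elim (fun i => zCoord J Q θ i X) (fun i => (starRingEnd ℂ) (zCoord J Q θ i X))) R

/-- The value at `X` of a complex valued polynomial on the X-space. -/
def evalX (P : MvPolynomial (Fin N × Fin r) ℂ) (X : XSpace N r) : ℂ :=
  MvPolynomial.eval (fun c => (X c : ℂ)) P

open Classical in
/-- The representation of `P` as a polynomial in the complex coordinates `z_{θ i}` and their
conjugates. It exists and is unique whenever `Q(θ)` is a complex basis for `J_θ`. -/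
def complexRep (J : ZSpace l → XSpace N r → XSpace N r) (Q : ZSpace l → Fin n → XSpace N r)
    (P : MvPolynomial (Fin N × Fin r) ℂ) (θ : ZSpace l) : MvPolynomial (Fin n ⊕ Fin n) ℂ :=
  if h : ∃ R : MvPolynomial (Fin n ⊕ Fin n) ℂ, ∀ X, evalCoord J Q R θ X = evalX P X
  then h.choose else 0

/-- The Gram determinant of `Q_1, …, Q_n, J_θ Q_1, …, J_θ Q_n`. It is positive exactly if these
vectors are independent, and equals `1` if they are orthonormal. -/
def frameGram (J : ZSpace l → XSpace N r → XSpace N r) (Q : ZSpace l → Fin n → XSpace N r)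
    (θ : ZSpace l) : ℝ :=
  (Matrix.of (fun u v => inner ℝ (realFrame J Q θ u) (realFrame J Q θ v))).det

end Coordinates

/-! ### Twisted Z-Fourier transforms and the intertwining operator -/

section Twisted

variable {l N r n : ℕ}

/-- The unit vector `V_u = V / |V|`. -/
def unitVec (V : ZSpace l) : ZSpace l := ‖V‖⁻¹ • V

/-- The twisted Z-Fourier transform
`∫ e^{𝐢⟨Z,V⟩} φ(|X|, V) ∏ i, z_{V_u i}^{p_i} \bar z_{V_u i}^{q_i} dV`. -/
def twistedFourier (J : ZSpace l → XSpace N r → XSpace N r)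
    (Q : ZSpace l → Fin n → XSpace N r) (p q : Fin n → ℕ) (φ : ℝ → ZSpace l → ℂ) :
    XSpace N r → ZSpace l → ℂ := fun X Z =>
  ∫ V : ZSpace l, Complex.exp (Complex.I * (inner ℝ Z V : ℂ)) * φ ‖X‖ V *
    ∏ i, zCoord J Q (unitVec V) i X ^ p i *
      (starRingEnd ℂ) (zCoord J Q (unitVec V) i X) ^ q i

/-- The same transform with the monomial replaced by a polynomial in the complex coordinates. -/
def twistedFourierPoly (J : ZSpace l → XSpace N r → XSpace N r)
    (Q : ZSpace l → Fin n → XSpace N r) (R : MvPolynomial (Fin n ⊕ Fin n) ℂ)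
    (φ : ℝ → ZSpace l → ℂ) : XSpace N r → ZSpace l → ℂ := fun X Z =>
  ∫ V : ZSpace l, Complex.exp (Complex.I * (inner ℝ Z V : ℂ)) * φ ‖X‖ V *
    evalCoord J Q R (unitVec V) X

/-- The functions of `V` that may be transformed: square integrable, and integrable so that the
Fourier integral converges absolutely. -/
def IsDensity (φ : ZSpace l → ℂ) : Prop := Integrable φ ∧ MemLp φ 2 volume

/-- The functions `φ(V)` that do not depend on `|X|`. -/
def constAmplitudes (l : ℕ) : Set (ℝ → ZSpace l → ℂ) :=
  {φ | ∃ ψ : ZSpace l → ℂ, IsDensity ψ ∧ ∀ s V, φ s V = ψ V}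

/-- The functions `φ(|X|, V)`, with no condition on the dependence on `|X|`. -/
def sliceAmplitudes (l : ℕ) : Set (ℝ → ZSpace l → ℂ) :=
  {φ | ∀ s, 0 ≤ s → IsDensity (φ s)}

/-- The functions `φ(|X|, V)` that are square integrable over each bounded range of `|X|`. -/
def localAmplitudes (l N r : ℕ) : Set (ℝ → ZSpace l → ℂ) :=
  {φ | (∀ s, 0 ≤ s → IsDensity (φ s)) ∧
    ∀ R : ℝ, MemLp (fun w : XSpace N r × ZSpace l => φ ‖w.1‖ w.2) 2
      ((volume.restrict (ball 0 R)).prod volume)}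

/-- The functions `φ(|X|, V) = e^{-|X|^2} ∑_j |X|^j φ_j(V)`. -/
def gaussAmplitudes (l : ℕ) : Set (ℝ → ZSpace l → ℂ) :=
  {φ | ∃ (m : ℕ) (ψ : ℕ → ZSpace l → ℂ), (∀ i, IsDensity (ψ i)) ∧
    ∀ s V, φ s V = (Real.exp (-s ^ 2) : ℂ) * ∑ i ∈ Finset.range m, (s : ℂ) ^ i * ψ i V}

/-- The graph of the intertwining operator `κ_Q`: the linear relation spanned by the
correspondences `F_{Q{p_i q_i}}(φ) → F'_{Q{p_i q_i}}(φ)`, for all exponents and all admissible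
functions `φ`. -/
def kappaGraph (J J' : ZSpace l → XSpace N r → XSpace N r)
    (Q : ZSpace l → Fin n → XSpace N r) (A : Set (ℝ → ZSpace l → ℂ)) :
    Submodule ℂ ((XSpace N r → ZSpace l → ℂ) × (XSpace N r → ZSpace l → ℂ)) :=
  Submodule.span ℂ {w | ∃ p q : Fin n → ℕ, ∃ φ ∈ A,
    w = (twistedFourier J Q p q φ, twistedFourier J' Q p q φ)}

/-- The domain of the intertwining operator `κ_Q`. -/
def kappaDomain (J J' : ZSpace l → XSpace N r → XSpace N r)
    (Q : ZSpace l → Fin n → XSpace N r) (A : Set (ℝ → ZSpace l → ℂ)) :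
    Submodule ℂ (XSpace N r → ZSpace l → ℂ) :=
  (kappaGraph J J' Q A).map (LinearMap.fst ℂ _ _)

end Twisted

/-! ### The dual Radon transform, the Laplace transform on lines, and their inverses -/

section Transforms

variable {l : ℕ}

/-- The dual Radon transform `∫_{⟨θ,Z⟩ ≥ 0} g(θ, ⟨θ,Z⟩) dθ` of a function `g` of a unit vector and
a real parameter. -/
def dualRadon (g : ZSpace l → ℝ → ℂ) (Z : ZSpace l) : ℂ :=
  ∫ θ in {θ : sphere (0 : ZSpace l) 1 | 0 ≤ inner ℝ (θ : ZSpace l) Z},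
    g θ (inner ℝ (θ : ZSpace l) Z) ∂(volume : Measure (ZSpace l)).toSphere

/-- `g` is the inverse dual Radon transform of `f`. Points of lines through the origin are
`(θ, t) = (-θ, -t)`, so `g` is even. At `Z = 0` the hemisphere of integration degenerates to the
whole sphere; this point is left out. -/
structure IsInverseDualRadon (f : ZSpace l → ℂ) (g : ZSpace l → ℝ → ℂ) : Prop where
  continuous : Continuous (fun w : sphere (0 : ZSpace l) 1 × ℝ => g w.1 w.2)
  even : ∀ θ : ZSpace l, ‖θ‖ = 1 → ∀ t, g (-θ) (-t) = g θ t
  bounded : ∃ C : ℝ, ∀ θ : ZSpace l, ‖θ‖ = 1 → ∀ t, ‖g θ t‖ ≤ C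
  decay : ∀ θ : ZSpace l, ‖θ‖ = 1 → Tendsto (g θ) (cocompact ℝ) (𝓝 0)
  dualRadon_eq : ∀ Z : ZSpace l, Z ≠ 0 → dualRadon g Z = f Z

/-- The Laplace transform `∫_0^∞ e^{-σ s} φ(s θ) ds` at `σ = -𝐢 t` of `φ` on the half-line
spanned by `θ`, which is the one-dimensional Fourier transform of `φ` cut off to the half-line. -/
def halfLineLaplace (φ : ZSpace l → ℂ) (θ : ZSpace l) (t : ℝ) : ℂ :=
  ∫ s in Set.Ioi (0 : ℝ), Complex.exp (Complex.I * (s * t : ℝ)) * φ (s • θ)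

/-- The function on the whole line spanned by `±θ` defined by the Laplace transforms of `φ` on the
two half-lines; the half-line of `-θ` is run through in the opposite direction. -/
def lineLaplace (φ : ZSpace l → ℂ) (θ : ZSpace l) (t : ℝ) : ℂ :=
  halfLineLaplace φ θ t + halfLineLaplace φ (-θ) (-t)

/-- `φ` is the inverse Laplace transform of `g` along the lines through the origin. -/
structure IsInverseLineLaplace (g : ZSpace l → ℝ → ℂ) (φ : ZSpace l → ℂ) : Prop where
  continuous : Continuous φ
  integrable : ∀ θ : ZSpace l, ‖θ‖ = 1 →
    IntegrableOn (fun s : ℝ => φ (s • θ)) (Set.Ioi (0 : ℝ))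
  lineLaplace_eq : ∀ θ : ZSpace l, ‖θ‖ = 1 → ∀ t, lineLaplace φ θ t = g θ t

/-- `φ` is obtained from `f` by the inverse dual Radon transform followed by the inverse Laplace
transform. -/
def IsInverseTransform (f φ : ZSpace l → ℂ) : Prop :=
  ∃ g : ZSpace l → ℝ → ℂ, IsInverseDualRadon f g ∧ IsInverseLineLaplace g φ

end Transforms

/-! ### The approximating functions -/

section Approximation

variable {l N r n : ℕ}

/-- The tube of radius `δ` around the half-line spanned by `θ`. -/
def tube (δ : ℝ) (θ : ZSpace l) : Set (ZSpace l) :=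
  {V | 0 ≤ inner ℝ V θ ∧ ‖V - (inner ℝ V θ : ℝ) • θ‖ ≤ δ}

/-- The volume of the discs of radius `δ` perpendicular to a line in the Z-space. -/
def discVol (l : ℕ) (δ : ℝ) : ℝ :=
  volume.real (closedBall (0 : EuclideanSpace ℝ (Fin (l - 1))) δ)

/-- The average over the unit sphere of `Vol(D_δ)⁻¹ F_{Q P_θ}(χ_{T_δ(θ)} φ)`, where only those `θ`
are used for which the Gram determinant of the basis is at least `ε`. For `ε = 0` these are all
unit vectors. -/
def approximant (J : ZSpace l → XSpace N r → XSpace N r) (Q : ZSpace l → Fin n → XSpace N r)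
    (P : MvPolynomial (Fin N × Fin r) ℂ) (φ : ℝ → ZSpace l → ℂ) (ε δ : ℝ) :
    XSpace N r → ZSpace l → ℂ := fun X Z =>
  ∫ θ in {θ : sphere (0 : ZSpace l) 1 | ε ≤ frameGram J Q θ},
    ((discVol l δ)⁻¹ : ℂ) * twistedFourierPoly J Q (complexRep J Q P θ)
      (fun s => (tube δ (θ : ZSpace l)).indicator (φ s)) X Z
    ∂(volume : Measure (ZSpace l)).toSphere

/-- `w` is the limit in `L²(ν)` of `u ε δ`, first for `δ → 0+`, then for `ε` along `𝓔`. For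
`𝓔 = pure 0` this says that `u 0 δ → w` in `L²(ν)` for `δ → 0+`. -/
def IsIteratedL2Limit {α : Type*} [MeasurableSpace α] (ν : Measure α) (𝓔 : Filter ℝ)
    (u : ℝ → ℝ → α → ℂ) (w : α → ℂ) : Prop :=
  MemLp w 2 ν ∧ ∀ η : ℝ≥0∞, 0 < η → ∀ᶠ ε in 𝓔, ∀ᶠ δ in 𝓝[>] (0 : ℝ),
    MemLp (u ε δ) 2 ν ∧ eLpNorm (u ε δ - w) 2 ν < η

/-- The surface measure of the sphere of radius `R` around the origin of the X-space. -/
def sphereMeasure (N r : ℕ) (R : ℝ) : Measure (XSpace N r) :=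
  ENNReal.ofReal (R ^ (N * r - 1)) •
    (volume : Measure (XSpace N r)).toSphere.map
      (fun θ : sphere (0 : XSpace N r) 1 => R • (θ : XSpace N r))

end Approximation

end

/-! Let `F` be the inverse Fourier transform of `f`, normalized so that `∫ e^{𝐢⟨Z,V⟩} F(V) dV =
f(Z)`. The witness for the inverse transform is `φ(V) = |V|^(l-1) F(V)`, the Fourier density in
polar coordinates. Indeed, on the hemisphere `⟨θ,Z⟩ ≥ 0` the Laplace integrals over the rays of `θ`
sweep out the half-space `⟨V,Z⟩ ≥ 0`, those over the rays of `-θ` the opposite one, and together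
they give the whole Fourier integral (`dualRadon_lineLaplace`).

In the approximating functions the coefficients of `P_θ` depend only on `θ` and the monomials only
on `V_u` and `X`. Fubini therefore moves the `θ`-integral inside: the approximant is a finite sum of
twisted transforms whose amplitudes are `φ(V)` times an integral of one coefficient over the cap `{θ
: V ∈ T_δ(θ)}`, divided by `Vol(D_δ)` (`approximant_eq_sum`). This gives membership in the domain.
The cap shrinks to `V_u`, and its measure divided by `Vol(D_δ)` tends to `|V|^(1-l)` and is at most
`C |V|^(1-l)` uniformly in `δ` (`tendsto_capDensity`, `exists_capDensity_le`). The weight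
`|V|^(l-1)` in `φ` cancels this factor, so that the amplitudes are dominated by `F` and converge to
`F(V)` times the coefficient of `P_{V_u}` at almost every `V`. Summation over the monomials restores
`P(X)`. Plancherel's formula in `Z`, with `X` as a parameter, and dominated convergence turn this
into convergence in `L²`.

For a constant basis the coefficients may be unbounded near the zeros of the Gram determinant. The
cutoff keeps them bounded for fixed `ε`, and what it removes lives on a set shrinking to a null set:
along suitable lines the determinant is a nonzero polynomial, so its zeros are negligible
(`ae_frameGram_ne_zero`).

For the density, Plancherel reduces the claim to the span of `e^{-|X|²} ψ(V)` times monomials in the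
complex coordinates. A function orthogonal to all of these has, for almost every `V`, a slice
orthogonal to `e^{-|X|²}` times every polynomial. The Fourier transform of the slice times the
Gaussian then has a vanishing power series, so the slice is zero
(`ae_eq_zero_of_forall_integral_inner_pow`). -/

noncomputable section

/-! ### Plancherel's formula with a parameter, and Fourier inversion -/

section Plancherel

open FourierTransform

variable {E : Type*} [NormedAddCommGroup E] [InnerProductSpace ℝ E] [FiniteDimensional ℝ E]
  [MeasurableSpace E] [BorelSpace E]

/-- The Fourier integral `∫ e^{𝐢⟨Z,V⟩} h(V) dV`. -/
def expFourier (h : E → ℂ) (Z : E) : ℂ :=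
  ∫ V : E, Complex.exp (Complex.I * (inner ℝ Z V : ℂ)) * h V

theorem expFourier_eq_fourier (h : E → ℂ) (Z : E) :
    expFourier h Z = 𝓕 h (-(2 * Real.pi)⁻¹ • Z) := by
  rw [Real.fourier_eq', expFourier]
  congr 1
  ext V
  rw [smul_eq_mul, inner_smul_right, real_inner_comm]
  congr 2
  push_cast
  have : (Real.pi : ℂ) ≠ 0 := by exact_mod_cast Real.pi_ne_zero
  field_simp

theorem eLpNorm_two_sq {α : Type*} [MeasurableSpace α] (f : α → ℂ) (μ : Measure α) :
    eLpNorm f 2 μ ^ 2 = ∫⁻ x, ‖f x‖ₑ ^ 2 ∂μ := by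
  have := eLpNorm_nnreal_pow_eq_lintegral (f := f) (μ := μ) (p := 2) two_ne_zero
  simpa using this

/-- Both sides are tested against smooth functions of compact support. On the left the transform
moves to the test function by Fubini, on the right by the definition of the transform of a tempered
distribution. -/
theorem fourier_eq_toLp_fourier {h : E → ℂ} (h1 : Integrable h) (h2 : MemLp h 2 volume) :
    𝓕 h =ᵐ[volume] ((𝓕 (h2.toLp h) : Lp ℂ 2 (volume : Measure E)) : E → ℂ) := by
  have hc : Continuous (𝓕 h) := VectorFourier.fourierIntegral_continuous
    Real.continuous_fourierChar (innerSL ℝ).continuous₂ h1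
  apply ae_eq_of_integral_contDiff_smul_eq hc.locallyIntegrable
    ((Lp.memLp _).locallyIntegrable (by norm_num))
  intro g hg hgc
  have hgc' : HasCompactSupport (fun x => (g x : ℂ)) :=
    hgc.comp_left (g := fun t : ℝ => (t : ℂ)) (by simp)
  have hg' : ContDiff ℝ ∞ (fun x => (g x : ℂ)) := Complex.ofRealCLM.contDiff.comp hg
  let G : SchwartzMap E ℂ := hgc'.toSchwartzMap hg'
  have hG : ∀ x, G x = (g x : ℂ) := fun x => rfl
  have key := congrArg (fun T => T G)
    (Lp.fourier_toTemperedDistribution_eq (h2.toLp h : Lp ℂ 2 (volume : Measure E)))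
  simp only [TemperedDistribution.fourier_apply, Lp.toTemperedDistribution_apply] at key
  have e1 : ∫ x, g x • 𝓕 h x = ∫ x, 𝓕 h x • G x := by
    congr 1; ext x; rw [hG, smul_eq_mul, Complex.real_smul, mul_comm]
  have e2 : ∫ x, 𝓕 h x • G x = ∫ x, h x • 𝓕 (G : E → ℂ) x :=
    VectorFourier.integral_fourierIntegral_smul_eq_flip (L := innerₗ E)
      Real.continuous_fourierChar continuous_inner h1 G.integrable |>.trans (by
        simp [Real.fourier_eq, VectorFourier.fourierIntegral, real_inner_comm])
  have e3 : ∫ x, h x • 𝓕 (G : E → ℂ) x = ∫ x, (𝓕 G) x • (h2.toLp h) x := by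
    apply integral_congr_ae
    filter_upwards [h2.coeFn_toLp] with x hx
    rw [hx, smul_eq_mul, smul_eq_mul, mul_comm]
    rfl
  rw [e1, e2, e3, key]
  congr 1

theorem eLpNorm_fourier_two {h : E → ℂ} (h1 : Integrable h) (h2 : MemLp h 2 volume) :
    eLpNorm (𝓕 h) 2 volume = eLpNorm h 2 volume := by
  rw [eLpNorm_congr_ae (fourier_eq_toLp_fourier h1 h2)]
  have := Lp.norm_fourier_eq (h2.toLp h : Lp ℂ 2 (volume : Measure E))
  rw [Lp.norm_def, Lp.norm_toLp] at this
  exact (ENNReal.toReal_eq_toReal_iff' (Lp.eLpNorm_ne_top _) h2.2.ne).1 this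

theorem lintegral_comp_smul_of_ne_zero (f : E → ℝ≥0∞) {c : ℝ} (hc : c ≠ 0) :
    ∫⁻ x, f (c • x) = ENNReal.ofReal |(c ^ Module.finrank ℝ E)⁻¹| * ∫⁻ x, f x := by
  have := Measure.map_addHaar_smul (volume : Measure E) hc
  rw [← smul_eq_mul, ← lintegral_smul_measure, ← this]
  exact ((MeasurableEquiv.smul₀ c hc).measurableEmbedding.lintegral_map _).symm

/-- The constant in Plancherel's formula. -/
def plancherelConst (E : Type*) [NormedAddCommGroup E] [InnerProductSpace ℝ E] : ℝ≥0∞ :=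
  ENNReal.ofReal |((-(2 * Real.pi)⁻¹) ^ Module.finrank ℝ E)⁻¹|

theorem plancherelConst_ne_zero {E : Type*} [NormedAddCommGroup E] [InnerProductSpace ℝ E] :
    plancherelConst E ≠ 0 := by
  simp [plancherelConst, Real.pi_ne_zero]

theorem plancherelConst_ne_top {E : Type*} [NormedAddCommGroup E] [InnerProductSpace ℝ E] :
    plancherelConst E ≠ ⊤ := ENNReal.ofReal_ne_top

theorem lintegral_expFourier_sq {h : E → ℂ} (h1 : Integrable h) (h2 : MemLp h 2 volume) :
    ∫⁻ Z, ‖expFourier h Z‖ₑ ^ 2 = plancherelConst E * ∫⁻ V, ‖h V‖ₑ ^ 2 := by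
  simp_rw [expFourier_eq_fourier]
  rw [lintegral_comp_smul_of_ne_zero (fun x => ‖𝓕 h x‖ₑ ^ 2) (by simp [Real.pi_ne_zero]),
    ← eLpNorm_two_sq, ← eLpNorm_two_sq, eLpNorm_fourier_two h1 h2, plancherelConst]

theorem aestronglyMeasurable_expFourier_prod {α : Type*} [MeasurableSpace α] {μ : Measure α}
    [SFinite μ] {h : α → E → ℂ}
    (hm : AEStronglyMeasurable (fun w : α × E => h w.1 w.2) (μ.prod volume)) :
    AEStronglyMeasurable (fun w : α × E => expFourier (h w.1) w.2) (μ.prod volume) := by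
  unfold expFourier
  refine AEStronglyMeasurable.integral_prod_right'
    (f := fun w : (α × E) × E => Complex.exp (Complex.I * (inner ℝ w.1.2 w.2 : ℂ)) * h w.1.1 w.2) ?_
  refine AEStronglyMeasurable.mul (Continuous.comp_aestronglyMeasurable
    (g := fun w : E × E => Complex.exp (Complex.I * (inner ℝ w.1 w.2 : ℂ)))
    (by fun_prop) (f := fun w : (α × E) × E => (w.1.2, w.2)) ?_) ?_
  · exact (measurable_snd.comp measurable_fst).aestronglyMeasurable.prodMk
      measurable_snd.aestronglyMeasurable
  · exact hm.comp_quasiMeasurePreserving (f := fun w : (α × E) × E => (w.1.1, w.2))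
      (QuasiMeasurePreserving.prodMap Measure.quasiMeasurePreserving_fst (.id _))

theorem ae_memLp_slice {α : Type*} [MeasurableSpace α] {μ : Measure α} {h : α → E → ℂ}
    (hm : MemLp (fun w : α × E => h w.1 w.2) 2 (μ.prod volume)) :
    ∀ᵐ x ∂μ, eLpNorm (h x) 2 volume < ⊤ := by
  have h3 : ∫⁻ w, ‖h w.1 w.2‖ₑ ^ 2 ∂(μ.prod volume) ≠ ⊤ := by
    rw [← eLpNorm_two_sq]; exact ENNReal.pow_ne_top hm.2.ne
  rw [lintegral_prod _ (hm.1.enorm.pow_const 2)] at h3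
  filter_upwards [ae_lt_top' (hm.1.enorm.pow_const 2).lintegral_prod_right' h3] with x hx
  rw [← eLpNorm_two_sq] at hx
  exact (ENNReal.pow_lt_top_iff.1 hx).resolve_right two_ne_zero

/-- Plancherel's formula with a parameter. -/
theorem eLpNorm_expFourier_prod {α : Type*} [MeasurableSpace α] {μ : Measure α}
    [SFinite μ] {h : α → E → ℂ}
    (hm : MemLp (fun w : α × E => h w.1 w.2) 2 (μ.prod volume))
    (hs : ∀ᵐ x ∂μ, Integrable (h x)) :
    eLpNorm (fun w : α × E => expFourier (h w.1) w.2) 2 (μ.prod volume) ^ 2 =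
      plancherelConst E * eLpNorm (fun w : α × E => h w.1 w.2) 2 (μ.prod volume) ^ 2 := by
  rw [eLpNorm_two_sq, eLpNorm_two_sq,
    lintegral_prod _ ((aestronglyMeasurable_expFourier_prod hm.1).enorm.pow_const 2),
    lintegral_prod _ (hm.1.enorm.pow_const 2),
    ← lintegral_const_mul' _ _ plancherelConst_ne_top]
  apply lintegral_congr_ae
  filter_upwards [hs, ae_memLp_slice hm] with x hx hx2
  exact lintegral_expFourier_sq hx ⟨hx.1, hx2⟩

theorem memLp_expFourier_prod {α : Type*} [MeasurableSpace α] {μ : Measure α}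
    [SFinite μ] {h : α → E → ℂ}
    (hm : MemLp (fun w : α × E => h w.1 w.2) 2 (μ.prod volume))
    (hs : ∀ᵐ x ∂μ, Integrable (h x)) :
    MemLp (fun w : α × E => expFourier (h w.1) w.2) 2 (μ.prod volume) := by
  refine ⟨aestronglyMeasurable_expFourier_prod hm.1, ?_⟩
  have h5 : plancherelConst E * eLpNorm (fun w : α × E => h w.1 w.2) 2 (μ.prod volume) ^ 2 < ⊤ :=
    ENNReal.mul_lt_top plancherelConst_ne_top.lt_top (ENNReal.pow_lt_top hm.2)
  rw [← eLpNorm_expFourier_prod hm hs] at h5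
  exact (ENNReal.pow_lt_top_iff.1 h5).resolve_right two_ne_zero

/-- The Fourier inverse of `expFourier` on smooth functions. -/
def spectralDensity (f : E → ℂ) (V : E) : ℂ :=
  (plancherelConst E)⁻¹.toReal * expFourier f (-V)

/-- The density is a rescaled Fourier transform of a Schwartz function. The rapid decay is what lets
it absorb the weight `|V|^(l-1)`. -/
theorem exists_schwartz_spectralDensity {f : E → ℂ} (hf : ContDiff ℝ ∞ f)
    (hc : HasCompactSupport f) : ∃ S : SchwartzMap E ℂ, ∀ V, S V = spectralDensity f V := by
  have hu : ((2 * Real.pi)⁻¹ : ℝ) ≠ 0 := by simp [Real.pi_ne_zero]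
  let e : E ≃L[ℝ] E := ContinuousLinearEquiv.smulLeft (Units.mk0 _ hu)
  refine ⟨((plancherelConst E)⁻¹.toReal : ℂ) •
    SchwartzMap.compCLMOfContinuousLinearEquiv ℂ e (𝓕 (hc.toSchwartzMap hf)), fun V => ?_⟩
  rw [spectralDensity, expFourier_eq_fourier]
  change _ * 𝓕 f ((2 * Real.pi)⁻¹ • V) = _
  simp

/-- Schwartz inversion after the substitution `V ↦ V / (2π)`, whose Jacobian cancels against the
inverse Plancherel constant. The identity holds at every `Z`, not only almost everywhere. -/
theorem expFourier_spectralDensity {f : E → ℂ} (hf : ContDiff ℝ ∞ f)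
    (hc : HasCompactSupport f) (Z : E) : expFourier (spectralDensity f) Z = f Z := by
  have hu : ((2 * Real.pi)⁻¹ : ℝ) ≠ 0 := by simp [Real.pi_ne_zero]
  let S : SchwartzMap E ℂ := hc.toSchwartzMap hf
  have h1 : 𝓕⁻ (𝓕 (S : E → ℂ)) = S := by
    rw [← SchwartzMap.fourier_coe, ← SchwartzMap.fourierInv_coe]
    simp
  have h2 : f Z = 𝓕⁻ (𝓕 (S : E → ℂ)) Z := by rw [h1]; rfl
  rw [h2, Real.fourierInv_eq', expFourier]
  have hint := Measure.integral_comp_smul (volume : Measure E) (fun W => Complex.exp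
    ((2 * Real.pi * inner ℝ W Z : ℝ) * Complex.I) • 𝓕 (S : E → ℂ) W) (2 * Real.pi)⁻¹
  have h3 : ∀ V : E, Complex.exp (Complex.I * (inner ℝ Z V : ℂ)) * spectralDensity f V =
      ((plancherelConst E)⁻¹.toReal : ℂ) * (Complex.exp
        ((2 * Real.pi * inner ℝ ((2 * Real.pi)⁻¹ • V) Z : ℝ) * Complex.I) •
          𝓕 (S : E → ℂ) ((2 * Real.pi)⁻¹ • V)) := by
    intro V
    rw [spectralDensity, expFourier_eq_fourier, neg_smul, smul_neg, neg_neg, smul_eq_mul]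
    rw [inner_smul_left, real_inner_comm]
    change _ * (_ * 𝓕 f _) = _ * (_ * 𝓕 f _)
    rw [mul_left_comm]
    congr 3
    have : (Real.pi : ℂ) ≠ 0 := by exact_mod_cast Real.pi_ne_zero
    simp only [conj_trivial]
    push_cast
    field_simp
  simp_rw [h3]
  rw [integral_const_mul, hint, ← Complex.coe_smul, smul_eq_mul, ← mul_assoc]
  convert one_mul _ using 2
  rw [plancherelConst, ENNReal.toReal_inv, ENNReal.toReal_ofReal (abs_nonneg _), neg_pow, mul_inv,
    abs_mul, ← Complex.ofReal_mul]
  have hpos : |((-1 : ℝ) ^ Module.finrank ℝ E)⁻¹| = 1 := by simp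
  rw [hpos, one_mul, inv_mul_cancel₀, Complex.ofReal_one]
  simp [Real.pi_ne_zero]

theorem integrable_of_schwartz_bound {h : E → ℂ} (S : SchwartzMap E ℂ) (hS : ∀ V, S V = h V)
    (k : ℕ) : Integrable (fun V => (‖V‖ ^ k : ℂ) * h V) := by
  have := S.integrable_pow_mul volume k
  refine Integrable.mono' this ?_ (.of_forall fun V => ?_)
  · have hh : h = S := (funext hS).symm
    rw [hh]
    exact (by fun_prop : Continuous fun V => (‖V‖ ^ k : ℂ) * S V).aestronglyMeasurable
  · rw [hS]; simp

end Plancherel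

/-! ### The measure of the spherical caps cut out by the tubes -/

section Caps

open scoped Pointwise

/-- The splitting of `ℝ ^ (k + 1)` into the first coordinate and the remaining ones. -/
def splitHead (k : ℕ) (x : ZSpace (k + 1)) : ℝ × ZSpace k :=
  (x 0, WithLp.toLp 2 (fun i => x i.succ))

theorem measurePreserving_splitHead (k : ℕ) :
    MeasurePreserving (splitHead k) volume (volume.prod volume) := by
  have h1 := volume_preserving_piFinSuccAbove (fun _ : Fin (k + 1) => ℝ) 0
  have h2 := (MeasurePreserving.id (volume : Measure ℝ)).prod (PiLp.volume_preserving_toLp (Fin k))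
  exact (h2.comp h1).comp (PiLp.volume_preserving_ofLp (Fin (k + 1)))

/-- The axis of `splitHead`. -/
def headVec (k : ℕ) : ZSpace (k + 1) := EuclideanSpace.single 0 1

theorem inner_headVec (k : ℕ) (x : ZSpace (k + 1)) : inner ℝ (headVec k) x = x 0 := by
  rw [headVec, EuclideanSpace.inner_single_left]
  simp
theorem norm_headVec (k : ℕ) : ‖headVec k‖ = 1 := by simp [headVec]

theorem norm_sub_inner_headVec (k : ℕ) (x : ZSpace (k + 1)) :
    ‖x - (inner ℝ (headVec k) x : ℝ) • headVec k‖ = ‖(splitHead k x).2‖ := by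
  rw [inner_headVec, EuclideanSpace.norm_eq, EuclideanSpace.norm_eq, Fin.sum_univ_succ]
  simp [headVec, splitHead, EuclideanSpace.single]

theorem exists_isometry_headVec (k : ℕ) {u : ZSpace (k + 1)} (hu : ‖u‖ = 1) :
    ∃ A : ZSpace (k + 1) ≃ₗᵢ[ℝ] ZSpace (k + 1), A u = headVec k :=
  ⟨_, Submodule.reflection_sub (hu.trans (norm_headVec k).symm)⟩

/-- The circular cone of slope `m` and height `b` around `u`. -/
def circularCone (k : ℕ) (u : ZSpace (k + 1)) (b m : ℝ) : Set (ZSpace (k + 1)) :=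
  {x | inner ℝ u x ∈ Set.Ioo 0 b ∧ ‖x - (inner ℝ u x : ℝ) • u‖ ≤ m * inner ℝ u x}

/-- A reflection carries `u` to the first axis; the slice at height `t` is then a ball of radius `m
t` in `ℝ ^ k`, and Fubini integrates `t ^ k` over `(0, b)`. -/
theorem volume_circularCone (k : ℕ) {u : ZSpace (k + 1)} (hu : ‖u‖ = 1) {b m : ℝ} (hb : 0 ≤ b)
    (hm : 0 ≤ m) : volume (circularCone k u b m) =
      ENNReal.ofReal (m ^ k * b ^ (k + 1) / (k + 1)) * volume (closedBall (0 : ZSpace k) 1) := by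
  obtain ⟨A, hA⟩ := exists_isometry_headVec k hu
  let T : Set (ℝ × ZSpace k) := {w | w.1 ∈ Set.Ioo 0 b ∧ ‖w.2‖ ≤ m * w.1}
  have hT : MeasurableSet T := by
    exact (measurable_fst measurableSet_Ioo).inter
      (measurableSet_le (f := fun w : ℝ × ZSpace k => ‖w.2‖) (g := fun w => m * w.1)
        (by fun_prop) (by fun_prop))
  have hcone : circularCone k u b m = A ⁻¹' (splitHead k ⁻¹' T) := by
    ext x
    have h1 : inner ℝ u x = inner ℝ (headVec k) (A x) := by rw [← hA, A.inner_map_map]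
    have h2 : ‖x - (inner ℝ u x : ℝ) • u‖ = ‖(splitHead k (A x)).2‖ := by
      rw [← norm_sub_inner_headVec, ← h1, ← hA, ← map_smul, ← map_sub, A.norm_map]
    simp only [circularCone, Set.mem_ofPred_eq, Set.mem_preimage, T]
    rw [h2, h1, inner_headVec]
    rfl
  rw [hcone, (A.measurePreserving.measure_preimage
      ((measurePreserving_splitHead k).measurable hT).nullMeasurableSet),
    (measurePreserving_splitHead k).measure_preimage hT.nullMeasurableSet,
    Measure.prod_apply hT]
  have hslice : ∀ t : ℝ, volume (Prod.mk t ⁻¹' T) = (Set.Ioo 0 b).indicator (fun t =>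
      ENNReal.ofReal (m ^ k * t ^ k) * volume (closedBall (0 : ZSpace k) 1)) t := by
    intro t
    by_cases ht : t ∈ Set.Ioo 0 b
    · rw [Set.indicator_of_mem ht, ← mul_pow]
      have : Prod.mk t ⁻¹' T = closedBall (0 : ZSpace k) (m * t) := by
        ext y
        simp only [T, Set.mem_preimage, Set.mem_ofPred_eq, mem_closedBall, dist_zero_right,
          and_iff_right ht]
      rw [this, Measure.addHaar_closedBall' _ _ (mul_nonneg hm ht.1.le)]
      simp
    · rw [Set.indicator_of_notMem ht]
      have : Prod.mk t ⁻¹' T = ∅ := by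
        ext y
        simp only [T, Set.mem_preimage, Set.mem_ofPred_eq, Set.mem_empty_iff_false, iff_false]
        exact fun h => ht h.1
      rw [this, measure_empty]
  simp_rw [hslice]
  rw [lintegral_indicator measurableSet_Ioo, lintegral_mul_const' _ _ measure_closedBall_lt_top.ne,
    ← ofReal_integral_eq_lintegral_ofReal]
  · congr 2
    rw [integral_const_mul, ← integral_Ioc_eq_integral_Ioo,
      ← intervalIntegral.integral_of_le hb, integral_pow]
    simp [mul_div_assoc]
  · exact (Continuous.integrableOn_Icc (by fun_prop)).mono_set Set.Ioo_subset_Icc_self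
  · filter_upwards [ae_restrict_mem measurableSet_Ioo] with t ht
    exact mul_nonneg (pow_nonneg hm _) (pow_nonneg ht.1.le _)

/-- The unit vectors whose tube of radius `δ` contains `V`. -/
def tubeCap {l : ℕ} (δ : ℝ) (V : ZSpace l) : Set (sphere (0 : ZSpace l) 1) :=
  {θ | V ∈ tube δ (θ : ZSpace l)}

theorem measurableSet_tubeCap {l : ℕ} (δ : ℝ) (V : ZSpace l) : MeasurableSet (tubeCap δ V) :=
  (measurableSet_le (f := fun _ => (0 : ℝ)) (g := fun θ : sphere (0 : ZSpace l) 1 =>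
      (inner ℝ V (θ : ZSpace l) : ℝ)) (by fun_prop) (by fun_prop)).inter
    (measurableSet_le (f := fun θ : sphere (0 : ZSpace l) 1 =>
      ‖V - (inner ℝ V (θ : ZSpace l) : ℝ) • (θ : ZSpace l)‖) (g := fun _ => δ)
      (by fun_prop) (by fun_prop))

theorem norm_sub_inner_smul_sq {l : ℕ} {u : ZSpace l} (hu : ‖u‖ = 1) (x : ZSpace l) :
    ‖x - (inner ℝ u x : ℝ) • u‖ ^ 2 = ‖x‖ ^ 2 - (inner ℝ u x) ^ 2 := by
  rw [norm_sub_sq_real, inner_smul_right, norm_smul, hu, real_inner_comm]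
  simp
  ring

theorem mem_tubeCap_iff {l : ℕ} {δ : ℝ} (hδ : 0 ≤ δ) {V : ZSpace l}
    (θ : sphere (0 : ZSpace l) 1) :
    θ ∈ tubeCap δ V ↔ 0 ≤ inner ℝ V θ ∧ ‖V‖ ^ 2 - (inner ℝ V θ) ^ 2 ≤ δ ^ 2 := by
  have h1 := norm_sub_inner_smul_sq (mem_sphere_zero_iff_norm.1 θ.2) V
  rw [real_inner_comm] at h1
  simp only [tubeCap, tube, Set.mem_ofPred_eq]
  rw [← h1, sq_le_sq₀ (norm_nonneg _) hδ]

/-- The part of the open unit ball that lies over `tubeCap`. -/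
theorem mem_smul_tubeCap_iff {l : ℕ} {δ : ℝ} (hδ : 0 ≤ δ) {V x : ZSpace l} :
    x ∈ Set.Ioo (0 : ℝ) 1 • ((↑) '' tubeCap δ V : Set (ZSpace l)) ↔
      0 < ‖x‖ ∧ ‖x‖ < 1 ∧ 0 ≤ inner ℝ V x ∧
        ‖V‖ ^ 2 * ‖x‖ ^ 2 - (inner ℝ V x) ^ 2 ≤ δ ^ 2 * ‖x‖ ^ 2 := by
  constructor
  · rintro ⟨s, hs, _, ⟨θ, hθ, rfl⟩, rfl⟩
    have hn : ‖(θ : ZSpace l)‖ = 1 := mem_sphere_zero_iff_norm.1 θ.2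
    rw [mem_tubeCap_iff hδ] at hθ
    simp only [norm_smul, hn, mul_one, Real.norm_of_nonneg hs.1.le, inner_smul_right]
    refine ⟨hs.1, hs.2, mul_nonneg hs.1.le hθ.1, ?_⟩
    nlinarith [mul_le_mul_of_nonneg_right hθ.2 (sq_nonneg s)]
  · rintro ⟨h0, h1, h2, h3⟩
    have hn : ‖‖x‖⁻¹ • x‖ = 1 := by
      rw [norm_smul, norm_inv, norm_norm, inv_mul_cancel₀ h0.ne']
    refine ⟨‖x‖, ⟨h0, h1⟩, _, ⟨⟨‖x‖⁻¹ • x, mem_sphere_zero_iff_norm.2 hn⟩, ?_, rfl⟩, ?_⟩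
    · rw [mem_tubeCap_iff hδ]
      simp only [inner_smul_right]
      refine ⟨by positivity, ?_⟩
      rw [mul_pow, inv_pow]
      have h4 : 0 < ‖x‖ ^ 2 := by positivity
      rw [← mul_le_mul_iff_left₀ h4]
      refine le_trans (le_of_eq ?_) h3
      rw [sub_mul, mul_right_comm, inv_mul_cancel₀ h4.ne', one_mul]
    · simp only [smul_smul]
      rw [mul_inv_cancel₀ h0.ne', one_smul]

/-- With `t = ⟨u,x⟩`, slope `r` gives `|x|² ≤ (1 + r²) t²`, and the height `√(1 - r²)` makes this
less than `1 - r⁴`, so the cone stays inside the unit ball. -/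
theorem circularCone_subset_smul_tubeCap {k : ℕ} {r : ℝ} (hr : 0 ≤ r)
    {u : ZSpace (k + 1)} (hu : ‖u‖ = 1) :
    circularCone k u (√(1 - r ^ 2)) r ⊆
      Set.Ioo (0 : ℝ) 1 • ((↑) '' tubeCap r u : Set (ZSpace (k + 1))) := by
  intro x hx
  obtain ⟨⟨h1, h2⟩, h3⟩ := hx
  rw [mem_smul_tubeCap_iff hr, hu]
  have h4 := norm_sub_inner_smul_sq hu x
  have h5 := pow_le_pow_left₀ (norm_nonneg _) h3 2
  rw [h4] at h5
  have h6 : inner ℝ u x ^ 2 < 1 - r ^ 2 := by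
    rwa [Real.lt_sqrt h1.le] at h2
  have h7 : inner ℝ u x ^ 2 ≤ ‖x‖ ^ 2 := by nlinarith [sq_nonneg ‖x - (inner ℝ u x : ℝ) • u‖]
  have h8 : 0 < ‖x‖ ^ 2 := lt_of_lt_of_le (by positivity) h7
  have hpos : 0 < ‖x‖ := by
    rcases (norm_nonneg x).eq_or_lt with h | h
    · rw [← h] at h8; norm_num at h8
    · exact h
  have h9 : ‖x‖ ^ 2 < 1 := by
    nlinarith [mul_nonneg (sq_nonneg r) (sq_nonneg (inner ℝ u x : ℝ)), sq_nonneg r]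
  refine ⟨hpos, by nlinarith, h1.le, ?_⟩
  nlinarith [mul_le_mul_of_nonneg_left h7 (sq_nonneg r)]

/-- Over the cap `⟨u,x⟩² ≥ (1 - r²) |x|²`, so the distance from the axis, at most `r |x|`, is at
most `r / √(1 - r²)` times the height. -/
theorem smul_tubeCap_subset_circularCone {k : ℕ} {r : ℝ} (hr : 0 ≤ r) (hr1 : r < 1)
    {u : ZSpace (k + 1)} (hu : ‖u‖ = 1) :
    Set.Ioo (0 : ℝ) 1 • ((↑) '' tubeCap r u : Set (ZSpace (k + 1))) ⊆
      circularCone k u 1 (r / √(1 - r ^ 2)) := by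
  intro x hx
  rw [mem_smul_tubeCap_iff hr, hu] at hx
  obtain ⟨h1, h2, h3, h4⟩ := hx
  have h5 := norm_sub_inner_smul_sq hu x
  have h6 : 0 < 1 - r ^ 2 := by nlinarith
  have h7 : inner ℝ u x ^ 2 ≤ ‖x‖ ^ 2 := by nlinarith [sq_nonneg ‖x - (inner ℝ u x : ℝ) • u‖]
  have h8 : 0 < ‖x‖ ^ 2 := by positivity
  have h9 : (1 - r ^ 2) * ‖x‖ ^ 2 ≤ inner ℝ u x ^ 2 := by linarith
  have h10 : 0 < inner ℝ u x := by
    rcases h3.eq_or_lt with h | h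
    · rw [← h] at h9
      have := mul_pos h6 h8
      norm_num at h9
      linarith
    · exact h
  refine ⟨⟨h10, by nlinarith⟩, ?_⟩
  rw [← sq_le_sq₀ (norm_nonneg _) (by positivity), h5, mul_pow, div_pow, Real.sq_sqrt h6.le,
    div_mul_eq_mul_div, le_div_iff₀ h6]
  nlinarith

theorem tubeCap_smul {l : ℕ} {δ c : ℝ} (hδ : 0 ≤ δ) (hc : 0 < c) (V : ZSpace l) :
    tubeCap (c * δ) (c • V) = tubeCap δ V := by
  ext θ
  rw [mem_tubeCap_iff (mul_nonneg hc.le hδ), mem_tubeCap_iff hδ, norm_smul,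
    Real.norm_of_nonneg hc.le, inner_smul_left]
  simp only [conj_trivial]
  rw [mul_pow, mul_pow, mul_pow, ← mul_sub, mul_le_mul_iff_right₀ (by positivity),
    mul_nonneg_iff_of_pos_left hc]

/-- The measure of `tubeCap`. -/
def capMeasure {l : ℕ} (δ : ℝ) (V : ZSpace l) : ℝ :=
  (volume : Measure (ZSpace l)).toSphere.real (tubeCap δ V)

theorem discVol_eq (l : ℕ) {δ : ℝ} (hδ : 0 ≤ δ) :
    discVol l δ = δ ^ (l - 1) * volume.real (closedBall (0 : ZSpace (l - 1)) 1) := by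
  rw [discVol, Measure.addHaar_real_closedBall' _ _ hδ]
  simp

theorem volume_real_closedBall_pos (k : ℕ) : 0 < volume.real (closedBall (0 : ZSpace k) 1) :=
  ENNReal.toReal_pos (measure_closedBall_pos _ _ one_pos).ne' measure_closedBall_lt_top.ne

/-- The surface measure of a cap is the dimension times the volume of the sector over it, and this
sector lies between two circular cones. Both bounds are `discVol` times a factor that tends to `1`
as `r → 0`. -/
theorem capMeasure_bounds {k : ℕ} {r : ℝ} (hr : 0 ≤ r) (hr1 : r < 1)
    {u : ZSpace (k + 1)} (hu : ‖u‖ = 1) :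
    discVol (k + 1) r * (√(1 - r ^ 2)) ^ (k + 1) ≤ capMeasure r u ∧
      capMeasure r u ≤ discVol (k + 1) r * ((√(1 - r ^ 2))⁻¹) ^ k := by
  have hv : capMeasure r u = (k + 1) * volume.real
      (Set.Ioo (0 : ℝ) 1 • ((↑) '' tubeCap r u : Set (ZSpace (k + 1)))) := by
    rw [capMeasure, measureReal_def, Measure.toSphere_apply' _ (measurableSet_tubeCap _ _),
      ENNReal.toReal_mul, measureReal_def, finrank_euclideanSpace_fin, ENNReal.toReal_natCast]
    push_cast
    rfl
  have hcone : ∀ b m : ℝ, 0 ≤ b → 0 ≤ m → volume.real (circularCone k u b m) =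
      m ^ k * b ^ (k + 1) / (k + 1) * volume.real (closedBall (0 : ZSpace k) 1) := by
    intro b m hb hm
    rw [measureReal_def, volume_circularCone k hu hb hm, ENNReal.toReal_mul,
      ENNReal.toReal_ofReal (by positivity), measureReal_def]
  have hfin : ∀ b m : ℝ, 0 ≤ b → 0 ≤ m → volume (circularCone k u b m) ≠ ⊤ := by
    intro b m hb hm
    rw [volume_circularCone k hu hb hm]
    exact ENNReal.mul_ne_top ENNReal.ofReal_ne_top measure_closedBall_lt_top.ne
  have hs := Real.sqrt_nonneg (1 - r ^ 2)
  have hd := discVol_eq (k + 1) hr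
  rw [Nat.add_sub_cancel] at hd
  have hk : (0 : ℝ) < k + 1 := by positivity
  have hd0 : 0 ≤ r / √(1 - r ^ 2) := by positivity
  constructor
  · have h1 := measureReal_mono (circularCone_subset_smul_tubeCap hr hu)
      (measure_ne_top_of_subset (smul_tubeCap_subset_circularCone hr hr1 hu)
        (hfin _ _ zero_le_one hd0))
    rw [hcone _ _ hs hr] at h1
    rw [hv, hd]
    refine le_trans (le_of_eq ?_) (mul_le_mul_of_nonneg_left h1 hk.le)
    field_simp
  · have h1 := measureReal_mono (smul_tubeCap_subset_circularCone hr hr1 hu)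
        (hfin _ _ zero_le_one hd0)
    rw [hcone _ _ zero_le_one hd0] at h1
    rw [hv, hd]
    refine (mul_le_mul_of_nonneg_left h1 hk.le).trans (le_of_eq ?_)
    rw [div_pow, inv_pow]
    field_simp
    simp

/-- The density of the caps `tubeCap δ V`. -/
def capDensity {l : ℕ} (δ : ℝ) (V : ZSpace l) : ℝ := (discVol l δ)⁻¹ * capMeasure δ V

theorem norm_unitVec {l : ℕ} {V : ZSpace l} (hV : V ≠ 0) : ‖unitVec V‖ = 1 := by
  rw [unitVec, norm_smul, norm_inv, norm_norm, inv_mul_cancel₀ (norm_ne_zero_iff.2 hV)]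

/-- Caps are unchanged when `V` and `δ` are scaled together, while `discVol` is homogeneous of
degree `l - 1` in `δ`. This is the source of the weight `|V|^(l-1)`. -/
theorem capDensity_eq {l : ℕ} {δ : ℝ} (hδ : 0 < δ) {V : ZSpace l} (hV : V ≠ 0) :
    capDensity δ V = (‖V‖ ^ (l - 1))⁻¹ * capDensity (‖V‖⁻¹ * δ) (unitVec V) := by
  have hn : 0 < ‖V‖ := norm_pos_iff.2 hV
  rw [capDensity, capDensity, capMeasure, capMeasure, unitVec,
    tubeCap_smul hδ.le (inv_pos.2 hn), discVol_eq l hδ.le, discVol_eq l (by positivity)]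
  rw [← mul_assoc, ← mul_inv, mul_pow, inv_pow]
  congr 2
  field_simp

theorem tendsto_capDensity {l : ℕ} (hl : 1 ≤ l) {V : ZSpace l} (hV : V ≠ 0) :
    Tendsto (fun δ => capDensity δ V) (𝓝[>] 0) (𝓝 (‖V‖ ^ (l - 1))⁻¹) := by
  obtain ⟨k, rfl⟩ := Nat.exists_eq_add_of_le' hl
  have hn : 0 < ‖V‖ := norm_pos_iff.2 hV
  have key : Tendsto (fun r => capDensity r (unitVec V)) (𝓝[>] 0) (𝓝 1) := by
    have hlow : Tendsto (fun r : ℝ => (√(1 - r ^ 2)) ^ (k + 1)) (𝓝[>] 0) (𝓝 1) := by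
      have : ContinuousAt (fun r : ℝ => (√(1 - r ^ 2)) ^ (k + 1)) 0 := by fun_prop
      have h := this.tendsto
      norm_num at h
      exact h.mono_left nhdsWithin_le_nhds
    have hup : Tendsto (fun r : ℝ => ((√(1 - r ^ 2))⁻¹) ^ k) (𝓝[>] 0) (𝓝 1) := by
      have : ContinuousAt (fun r : ℝ => ((√(1 - r ^ 2))⁻¹) ^ k) 0 := by
        have h0 : √(1 - (0 : ℝ) ^ 2) ≠ 0 := by norm_num
        fun_prop (disch := assumption)
      have h := this.tendsto
      norm_num at h
      simpa using h.mono_left nhdsWithin_le_nhds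
    refine tendsto_of_tendsto_of_tendsto_of_le_of_le' hlow hup ?_ ?_
    all_goals
      filter_upwards [Ioo_mem_nhdsGT (one_pos : (0 : ℝ) < 1)] with r hr
      have hb := capMeasure_bounds hr.1.le hr.2 (norm_unitVec hV)
      have hd : 0 < discVol (k + 1) r := by
        rw [discVol_eq _ hr.1.le]
        exact mul_pos (pow_pos hr.1 _) (volume_real_closedBall_pos _)
      rw [capDensity]
    · rw [le_inv_mul_iff₀ hd]; exact hb.1
    · rw [inv_mul_le_iff₀ hd]; exact hb.2
  have hscale : Tendsto (fun δ : ℝ => ‖V‖⁻¹ * δ) (𝓝[>] 0) (𝓝[>] 0) := by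
    refine tendsto_nhdsWithin_iff.2 ⟨?_, ?_⟩
    · have : Tendsto (fun δ : ℝ => ‖V‖⁻¹ * δ) (𝓝 0) (𝓝 (‖V‖⁻¹ * 0)) :=
        tendsto_id.const_mul _
      rw [mul_zero] at this
      exact this.mono_left nhdsWithin_le_nhds
    · filter_upwards [self_mem_nhdsWithin] with δ hδ
      exact mul_pos (inv_pos.2 hn) hδ
  have h2 := (key.comp hscale).const_mul (‖V‖ ^ (k + 1 - 1))⁻¹
  rw [mul_one] at h2
  refine h2.congr' ?_
  filter_upwards [self_mem_nhdsWithin] with δ hδ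
  exact (capDensity_eq hδ hV).symm

theorem exists_capDensity_le {l : ℕ} (hl : 1 ≤ l) : ∃ C : ℝ, 0 ≤ C ∧
    ∀ δ : ℝ, 0 < δ → ∀ V : ZSpace l, V ≠ 0 → capDensity δ V ≤ C * (‖V‖ ^ (l - 1))⁻¹ := by
  obtain ⟨k, rfl⟩ := Nat.exists_eq_add_of_le' hl
  set σ := (volume : Measure (ZSpace (k + 1))).toSphere
  set D := discVol (k + 1) (1 / 2)
  have hD : 0 < D := by
    rw [show D = _ from discVol_eq _ (by norm_num)]
    exact mul_pos (by positivity) (volume_real_closedBall_pos _)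
  have h0 : 0 ≤ D⁻¹ * σ.real Set.univ := mul_nonneg (inv_nonneg.2 hD.le) measureReal_nonneg
  -- After rescaling to a unit vector with radius `r`: for `r < 1/2` the cone bound applies with
  -- `(√(1 - r²))⁻¹ ≤ 2`; for `r ≥ 1/2` the cap is at most the whole sphere and the disc at least
  -- the one of radius `1/2`.
  refine ⟨2 ^ k + D⁻¹ * σ.real Set.univ, by positivity, fun δ hδ V hV => ?_⟩
  have hn : 0 < ‖V‖ := norm_pos_iff.2 hV
  rw [capDensity_eq hδ hV, mul_comm]
  refine mul_le_mul_of_nonneg_right ?_ (by positivity)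
  have hr : 0 < ‖V‖⁻¹ * δ := by positivity
  generalize ‖V‖⁻¹ * δ = r at hr
  have hd : 0 < discVol (k + 1) r := by
    rw [discVol_eq _ hr.le]
    exact mul_pos (pow_pos hr _) (volume_real_closedBall_pos _)
  rcases lt_or_ge r (1 / 2) with h | h
  · refine le_trans ?_ (le_add_of_nonneg_right h0)
    rw [capDensity, inv_mul_le_iff₀ hd]
    refine (capMeasure_bounds hr.le (by linarith) (norm_unitVec hV)).2.trans ?_
    refine mul_le_mul_of_nonneg_left (pow_le_pow_left₀ (by positivity) ?_ _) hd.le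
    rw [inv_le_comm₀ (Real.sqrt_pos.2 (by nlinarith)) two_pos]
    apply Real.le_sqrt_of_sq_le
    nlinarith
  · refine le_trans ?_ (le_add_of_nonneg_left (by positivity))
    refine mul_le_mul ?_ (measureReal_mono (Set.subset_univ _)) measureReal_nonneg (by positivity)
    exact inv_anti₀ hD (measureReal_mono (closedBall_subset_closedBall h)
      measure_closedBall_lt_top.ne)

end Caps

/-! ### Polar coordinates and null sets of directions -/

section Polar

variable {l : ℕ}

/-- The surface measure of the unit sphere of the Z-space. -/
abbrev sphereVol (l : ℕ) : Measure (sphere (0 : ZSpace l) 1) :=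
  (volume : Measure (ZSpace l)).toSphere

theorem ae_ne_zero (hl : 1 ≤ l) : ∀ᵐ V : ZSpace l, V ≠ 0 := by
  have : Nonempty (Fin l) := ⟨⟨0, hl⟩⟩
  exact Measure.ae_ne volume 0

theorem homeomorphUnitSphereProd_fst (V : ({0}ᶜ : Set (ZSpace l))) :
    ((homeomorphUnitSphereProd (ZSpace l) V).1 : ZSpace l) = unitVec (V : ZSpace l) := by
  simp [unitVec]

theorem homeomorphUnitSphereProd_symm_coe (w : sphere (0 : ZSpace l) 1 × Set.Ioi (0 : ℝ)) :
    (((homeomorphUnitSphereProd (ZSpace l)).symm w : ({0}ᶜ : Set (ZSpace l))) : ZSpace l) =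
      (w.2 : ℝ) • (w.1 : ZSpace l) := by
  simp

/-- In polar coordinates Lebesgue measure is the product of the surface measure and a nonzero radial
measure, so null sets of directions correspond to null cones. Nonvanishing of the radial factor is
needed for the passage from vectors to directions. -/
theorem ae_unitVec_iff (hl : 1 ≤ l) (p : ZSpace l → Prop) :
    (∀ᵐ V : ZSpace l, p (unitVec V)) ↔ ∀ᵐ θ : sphere (0 : ZSpace l) 1 ∂(sphereVol l), p θ := by
  have hmp := (volume : Measure (ZSpace l)).measurePreserving_homeomorphUnitSphereProd
  have hemb := (homeomorphUnitSphereProd (ZSpace l)).measurableEmbedding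
  have h1 : (∀ᵐ V : ZSpace l, p (unitVec V)) ↔
      ∀ᵐ V : ({0}ᶜ : Set (ZSpace l)) ∂(Measure.comap (↑) (volume : Measure (ZSpace l))),
        p (unitVec (V : ZSpace l)) := by
    rw [← ae_restrict_iff_subtype (measurableSet_singleton (0 : ZSpace l)).compl
      (p := fun V => p (unitVec V))]
    rw [ae_restrict_iff' (measurableSet_singleton (0 : ZSpace l)).compl]
    constructor
    · intro h; filter_upwards [h] with V hV _ using hV
    · intro h; filter_upwards [h, ae_ne_zero hl] with V hV h0 using hV h0
  have h2 : (∀ᵐ V : ({0}ᶜ : Set (ZSpace l)) ∂(Measure.comap (↑) (volume : Measure (ZSpace l))),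
        p (unitVec (V : ZSpace l))) ↔
      ∀ᵐ w ∂((sphereVol l).prod (Measure.volumeIoiPow (Module.finrank ℝ (ZSpace l) - 1))),
        p (w.1 : ZSpace l) := by
    rw [← hmp.map_eq, hemb.ae_map_iff]
    simp_rw [homeomorphUnitSphereProd_fst]
  rw [h1, h2]
  have hne : Measure.volumeIoiPow (Module.finrank ℝ (ZSpace l) - 1) ≠ 0 := by
    intro h
    have h3 := Measure.volumeIoiPow_apply_Iio (Module.finrank ℝ (ZSpace l) - 1) ⟨1, Set.mem_Ioi.2 one_pos⟩
    rw [h, Measure.coe_zero, Pi.zero_apply, eq_comm, ENNReal.ofReal_eq_zero] at h3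
    have : (0 : ℝ) < 1 ^ (Module.finrank ℝ (ZSpace l) - 1 + 1) /
      ((Module.finrank ℝ (ZSpace l) - 1 : ℕ) + 1) := by positivity
    exact absurd h3 (not_le.2 this)
  have : NeZero (Measure.volumeIoiPow (Module.finrank ℝ (ZSpace l) - 1)) := ⟨hne⟩
  constructor
  · intro h
    filter_upwards [Measure.ae_ae_of_ae_prod h] with θ hθ
    exact Filter.eventually_const.1 hθ
  · intro h
    exact Measure.quasiMeasurePreserving_fst.ae h

/-- Integration in polar coordinates. -/
theorem integral_polar (hl : 1 ≤ l) {f : ZSpace l → ℂ} (hf : Integrable f) :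
    ∫ V, f V = ∫ θ, (∫ s in Set.Ioi (0 : ℝ), (s ^ (l - 1) : ℂ) * f (s • (θ : ZSpace l)))
      ∂(sphereVol l) := by
  have hmp := (volume : Measure (ZSpace l)).measurePreserving_homeomorphUnitSphereProd
  have hemb := (homeomorphUnitSphereProd (ZSpace l)).measurableEmbedding
  have : Nonempty (Fin l) := ⟨⟨0, hl⟩⟩
  let g : sphere (0 : ZSpace l) 1 × Set.Ioi (0 : ℝ) → ℂ := fun w => f ((w.2 : ℝ) • (w.1 : ZSpace l))
  have hg : ∀ V : ({0}ᶜ : Set (ZSpace l)), g (homeomorphUnitSphereProd (ZSpace l) V) = f V := by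
    intro V
    simp only [g]
    rw [← homeomorphUnitSphereProd_symm_coe, Homeomorph.symm_apply_apply]
  have h1 : ∫ V, f V = ∫ V : ({0}ᶜ : Set (ZSpace l)), f V ∂(Measure.comap (↑) (volume : Measure (ZSpace l))) := by
    rw [integral_subtype_comap (measurableSet_singleton _).compl f, restrict_compl_singleton]
  have h2 : Integrable g ((sphereVol l).prod
      (Measure.volumeIoiPow (Module.finrank ℝ (ZSpace l) - 1))) := by
    rw [← hmp.integrable_comp_emb hemb]
    have h3 : IntegrableOn f ({0}ᶜ : Set (ZSpace l)) := hf.integrableOn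
    rw [integrableOn_iff_comap_subtypeVal (measurableSet_singleton _).compl] at h3
    refine h3.congr (.of_forall fun V => ?_)
    exact (hg V).symm
  rw [h1, ← integral_congr_ae (.of_forall hg), hmp.integral_comp hemb, integral_prod _ h2]
  congr 1
  ext θ
  simp only [g, finrank_euclideanSpace_fin]
  rw [← integral_subtype_comap measurableSet_Ioi
    (fun s : ℝ => (s ^ (l - 1) : ℂ) * f (s • (θ : ZSpace l)))]
  rw [Measure.volumeIoiPow]
  simp only [ENNReal.ofReal]
  rw [integral_withDensity_eq_integral_smul
    (measurable_subtype_coe.pow_const _).real_toNNReal]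
  congr 1
  ext s
  rw [NNReal.smul_def, Real.coe_toNNReal _ (pow_nonneg (le_of_lt s.2) _)]
  simp

end Polar

/-! ### Linear substitutions in polynomials -/

section LinearSubstitution

open MvPolynomial

variable {κ ι ι' : Type*} [Fintype ι] [Fintype ι']

/-- The linear change of variables in polynomials. -/
def linSubst (A : Matrix κ ι ℂ) : MvPolynomial κ ℂ →ₐ[ℂ] MvPolynomial ι ℂ :=
  bind₁ (fun c => ∑ u, C (A c u) * X u)

theorem eval_linSubst (A : Matrix κ ι ℂ) (P : MvPolynomial κ ℂ) (y : ι → ℂ) :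
    eval y (linSubst A P) = eval (A.mulVec y) P := by
  rw [linSubst, ← coe_aeval_eq_eval, ← coe_aeval_eq_eval]
  simp only [RingHom.coe_coe, aeval_bind₁]
  congr 2
  ext c
  simp [Matrix.mulVec, dotProduct]

theorem linSubst_linSubst (A : Matrix κ ι ℂ) (B : Matrix ι ι' ℂ) (P : MvPolynomial κ ℂ) :
    linSubst B (linSubst A P) = linSubst (A * B) P :=
  MvPolynomial.funext fun y => by simp only [eval_linSubst, Matrix.mulVec_mulVec]

theorem linSubst_one [Fintype κ] [DecidableEq κ] (P : MvPolynomial κ ℂ) : linSubst (1 : Matrix κ κ ℂ) P = P :=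
  MvPolynomial.funext fun y => by rw [eval_linSubst, Matrix.one_mulVec]

theorem totalDegree_linSubst_le (A : Matrix κ ι ℂ) (P : MvPolynomial κ ℂ) :
    (linSubst A P).totalDegree ≤ P.totalDegree := by
  have h1 : ∀ c, (∑ u, C (A c u) * X u : MvPolynomial ι ℂ).totalDegree ≤ 1 := by
    intro c
    refine totalDegree_finsetSum_le fun u _ => ?_
    refine (totalDegree_mul _ _).trans ?_
    simp [totalDegree_X]
  rw [linSubst, bind₁, aeval_def, eval₂_eq]
  refine totalDegree_finsetSum_le fun d hd => ?_
  refine (totalDegree_mul _ _).trans ?_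
  have h2 : (∏ i ∈ d.support, (∑ u, C (A i u) * X u : MvPolynomial ι ℂ) ^ d i).totalDegree ≤
      ∑ i ∈ d.support, d i := by
    refine (totalDegree_finsetProd _ _).trans (Finset.sum_le_sum fun i _ => ?_)
    refine (totalDegree_pow _ _).trans ?_
    simpa using Nat.mul_le_mul_left (d i) (h1 i)
  have h3 := le_totalDegree hd
  simp only [algebraMap_eq, totalDegree_C, zero_add]
  exact h2.trans h3

/-- Each coefficient is a polynomial in the entries of `A`; the induction carries all exponents `m`
at once because a product mixes them. -/
theorem continuous_coeff_linSubst (P : MvPolynomial κ ℂ) :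
    ∀ m : ι →₀ ℕ, Continuous fun A : Matrix κ ι ℂ => coeff m (linSubst A P) := by
  classical
  have hmul : ∀ p q : Matrix κ ι ℂ → MvPolynomial ι ℂ, (∀ m, Continuous fun A => coeff m (p A)) →
      (∀ m, Continuous fun A => coeff m (q A)) → ∀ m, Continuous fun A => coeff m (p A * q A) := by
    intro p q hp hq m
    simp_rw [coeff_mul]
    exact continuous_finsetSum _ fun x _ => (hp _).mul (hq _)
  induction P using MvPolynomial.induction_on with
  | C a =>
    intro m
    simp only [linSubst, bind₁_C_right, coeff_C]
    exact continuous_const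
  | add p q hp hq =>
    intro m
    simp only [map_add, coeff_add]
    exact (hp m).add (hq m)
  | mul_X p c hp =>
    simp only [map_mul]
    refine hmul _ _ hp fun m => ?_
    simp only [linSubst, bind₁_X_right, coeff_sum, coeff_C_mul]
    refine continuous_finsetSum _ fun u _ => ?_
    exact (continuous_id.matrix_elem c u).mul continuous_const

/-- The real numbers form an infinite subset of `ℂ`, so real points separate complex polynomials.
This yields uniqueness of the representation `P_θ`. -/
theorem eval_ofReal_injective [Finite κ] {P P' : MvPolynomial κ ℂ}
    (h : ∀ x : κ → ℝ, eval (fun c => (x c : ℂ)) P = eval (fun c => (x c : ℂ)) P') : P = P' := by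
  refine funext_set (fun _ => Set.range ((↑) : ℝ → ℂ))
    (fun _ => Set.infinite_range_of_injective Complex.ofReal_injective) fun x hx => ?_
  choose y hy using fun c => hx c (Set.mem_univ c)
  have : x = fun c => (y c : ℂ) := funext fun c => (hy c).symm
  rw [this]
  exact h y

end LinearSubstitution

/-! ### The complex representation of a polynomial in a frame -/

section Frames

variable {l N r n : ℕ}

/-- The index set of the real frame `Q_1, …, Q_n, J Q_1, …, J Q_n`. -/
abbrev FrameIdx (n : ℕ) : Type := Fin n ⊕ Fin n

/-- The index set of the coordinates of the X-space. -/
abbrev CoordIdx (N r : ℕ) : Type := Fin N × Fin r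

/-- The matrix with rows `b u`. -/
def rowMatrix (b : FrameIdx n → XSpace N r) : Matrix (FrameIdx n) (CoordIdx N r) ℝ :=
  Matrix.of fun u c => b u c

theorem frameGram_eq (J : ZSpace l → XSpace N r → XSpace N r)
    (Q : ZSpace l → Fin n → XSpace N r) (θ : ZSpace l) :
    frameGram J Q θ = (rowMatrix (realFrame J Q θ) * (rowMatrix (realFrame J Q θ)).transpose).det := by
  rw [frameGram]
  congr 1
  ext u v
  simp [rowMatrix, Matrix.mul_apply, PiLp.inner_apply, mul_comm]

/-- The passage from `x, y` to `x + 𝐢 y, x - 𝐢 y`. -/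
def complexify (n : ℕ) : Matrix (FrameIdx n) (FrameIdx n) ℂ :=
  Matrix.fromBlocks 1 (Complex.I • 1) 1 (-Complex.I • 1)

/-- The inverse of `complexify`. -/
def complexifyInv (n : ℕ) : Matrix (FrameIdx n) (FrameIdx n) ℂ :=
  Matrix.fromBlocks ((1 / 2 : ℂ) • 1) ((1 / 2 : ℂ) • 1)
    ((-Complex.I / 2) • 1) ((Complex.I / 2) • 1)

theorem complexify_mul_inv : complexify n * complexifyInv n = 1 := by
  rw [complexify, complexifyInv, Matrix.fromBlocks_multiply, ← Matrix.fromBlocks_one]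
  have hI : Complex.I * (-Complex.I / 2) = 1 / 2 := by
    rw [mul_div_assoc', mul_neg, Complex.I_mul_I]; norm_num
  have hI2 : Complex.I * (Complex.I / 2) = -1 / 2 := by
    rw [mul_div_assoc', Complex.I_mul_I]
  congr 1 <;>
  · simp only [Matrix.one_mul, Matrix.smul_mul, smul_smul, ← add_smul, neg_mul, hI, hI2]
    norm_num

/-- The matrix expressing the complex coordinates and their conjugates by the real coordinates. -/
def coordMatrix (B : Matrix (FrameIdx n) (CoordIdx N r) ℝ) :
    Matrix (FrameIdx n) (CoordIdx N r) ℂ :=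
  complexify n * B.map Complex.ofRealHom

/-- The inverse of `coordMatrix`. -/
def coordMatrixInv (B : Matrix (FrameIdx n) (CoordIdx N r) ℝ) :
    Matrix (CoordIdx N r) (FrameIdx n) ℂ :=
  (B.transpose * ((B * B.transpose).det⁻¹ • (B * B.transpose).adjugate)).map Complex.ofRealHom *
    complexifyInv n

/-- `Bᵀ (B Bᵀ)⁻¹` is a right inverse of `B`. Written with the adjugate, its only denominator is the
Gram determinant, which makes the dependence on the frame visibly continuous off the zeros of that
determinant. -/
theorem coordMatrix_mul_inv {B : Matrix (FrameIdx n) (CoordIdx N r) ℝ}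
    (hB : (B * B.transpose).det ≠ 0) : coordMatrix B * coordMatrixInv B = 1 := by
  rw [coordMatrix, coordMatrixInv, Matrix.mul_assoc, ← Matrix.mul_assoc (B.map _), ← Matrix.map_mul,
    ← Matrix.mul_assoc B, Matrix.mul_smul, Matrix.mul_adjugate, smul_smul, inv_mul_cancel₀ hB,
    one_smul, Matrix.map_one _ (map_zero _) (map_one _), Matrix.one_mul, complexify_mul_inv]

/-- The values of the complex coordinates and their conjugates. -/
def coordVal (J : ZSpace l → XSpace N r → XSpace N r) (Q : ZSpace l → Fin n → XSpace N r)
    (θ : ZSpace l) (X : XSpace N r) : FrameIdx n → ℂ :=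
  Sum.elim (fun i => zCoord J Q θ i X) (fun i => (starRingEnd ℂ) (zCoord J Q θ i X))

theorem coordVal_eq (J : ZSpace l → XSpace N r → XSpace N r) (Q : ZSpace l → Fin n → XSpace N r)
    (θ : ZSpace l) (X : XSpace N r) :
    coordVal J Q θ X =
      (coordMatrix (rowMatrix (realFrame J Q θ))).mulVec (fun c => (X c : ℂ)) := by
  have hB : ((rowMatrix (realFrame J Q θ)).map Complex.ofRealHom).mulVec
      (fun c => (X c : ℂ)) = fun u => (inner ℝ (realFrame J Q θ u) X : ℂ) := by
    ext u
    simp [rowMatrix, Matrix.mulVec, dotProduct, PiLp.inner_apply, mul_comm]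
  rw [coordMatrix, ← Matrix.mulVec_mulVec, complexify, hB, Matrix.fromBlocks_mulVec]
  ext u
  rcases u with i | i
  · simp [coordVal, zCoord, Matrix.smul_mulVec, realFrame]
  · simp [coordVal, zCoord, Matrix.smul_mulVec, realFrame, Matrix.neg_mulVec]

theorem evalCoord_eq_evalX (J : ZSpace l → XSpace N r → XSpace N r)
    (Q : ZSpace l → Fin n → XSpace N r) (R : MvPolynomial (FrameIdx n) ℂ) (θ : ZSpace l)
    (X : XSpace N r) : evalCoord J Q R θ X =
      evalX (linSubst (coordMatrix (rowMatrix (realFrame J Q θ))) R) X := by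
  rw [evalX, eval_linSubst, ← coordVal_eq]
  rfl

theorem evalX_injective {P P' : MvPolynomial (CoordIdx N r) ℂ}
    (h : ∀ X : XSpace N r, evalX P X = evalX P' X) : P = P' :=
  eval_ofReal_injective fun x => h (WithLp.toLp 2 x)

/-- The coefficients of the complex representation of `P`, in dependence of the frame. -/
def frameRep (P : MvPolynomial (CoordIdx N r) ℂ) (b : FrameIdx n → XSpace N r) :
    MvPolynomial (FrameIdx n) ℂ :=
  linSubst (coordMatrixInv (rowMatrix b)) P

/-- By the equality `n + n = N * r` the coordinate matrix has equally many rows and columns, so its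
right inverse is also a left inverse. -/
theorem evalCoord_frameRep {J : ZSpace l → XSpace N r → XSpace N r}
    {Q : ZSpace l → Fin n → XSpace N r} {θ : ZSpace l}
    (hcard : n + n = N * r) (hG : frameGram J Q θ ≠ 0) (P : MvPolynomial (CoordIdx N r) ℂ)
    (X : XSpace N r) : evalCoord J Q (frameRep P (realFrame J Q θ)) θ X = evalX P X := by
  rw [frameGram_eq] at hG
  rw [evalCoord_eq_evalX, frameRep, linSubst_linSubst,
    (Matrix.mul_eq_one_comm_of_card_eq _ _ _ (by simp [hcard])).1 (coordMatrix_mul_inv hG), linSubst_one]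

/-- `complexRep` is made by choice and has no evident regularity in `θ`. Uniqueness of the
representation identifies it with `frameRep`, whose coefficients vary continuously with the frame.
-/
theorem complexRep_eq {J : ZSpace l → XSpace N r → XSpace N r}
    {Q : ZSpace l → Fin n → XSpace N r} {θ : ZSpace l}
    (hcard : n + n = N * r) (hG : frameGram J Q θ ≠ 0) (P : MvPolynomial (CoordIdx N r) ℂ) :
    complexRep J Q P θ = frameRep P (realFrame J Q θ) := by
  have hex : ∃ R : MvPolynomial (FrameIdx n) ℂ, ∀ X, evalCoord J Q R θ X = evalX P X :=
    ⟨_, evalCoord_frameRep hcard hG P⟩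
  rw [complexRep, dif_pos hex]
  have h2 : linSubst (coordMatrix (rowMatrix (realFrame J Q θ))) hex.choose = P :=
    evalX_injective fun X => by rw [← evalCoord_eq_evalX, hex.choose_spec]
  rw [frameGram_eq] at hG
  conv_rhs => rw [← h2]
  rw [frameRep, linSubst_linSubst, coordMatrix_mul_inv hG, linSubst_one]

theorem continuousAt_coeff_frameRep (P : MvPolynomial (CoordIdx N r) ℂ) (m : FrameIdx n →₀ ℕ)
    {b : FrameIdx n → XSpace N r}
    (hb : (rowMatrix b * (rowMatrix b).transpose).det ≠ 0) :
    ContinuousAt (fun b : FrameIdx n → XSpace N r => (frameRep P b).coeff m) b := by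
  have hrow : Continuous (rowMatrix : (FrameIdx n → XSpace N r) → _) :=
    continuous_pi fun u => continuous_pi fun c => by
      simp only [rowMatrix, Matrix.of_apply]
      fun_prop
  have h1 : ContinuousAt (fun b : FrameIdx n → XSpace N r => coordMatrixInv (rowMatrix b)) b := by
    have hmm : Continuous fun b : FrameIdx n → XSpace N r => rowMatrix b * (rowMatrix b).transpose :=
      hrow.matrix_mul hrow.matrix_transpose
    have hd : ContinuousAt (fun b : FrameIdx n → XSpace N r =>
        (rowMatrix b * (rowMatrix b).transpose).det⁻¹) b := hmm.matrix_det.continuousAt.inv₀ hb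
    have hs : ContinuousAt (fun b : FrameIdx n → XSpace N r =>
        (rowMatrix b * (rowMatrix b).transpose).det⁻¹ •
          (rowMatrix b * (rowMatrix b).transpose).adjugate) b :=
      hd.smul hmm.matrix_adjugate.continuousAt
    let F : Matrix (CoordIdx N r) (FrameIdx n) ℝ × Matrix (FrameIdx n) (FrameIdx n) ℝ →
        Matrix (CoordIdx N r) (FrameIdx n) ℂ := fun w =>
          (w.1 * w.2).map Complex.ofRealHom * complexifyInv n
    have hF : Continuous F :=
      ((continuous_fst.matrix_mul continuous_snd).matrix_map Complex.continuous_ofReal).matrix_mul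
        continuous_const
    exact ContinuousAt.comp (g := F) (f := fun b : FrameIdx n → XSpace N r =>
      ((rowMatrix b).transpose, (rowMatrix b * (rowMatrix b).transpose).det⁻¹ •
          (rowMatrix b * (rowMatrix b).transpose).adjugate))
      hF.continuousAt (hrow.matrix_transpose.continuousAt.prodMk hs)
  exact (continuous_coeff_linSubst P m).continuousAt.comp h1

/-- Frames of bounded length with Gram determinant at least `e` form a compact set, on which the
coefficients are continuous. -/
theorem exists_coeff_frameRep_le (P : MvPolynomial (CoordIdx N r) ℂ) (m : FrameIdx n →₀ ℕ)
    (C e : ℝ) (he : 0 < e) : ∃ K : ℝ, ∀ b : FrameIdx n → XSpace N r, (∀ u, ‖b u‖ ≤ C) →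
      e ≤ (rowMatrix b * (rowMatrix b).transpose).det → ‖(frameRep P b).coeff m‖ ≤ K := by
  have hrow : Continuous (rowMatrix : (FrameIdx n → XSpace N r) → _) :=
    continuous_pi fun u => continuous_pi fun c => by
      simp only [rowMatrix, Matrix.of_apply]
      fun_prop
  let S : Set (FrameIdx n → XSpace N r) := (Set.univ.pi fun _ => closedBall 0 C) ∩
    {b | e ≤ (rowMatrix b * (rowMatrix b).transpose).det}
  have hS : IsCompact S := by
    refine (isCompact_univ_pi fun _ => isCompact_closedBall _ _).inter_right ?_
    exact isClosed_le continuous_const (hrow.matrix_mul hrow.matrix_transpose).matrix_det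
  have hc : ContinuousOn (fun b : FrameIdx n → XSpace N r => (frameRep P b).coeff m) S :=
    fun b hb => (continuousAt_coeff_frameRep P m (he.trans_le hb.2).ne').continuousWithinAt
  obtain ⟨K, hK⟩ := hS.exists_bound_of_continuousOn hc
  exact ⟨K, fun b hb hb2 => hK b ⟨fun u _ => mem_closedBall_zero_iff.2 (hb u), hb2⟩⟩

/-- The monomials of degree at most `D`. -/
def expIdx (n D : ℕ) : Finset (FrameIdx n →₀ ℕ) :=
  (Finsupp.finite_of_degree_le (σ := FrameIdx n) D).toFinset

theorem mem_expIdx {D : ℕ} {m : FrameIdx n →₀ ℕ} : m ∈ expIdx n D ↔ m.degree ≤ D := by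
  simp [expIdx]

/-- The monomials in the complex coordinates and their conjugates. -/
def coordMonomial (J : ZSpace l → XSpace N r → XSpace N r) (Q : ZSpace l → Fin n → XSpace N r)
    (m : FrameIdx n →₀ ℕ) (θ : ZSpace l) (X : XSpace N r) : ℂ :=
  ∏ u, coordVal J Q θ X u ^ m u

theorem evalCoord_eq_sum (J : ZSpace l → XSpace N r → XSpace N r)
    (Q : ZSpace l → Fin n → XSpace N r) {R : MvPolynomial (FrameIdx n) ℂ} {D : ℕ}
    (hR : R.totalDegree ≤ D) (θ : ZSpace l) (X : XSpace N r) :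
    evalCoord J Q R θ X = ∑ m ∈ expIdx n D, R.coeff m * coordMonomial J Q m θ X := by
  change MvPolynomial.eval (coordVal J Q θ X) R = _
  rw [MvPolynomial.eval_eq']
  refine Finset.sum_subset (fun m hm => ?_) (fun m _ hm => ?_)
  · rw [mem_expIdx]
    exact (MvPolynomial.le_totalDegree hm).trans hR
  · rw [MvPolynomial.notMem_support_iff.1 hm, zero_mul]

theorem coordMonomial_eq (J : ZSpace l → XSpace N r → XSpace N r)
    (Q : ZSpace l → Fin n → XSpace N r) (m : FrameIdx n →₀ ℕ) (θ : ZSpace l) (X : XSpace N r) :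
    coordMonomial J Q m θ X = ∏ i, zCoord J Q θ i X ^ m (Sum.inl i) *
      (starRingEnd ℂ) (zCoord J Q θ i X) ^ m (Sum.inr i) := by
  rw [coordMonomial, Fintype.prod_sum_type, Finset.prod_mul_distrib]
  rfl

theorem norm_coordVal_le {J : ZSpace l → XSpace N r → XSpace N r}
    {Q : ZSpace l → Fin n → XSpace N r} {θ : ZSpace l} {C : ℝ}
    (hC : ∀ u, ‖realFrame J Q θ u‖ ≤ C) (X : XSpace N r) (u : FrameIdx n) :
    ‖coordVal J Q θ X u‖ ≤ 2 * C * ‖X‖ := by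
  have h : ∀ i, ‖zCoord J Q θ i X‖ ≤ 2 * C * ‖X‖ := by
    intro i
    rw [zCoord]
    refine (norm_add_le _ _).trans ?_
    rw [norm_mul, Complex.norm_I, one_mul, Complex.norm_real, Complex.norm_real]
    have h1 := (norm_inner_le_norm (𝕜 := ℝ) (Q θ i) X).trans
      (mul_le_mul_of_nonneg_right (hC (Sum.inl i)) (norm_nonneg X))
    have h2 := (norm_inner_le_norm (𝕜 := ℝ) (J θ (Q θ i)) X).trans
      (mul_le_mul_of_nonneg_right (hC (Sum.inr i)) (norm_nonneg X))
    linarith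
  rcases u with i | i
  · exact h i
  · simpa [coordVal] using h i

/-- Each coordinate is at most `2 C (1 + ‖X‖)`. This base is at least `1`, so the single exponent
`D` serves all monomials of lower degree too. -/
theorem norm_coordMonomial_le {J : ZSpace l → XSpace N r → XSpace N r}
    {Q : ZSpace l → Fin n → XSpace N r} {θ : ZSpace l} {C : ℝ} (hC1 : 1 ≤ C)
    (hC : ∀ u, ‖realFrame J Q θ u‖ ≤ C) (X : XSpace N r) {m : FrameIdx n →₀ ℕ} {D : ℕ}
    (hm : m.degree ≤ D) :
    ‖coordMonomial J Q m θ X‖ ≤ (2 * C) ^ D * (1 + ‖X‖) ^ D := by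
  rw [coordMonomial, norm_prod, ← mul_pow]
  have hX := norm_nonneg X
  have h1 : ∀ u, ‖coordVal J Q θ X u ^ m u‖ ≤ (2 * C * (1 + ‖X‖)) ^ m u := by
    intro u
    rw [norm_pow]
    refine pow_le_pow_left₀ (norm_nonneg _) ((norm_coordVal_le hC X u).trans ?_) _
    nlinarith
  refine (Finset.prod_le_prod (fun _ _ => norm_nonneg _) fun u _ => h1 u).trans ?_
  rw [Finset.prod_pow_eq_pow_sum]
  refine pow_le_pow_right₀ (by nlinarith) ?_
  rwa [Finsupp.degree_eq_sum] at hm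

theorem exists_norm_evalX_le (P : MvPolynomial (CoordIdx N r) ℂ) :
    ∃ K : ℝ, 0 ≤ K ∧ ∀ X : XSpace N r, ‖evalX P X‖ ≤ K * (1 + ‖X‖) ^ P.totalDegree := by
  refine ⟨∑ d ∈ P.support, ‖P.coeff d‖, Finset.sum_nonneg fun _ _ => norm_nonneg _, fun X => ?_⟩
  rw [evalX, MvPolynomial.eval_eq', Finset.sum_mul]
  refine norm_sum_le_of_le _ fun d hd => ?_
  rw [norm_mul, norm_prod]
  refine mul_le_mul_of_nonneg_left ?_ (norm_nonneg _)
  have hX := norm_nonneg X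
  have h1 : ∀ c, ‖((X c : ℝ) : ℂ) ^ d c‖ ≤ (1 + ‖X‖) ^ d c := by
    intro c
    rw [norm_pow, Complex.norm_real]
    exact pow_le_pow_left₀ (norm_nonneg _) ((PiLp.norm_apply_le X c).trans (by linarith)) _
  refine (Finset.prod_le_prod (fun _ _ => norm_nonneg _) fun u _ => h1 u).trans ?_
  rw [Finset.prod_pow_eq_pow_sum]
  refine pow_le_pow_right₀ (by linarith) ?_
  have := MvPolynomial.le_totalDegree hd
  rwa [Finsupp.sum_fintype _ _ (fun _ => rfl)] at this

theorem continuous_evalX (P : MvPolynomial (CoordIdx N r) ℂ) :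
    Continuous (evalX P : XSpace N r → ℂ) := by
  unfold evalX
  simp_rw [MvPolynomial.eval_eq']
  fun_prop

end Frames

/-! ### The inverse Laplace and inverse dual Radon transform -/

section InverseTransform

variable {l : ℕ}

/-- The density of the Fourier transform in polar coordinates. -/
def polarDensity (f : ZSpace l → ℂ) (V : ZSpace l) : ℂ :=
  (‖V‖ ^ (l - 1) : ℂ) * spectralDensity f V

variable {f : ZSpace l → ℂ} (hf : ContDiff ℝ ∞ f) (hc : HasCompactSupport f)

include hf hc

theorem continuous_spectralDensity : Continuous (spectralDensity f) := by
  obtain ⟨S, hS⟩ := exists_schwartz_spectralDensity hf hc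
  rw [← funext hS]
  exact S.continuous

theorem memLp_spectralDensity : MemLp (spectralDensity f) 2 volume := by
  obtain ⟨S, hS⟩ := exists_schwartz_spectralDensity hf hc
  rw [← funext hS]
  exact S.memLp 2 volume

theorem integrable_spectralDensity : Integrable (spectralDensity f) := by
  obtain ⟨S, hS⟩ := exists_schwartz_spectralDensity hf hc
  rw [← funext hS]
  exact S.integrable

theorem integrable_polarDensity : Integrable (polarDensity f) := by
  obtain ⟨S, hS⟩ := exists_schwartz_spectralDensity hf hc
  exact integrable_of_schwartz_bound S hS (l - 1)

theorem continuous_polarDensity : Continuous (polarDensity f) := by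
  have := continuous_spectralDensity hf hc
  unfold polarDensity
  fun_prop

/-- Schwartz decay is used at the two orders `l - 1` and `l + 1`, the first to absorb the weight
near the origin. The resulting majorant is integrable along every ray, uniformly in its direction.
-/
theorem exists_polarDensity_le :
    ∃ C : ℝ, ∀ V, ‖polarDensity f V‖ ≤ C * (1 + ‖V‖ ^ 2)⁻¹ := by
  obtain ⟨S, hS⟩ := exists_schwartz_spectralDensity hf hc
  obtain ⟨C₁, -, hC₁⟩ := S.decay (l - 1) 0
  obtain ⟨C₂, -, hC₂⟩ := S.decay (l - 1 + 2) 0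
  refine ⟨C₁ + C₂, fun V => ?_⟩
  rw [← div_eq_mul_inv, le_div_iff₀ (by positivity), polarDensity, ← hS]
  have h1 := hC₁ V
  have h2 := hC₂ V
  rw [norm_iteratedFDeriv_zero] at h1 h2
  rw [norm_mul, norm_pow, Complex.norm_real, norm_norm]
  rw [pow_add] at h2
  nlinarith

theorem exists_polarDensity_ray_le :
    ∃ C : ℝ, ∀ θ : ZSpace l, ‖θ‖ = 1 → ∀ s : ℝ, ‖polarDensity f (s • θ)‖ ≤ C * (1 + s ^ 2)⁻¹ := by
  obtain ⟨C, hC⟩ := exists_polarDensity_le hf hc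
  refine ⟨C, fun θ hθ s => ?_⟩
  simpa [norm_smul, hθ] using hC (s • θ)

theorem integrable_polarDensity_ray {θ : ZSpace l} (hθ : ‖θ‖ = 1) :
    Integrable (fun s : ℝ => polarDensity f (s • θ)) := by
  obtain ⟨C, hC⟩ := exists_polarDensity_ray_le hf hc
  refine (integrable_inv_one_add_sq.const_mul C).mono' ?_ (.of_forall fun s => hC θ hθ s)
  have := continuous_polarDensity hf hc
  exact (by fun_prop : Continuous fun s : ℝ => polarDensity f (s • θ)).aestronglyMeasurable

theorem continuous_halfLineLaplace : Continuous
    (fun w : sphere (0 : ZSpace l) 1 × ℝ => halfLineLaplace (polarDensity f) w.1 w.2) := by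
  obtain ⟨C, hC⟩ := exists_polarDensity_ray_le hf hc
  have hcont := continuous_polarDensity hf hc
  unfold halfLineLaplace
  refine continuous_of_dominated (bound := fun s => C * (1 + s ^ 2)⁻¹) (fun w => ?_) (fun w => ?_)
    (integrable_inv_one_add_sq.const_mul C).integrableOn (.of_forall fun s => ?_)
  · exact (by fun_prop : Continuous fun s : ℝ => Complex.exp (Complex.I * (s * w.2 : ℝ)) *
      polarDensity f (s • (w.1 : ZSpace l))).aestronglyMeasurable
  · refine .of_forall fun s => ?_
    rw [norm_mul, mul_comm Complex.I, Complex.norm_exp_ofReal_mul_I, one_mul]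
    exact hC _ (mem_sphere_zero_iff_norm.1 w.1.2) s
  · fun_prop

theorem exists_halfLineLaplace_le : ∃ C : ℝ, ∀ θ : ZSpace l, ‖θ‖ = 1 → ∀ t,
    ‖halfLineLaplace (polarDensity f) θ t‖ ≤ C := by
  obtain ⟨C, hC⟩ := exists_polarDensity_ray_le hf hc
  refine ⟨∫ s in Set.Ioi (0 : ℝ), C * (1 + s ^ 2)⁻¹, fun θ hθ t => ?_⟩
  refine norm_integral_le_of_norm_le (integrable_inv_one_add_sq.const_mul C).integrableOn
    (.of_forall fun s => ?_)
  rw [norm_mul, mul_comm Complex.I, Complex.norm_exp_ofReal_mul_I, one_mul]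
  exact hC θ hθ s

/-- This is the Riemann–Lebesgue lemma for the density on the ray, extended by zero to the other
half-line. -/
theorem tendsto_halfLineLaplace {θ : ZSpace l} (hθ : ‖θ‖ = 1) :
    Tendsto (halfLineLaplace (polarDensity f) θ) (cocompact ℝ) (𝓝 0) := by
  have h1 := (integrable_polarDensity_ray hf hc hθ).indicator (measurableSet_Ioi (a := (0 : ℝ)))
  have h2 : halfLineLaplace (polarDensity f) θ =
      expFourier ((Set.Ioi (0 : ℝ)).indicator fun s : ℝ => polarDensity f (s • θ)) := by
    ext t
    rw [halfLineLaplace, expFourier, ← integral_indicator measurableSet_Ioi]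
    congr 1
    ext s
    by_cases hs : s ∈ Set.Ioi (0 : ℝ)
    · simp [Set.indicator_of_mem hs, mul_comm]
    · simp [Set.indicator_of_notMem hs]
  rw [h2, funext (expFourier_eq_fourier _)]
  refine (Real.zero_at_infty_fourier _).comp ?_
  have hne : (-(2 * Real.pi)⁻¹ : ℝ) ≠ 0 := by simp [Real.pi_ne_zero]
  exact (Homeomorph.smulOfNeZero (α := ℝ) _ hne).isClosedEmbedding.tendsto_cocompact

/-- The factor `s^(l-1)` contained in `polarDensity` is the polar Jacobian. The first half-line
transform therefore integrates the Fourier integrand over the half-space `⟨V,Z⟩ ≥ 0`, and the second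
integrates its reflection there, that is, the integrand over the opposite half-space. The two
overlap only in a hyperplane. -/
theorem dualRadon_lineLaplace (hl : 1 ≤ l) {Z : ZSpace l} (hZ : Z ≠ 0) :
    dualRadon (lineLaplace (polarDensity f)) Z = f Z := by
  set h : ZSpace l → ℂ := fun V =>
    Complex.exp (Complex.I * (inner ℝ Z V : ℂ)) * spectralDensity f V with hh
  have hint : Integrable h := by
    refine (integrable_spectralDensity hf hc).bdd_mul (c := 1) ?_ (.of_forall fun V => ?_)
    · exact (by fun_prop : Continuous fun V : ZSpace l =>
        Complex.exp (Complex.I * (inner ℝ Z V : ℂ))).aestronglyMeasurable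
    · rw [mul_comm, Complex.norm_exp_ofReal_mul_I]
  have hintneg : Integrable fun V => h (-V) := hint.comp_neg
  let H : Set (ZSpace l) := {V | 0 ≤ inner ℝ V Z}
  have hH : MeasurableSet H :=
    measurableSet_le (f := fun _ => (0 : ℝ)) (g := fun V : ZSpace l => (inner ℝ V Z : ℝ))
      (by fun_prop) (by fun_prop)
  let Hs : Set (sphere (0 : ZSpace l) 1) := {θ | 0 ≤ inner ℝ (θ : ZSpace l) Z}
  have hHs : MeasurableSet Hs := measurable_subtype_coe hH
  have hpolar : ∀ k : ZSpace l → ℂ, Integrable k → ∫ V in H, k V =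
      ∫ θ in Hs, (∫ s in Set.Ioi (0 : ℝ), (s ^ (l - 1) : ℂ) * k (s • (θ : ZSpace l)))
        ∂(sphereVol l) := by
    intro k hk
    rw [← integral_indicator hH, integral_polar hl (hk.indicator hH), ← integral_indicator hHs]
    congr 1
    ext θ
    by_cases hθ : θ ∈ Hs
    · rw [Set.indicator_of_mem hθ]
      refine setIntegral_congr_fun measurableSet_Ioi fun s hs => ?_
      have : s • (θ : ZSpace l) ∈ H := by
        change 0 ≤ inner ℝ (s • (θ : ZSpace l)) Z
        rw [inner_smul_left]
        exact mul_nonneg (le_of_lt hs) hθ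
      simp only [Set.indicator_of_mem this]
    · rw [Set.indicator_of_notMem hθ]
      refine setIntegral_eq_zero_of_forall_eq_zero fun s hs => ?_
      have : s • (θ : ZSpace l) ∉ H := by
        change ¬ 0 ≤ inner ℝ (s • (θ : ZSpace l)) Z
        rw [inner_smul_left, not_le]
        exact mul_neg_of_pos_of_neg hs (not_le.1 hθ)
      rw [Set.indicator_of_notMem this, mul_zero]
  have hL1 : ∀ θ : sphere (0 : ZSpace l) 1,
      halfLineLaplace (polarDensity f) θ (inner ℝ (θ : ZSpace l) Z) =
        ∫ s in Set.Ioi (0 : ℝ), (s ^ (l - 1) : ℂ) * h (s • (θ : ZSpace l)) := by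
    intro θ
    refine setIntegral_congr_fun measurableSet_Ioi fun s hs => ?_
    simp only [polarDensity, hh, norm_smul, mem_sphere_zero_iff_norm.1 θ.2,
      Real.norm_of_nonneg (le_of_lt hs), inner_smul_right, real_inner_comm, mul_one]
    ring
  have hL2 : ∀ θ : sphere (0 : ZSpace l) 1,
      halfLineLaplace (polarDensity f) (-θ) (-inner ℝ (θ : ZSpace l) Z) =
        ∫ s in Set.Ioi (0 : ℝ), (s ^ (l - 1) : ℂ) * h (-(s • (θ : ZSpace l))) := by
    intro θ
    refine setIntegral_congr_fun measurableSet_Ioi fun s hs => ?_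
    simp only [polarDensity, hh, norm_smul, mem_sphere_zero_iff_norm.1 θ.2, norm_neg, smul_neg,
      Real.norm_of_nonneg (le_of_lt hs), inner_smul_right, real_inner_comm, mul_one, inner_neg_right,
      mul_neg]
    ring
  have hcont := continuous_halfLineLaplace hf hc
  have hi1 : Integrable (fun θ : sphere (0 : ZSpace l) 1 =>
      halfLineLaplace (polarDensity f) θ (inner ℝ (θ : ZSpace l) Z)) (sphereVol l) := by
    refine Continuous.integrable_of_hasCompactSupport ?_ (HasCompactSupport.of_compactSpace _)
    exact hcont.comp (by fun_prop : Continuous fun θ : sphere (0 : ZSpace l) 1 =>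
      (θ, (inner ℝ (θ : ZSpace l) Z : ℝ)))
  have hi2 : Integrable (fun θ : sphere (0 : ZSpace l) 1 =>
      halfLineLaplace (polarDensity f) (-θ) (-inner ℝ (θ : ZSpace l) Z)) (sphereVol l) := by
    refine Continuous.integrable_of_hasCompactSupport ?_ (HasCompactSupport.of_compactSpace _)
    exact hcont.comp (by fun_prop : Continuous fun θ : sphere (0 : ZSpace l) 1 =>
      (-θ, (-inner ℝ (θ : ZSpace l) Z : ℝ)))
  -- Here `Z ≠ 0` enters: the common boundary of the half-spaces is a proper subspace. For `Z = 0`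
  -- both half-spaces would be the whole space and the integral would be counted twice.
  have hnull : volume {V : ZSpace l | inner ℝ V Z = (0 : ℝ)} = 0 := by
    have h1 : {V : ZSpace l | inner ℝ V Z = (0 : ℝ)} = ((Submodule.span ℝ {Z})ᗮ : Set _) := by
      ext V
      rw [SetLike.mem_coe, Submodule.mem_orthogonal_singleton_iff_inner_left]
      rfl
    rw [h1]
    refine Measure.addHaar_submodule _ _ fun htop => hZ ?_
    have : Z ∈ (Submodule.span ℝ {Z})ᗮ := htop ▸ Submodule.mem_top
    rw [Submodule.mem_orthogonal_singleton_iff_inner_left] at this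
    exact inner_self_eq_zero.1 this
  rw [← expFourier_spectralDensity hf hc Z]
  change ∫ θ in Hs, lineLaplace (polarDensity f) θ (inner ℝ (θ : ZSpace l) Z) ∂(sphereVol l) =
    ∫ V, h V
  unfold lineLaplace
  rw [integral_add hi1.integrableOn hi2.integrableOn]
  simp_rw [hL1, hL2]
  rw [← hpolar h hint, ← hpolar _ hintneg, ← integral_add_compl hH hint]
  congr 1
  have h1 : ∫ V in H, h (-V) = ∫ V in Neg.neg ⁻¹' H, h V := by
    rw [← (Measure.measurePreserving_neg (volume : Measure (ZSpace l))).setIntegral_preimage_emb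
      (MeasurableEquiv.neg (ZSpace l)).measurableEmbedding]
    congr 1
    ext V
    simp
  rw [h1]
  refine setIntegral_congr_set ?_
  have hae : ∀ᵐ V : ZSpace l, inner ℝ V Z ≠ (0 : ℝ) := by
    rw [ae_iff]; simpa using hnull
  filter_upwards [hae] with V hV
  apply propext
  change 0 ≤ inner ℝ (-V) Z ↔ ¬ 0 ≤ inner ℝ V Z
  rw [inner_neg_left, not_le, neg_nonneg]
  exact ⟨fun h => lt_of_le_of_ne h hV, le_of_lt⟩

theorem isInverseTransform_polarDensity (hl : 1 ≤ l) : IsInverseTransform f (polarDensity f) := by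
  have hcont := continuous_halfLineLaplace hf hc
  refine ⟨lineLaplace (polarDensity f), ⟨?_, ?_, ?_, ?_, fun Z hZ => ?_⟩, ⟨?_, ?_, ?_⟩⟩
  · unfold lineLaplace
    exact hcont.add (hcont.comp (by fun_prop : Continuous
      fun w : sphere (0 : ZSpace l) 1 × ℝ => (-w.1, -w.2)))
  · intro θ _ t
    rw [lineLaplace, lineLaplace, neg_neg, neg_neg, add_comm]
  · obtain ⟨C, hC⟩ := exists_halfLineLaplace_le hf hc
    refine ⟨C + C, fun θ hθ t => (norm_add_le _ _).trans (add_le_add (hC θ hθ t) (hC _ ?_ _))⟩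
    rwa [norm_neg]
  · intro θ hθ
    have h1 := tendsto_halfLineLaplace hf hc hθ
    have h2 := (tendsto_halfLineLaplace hf hc (θ := -θ) (by rwa [norm_neg])).comp
      (Homeomorph.neg ℝ).isClosedEmbedding.tendsto_cocompact
    have h3 := h1.add h2
    rw [add_zero] at h3
    exact h3
  · exact dualRadon_lineLaplace hf hc hl hZ
  · exact continuous_polarDensity hf hc
  · exact fun θ hθ => (integrable_polarDensity_ray hf hc hθ).integrableOn
  · exact fun θ _ t => rfl

end InverseTransform

/-! ### Exchanging the average over directions with the Fourier integral -/

section TubeKernel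

variable {l : ℕ}

/-- The average of `c` over the unit vectors whose tube contains `V`. -/
def tubeKernel (c : sphere (0 : ZSpace l) 1 → ℂ) (δ : ℝ) (V : ZSpace l) : ℂ :=
  ((discVol l δ)⁻¹ : ℂ) * ∫ θ in tubeCap δ V, c θ ∂(sphereVol l)

theorem measurableSet_tube_prod (δ : ℝ) :
    MeasurableSet {w : sphere (0 : ZSpace l) 1 × ZSpace l | w.2 ∈ tube δ (w.1 : ZSpace l)} :=
  (measurableSet_le (f := fun _ => (0 : ℝ)) (g := fun w : sphere (0 : ZSpace l) 1 × ZSpace l =>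
      (inner ℝ w.2 (w.1 : ZSpace l) : ℝ)) (by fun_prop) (by fun_prop)).inter
    (measurableSet_le (f := fun w : sphere (0 : ZSpace l) 1 × ZSpace l =>
      ‖w.2 - (inner ℝ w.2 (w.1 : ZSpace l) : ℝ) • (w.1 : ZSpace l)‖) (g := fun _ => δ)
      (by fun_prop) (by fun_prop))

/-- Fubini on the incidence set `V ∈ T_δ(θ)`: its slices are tubes for fixed `θ` and caps for fixed
`V`. -/
theorem integral_mul_integral_tube {c : sphere (0 : ZSpace l) 1 → ℂ}
    (hc : Integrable c (sphereVol l)) {ψ : ZSpace l → ℂ} (hψ : Integrable ψ) (δ : ℝ) :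
    ∫ θ, c θ * (((discVol l δ)⁻¹ : ℂ) * ∫ V, (tube δ (θ : ZSpace l)).indicator ψ V) ∂(sphereVol l) =
      ∫ V, ψ V * tubeKernel c δ V := by
  have hint := (hc.mul_prod hψ).indicator (measurableSet_tube_prod (l := l) δ)
  have hswap := integral_integral_swap (f := fun θ V =>
    {w : sphere (0 : ZSpace l) 1 × ZSpace l | w.2 ∈ tube δ (w.1 : ZSpace l)}.indicator
      (fun w => c w.1 * ψ w.2) (θ, V)) hint
  have h1 : ∀ θ : sphere (0 : ZSpace l) 1, ∫ V,
      {w : sphere (0 : ZSpace l) 1 × ZSpace l | w.2 ∈ tube δ (w.1 : ZSpace l)}.indicator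
        (fun w => c w.1 * ψ w.2) (θ, V) = c θ * ∫ V, (tube δ (θ : ZSpace l)).indicator ψ V := by
    intro θ
    rw [← integral_const_mul]
    congr 1
    ext V
    by_cases h : V ∈ tube δ (θ : ZSpace l)
    · rw [Set.indicator_of_mem h, Set.indicator_of_mem (by exact h)]
    · rw [Set.indicator_of_notMem h, Set.indicator_of_notMem (by exact h), mul_zero]
  have h2 : ∀ V : ZSpace l, ∫ θ,
      {w : sphere (0 : ZSpace l) 1 × ZSpace l | w.2 ∈ tube δ (w.1 : ZSpace l)}.indicator
        (fun w => c w.1 * ψ w.2) (θ, V) ∂(sphereVol l) =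
          ψ V * ∫ θ in tubeCap δ V, c θ ∂(sphereVol l) := by
    intro V
    rw [← integral_indicator (measurableSet_tubeCap δ V), ← integral_const_mul]
    congr 1
    ext θ
    by_cases h : V ∈ tube δ (θ : ZSpace l)
    · rw [Set.indicator_of_mem (by exact h), Set.indicator_of_mem (by exact h), mul_comm]
    · rw [Set.indicator_of_notMem (by exact h), Set.indicator_of_notMem (by exact h), mul_zero]
  simp_rw [h1, h2] at hswap
  simp_rw [tubeKernel, mul_left_comm _ ((discVol l δ)⁻¹ : ℂ)]
  rw [integral_const_mul, hswap, integral_const_mul]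

theorem aestronglyMeasurable_tubeKernel {c : sphere (0 : ZSpace l) 1 → ℂ}
    (hc : AEStronglyMeasurable c (sphereVol l)) (δ : ℝ) :
    AEStronglyMeasurable (tubeKernel c δ) volume := by
  refine AEStronglyMeasurable.const_mul ?_ _
  have h1 : AEStronglyMeasurable
      ({w : ZSpace l × sphere (0 : ZSpace l) 1 | w.1 ∈ tube δ (w.2 : ZSpace l)}.indicator
        (fun w => c w.2)) ((volume : Measure (ZSpace l)).prod (sphereVol l)) :=
    (hc.comp_snd).indicator (measurable_swap (measurableSet_tube_prod δ))
  have h2 := h1.integral_prod_right'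
  refine h2.congr (.of_forall fun V => ?_)
  simp only
  rw [← integral_indicator (measurableSet_tubeCap δ V)]
  rfl

theorem norm_tubeKernel_le {c : sphere (0 : ZSpace l) 1 → ℂ} {K : ℝ}
    (hc : ∀ θ, ‖c θ‖ ≤ K) (δ : ℝ) (V : ZSpace l) :
    ‖tubeKernel c δ V‖ ≤ K * capDensity δ V := by
  have hd : 0 ≤ discVol l δ := measureReal_nonneg
  rw [tubeKernel, capDensity, norm_mul, mul_left_comm, norm_inv, Complex.norm_real,
    Real.norm_of_nonneg hd]
  refine mul_le_mul_of_nonneg_left ?_ (inv_nonneg.2 measureReal_nonneg)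
  refine (norm_setIntegral_le_of_norm_le_const (measure_lt_top _ _) fun θ _ => hc θ).trans_eq ?_
  rfl

end TubeKernel

/-! ### Frame fields and the kernel form of the approximants -/

section FrameFields

variable {l N r n : ℕ}

/-- A field of frames which is continuous and bounded on an open set of full measure, and consists
of complex bases there. -/
structure FrameData (J : ZSpace l → XSpace N r → XSpace N r) (Q : ZSpace l → Fin n → XSpace N r)
    (U : Set (sphere (0 : ZSpace l) 1)) (C : ℝ) : Prop where
  isOpen : IsOpen U
  ae_mem : ∀ᵐ θ ∂(sphereVol l), θ ∈ U
  continuousOn : ContinuousOn (fun θ : sphere (0 : ZSpace l) 1 => realFrame J Q θ) U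
  norm_le : ∀ θ ∈ U, ∀ u, ‖realFrame J Q θ u‖ ≤ C
  one_le : 1 ≤ C
  gram_pos : ∀ θ ∈ U, 0 < frameGram J Q θ
  card : n + n = N * r

/-- A measurable representative on the sphere is extended to the whole space and composed with
`unitVec`; the exceptional set of directions stays null by `ae_unitVec_iff`. -/
theorem aestronglyMeasurable_comp_unitVec (hl : 1 ≤ l) {F : Type*} [TopologicalSpace F]
    {g : ZSpace l → F}
    (hg : AEStronglyMeasurable (fun θ : sphere (0 : ZSpace l) 1 => g θ) (sphereVol l)) :
    AEStronglyMeasurable (fun V => g (unitVec V)) volume := by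
  obtain ⟨g', hg', hgg'⟩ := hg
  obtain ⟨G, hG, hGg⟩ := (MeasurableEmbedding.subtype_coe
    (isClosed_sphere (x := (0 : ZSpace l)) (ε := 1)).measurableSet).exists_stronglyMeasurable_extend
      hg' (fun V => ⟨g V⟩)
  have hu : Measurable (unitVec : ZSpace l → ZSpace l) := by
    unfold unitVec
    fun_prop
  refine ⟨fun V => G (unitVec V), hG.comp_measurable hu, ?_⟩
  refine (ae_unitVec_iff hl (fun θ => g θ = G θ)).2 ?_
  filter_upwards [hgg'] with θ hθ
  rw [hθ, ← hGg]
  rfl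

variable {J : ZSpace l → XSpace N r → XSpace N r} {Q : ZSpace l → Fin n → XSpace N r}
  {U : Set (sphere (0 : ZSpace l) 1)} {C : ℝ}

theorem continuous_frameGram_rows : Continuous fun b : FrameIdx n → XSpace N r =>
    (rowMatrix b * (rowMatrix b).transpose).det := by
  have hrow : Continuous (rowMatrix : (FrameIdx n → XSpace N r) → _) :=
    continuous_pi fun u => continuous_pi fun c => by
      simp only [rowMatrix, Matrix.of_apply]
      fun_prop
  exact (hrow.matrix_mul hrow.matrix_transpose).matrix_det

namespace FrameData

theorem continuousOn_frameGram (hd : FrameData J Q U C) :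
    ContinuousOn (fun θ : sphere (0 : ZSpace l) 1 => frameGram J Q θ) U := by
  simp_rw [frameGram_eq]
  exact continuous_frameGram_rows.comp_continuousOn hd.continuousOn

theorem ae_unitVec (hd : FrameData J Q U C) (hl : 1 ≤ l) :
    ∀ᵐ V : ZSpace l, V ≠ 0 ∧ ∃ θ ∈ U, (θ : ZSpace l) = unitVec V := by
  have h1 : ∀ᵐ V : ZSpace l, ∃ θ ∈ U, (θ : ZSpace l) = unitVec V := by
    refine (ae_unitVec_iff hl (fun v => ∃ θ ∈ U, (θ : ZSpace l) = v)).2 ?_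
    filter_upwards [hd.ae_mem] with θ hθ using ⟨θ, hθ, rfl⟩
  filter_upwards [h1, ae_ne_zero hl] with V hV h0 using ⟨h0, hV⟩

theorem aestronglyMeasurable_of_continuousOn (hd : FrameData J Q U C) {F : Type*}
    [TopologicalSpace F] [TopologicalSpace.PseudoMetrizableSpace F]
    {g : sphere (0 : ZSpace l) 1 → F} (hg : ContinuousOn g U) :
    AEStronglyMeasurable g (sphereVol l) := by
  have h := hg.aestronglyMeasurable (μ := sphereVol l) hd.isOpen.measurableSet
  rwa [Measure.restrict_eq_self_of_ae_mem hd.ae_mem] at h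

theorem aestronglyMeasurable_realFrame (hd : FrameData J Q U C) (hl : 1 ≤ l) (u : FrameIdx n) :
    AEStronglyMeasurable (fun V : ZSpace l => realFrame J Q (unitVec V) u) volume :=
  aestronglyMeasurable_comp_unitVec (g := fun θ => realFrame J Q θ u) hl (hd.aestronglyMeasurable_of_continuousOn
    (continuousOn_pi.1 hd.continuousOn u))

theorem aestronglyMeasurable_coordMonomial (hd : FrameData J Q U C) (hl : 1 ≤ l)
    (m : FrameIdx n →₀ ℕ) (μ : Measure (XSpace N r)) [SFinite μ] :
    AEStronglyMeasurable (fun w : XSpace N r × ZSpace l => coordMonomial J Q m (unitVec w.2) w.1)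
      (μ.prod volume) := by
  have hin : ∀ u, AEStronglyMeasurable (fun w : XSpace N r × ZSpace l =>
      ((inner ℝ (realFrame J Q (unitVec w.2) u) w.1 : ℝ) : ℂ)) (μ.prod volume) := by
    intro u
    refine Complex.continuous_ofReal.comp_aestronglyMeasurable ?_
    exact ((hd.aestronglyMeasurable_realFrame hl u).comp_snd).inner
      measurable_fst.aestronglyMeasurable
  have hz : ∀ i, AEStronglyMeasurable (fun w : XSpace N r × ZSpace l =>
      zCoord J Q (unitVec w.2) i w.1) (μ.prod volume) := fun i =>
    (hin (Sum.inl i)).add ((hin (Sum.inr i)).const_mul Complex.I)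
  simp_rw [coordMonomial_eq]
  refine Finset.aestronglyMeasurable_fun_prod _ fun i _ => ?_
  exact ((hz i).pow _).mul ((Complex.continuous_conj.comp_aestronglyMeasurable (hz i)).pow _)

theorem aestronglyMeasurable_coordMonomial_slice (hd : FrameData J Q U C) (hl : 1 ≤ l)
    (m : FrameIdx n →₀ ℕ) (X : XSpace N r) :
    AEStronglyMeasurable (fun V : ZSpace l => coordMonomial J Q m (unitVec V) X) volume := by
  have hin : ∀ u, AEStronglyMeasurable (fun V : ZSpace l =>
      ((inner ℝ (realFrame J Q (unitVec V) u) X : ℝ) : ℂ)) volume := fun u =>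
    Complex.continuous_ofReal.comp_aestronglyMeasurable
      ((hd.aestronglyMeasurable_realFrame hl u).inner aestronglyMeasurable_const)
  have hz : ∀ i, AEStronglyMeasurable (fun V : ZSpace l =>
      zCoord J Q (unitVec V) i X) volume := fun i =>
    (hin (Sum.inl i)).add ((hin (Sum.inr i)).const_mul Complex.I)
  simp_rw [coordMonomial_eq]
  refine Finset.aestronglyMeasurable_fun_prod _ fun i _ => ?_
  exact ((hz i).pow _).mul ((Complex.continuous_conj.comp_aestronglyMeasurable (hz i)).pow _)

theorem ae_norm_coordMonomial_le (hd : FrameData J Q U C) (hl : 1 ≤ l) :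
    ∀ᵐ V : ZSpace l, ∀ D : ℕ, ∀ m ∈ expIdx n D, ∀ X : XSpace N r,
      ‖coordMonomial J Q m (unitVec V) X‖ ≤ (2 * C) ^ D * (1 + ‖X‖) ^ D := by
  filter_upwards [hd.ae_unitVec hl] with V hV D m hm X
  obtain ⟨-, θ, hθ, hθV⟩ := hV
  rw [← hθV]
  exact norm_coordMonomial_le hd.one_le (hd.norm_le θ hθ) X (mem_expIdx.1 hm)

end FrameData

/-- The unit vectors in `U` where the Gram determinant is at least `ε`. -/
def levelSet (J : ZSpace l → XSpace N r → XSpace N r) (Q : ZSpace l → Fin n → XSpace N r)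
    (U : Set (sphere (0 : ZSpace l) 1)) (ε : ℝ) : Set (sphere (0 : ZSpace l) 1) :=
  {θ | θ ∈ U ∧ ε ≤ frameGram J Q θ}

/-- The coefficients of the complex representation of `P`, cut off to `levelSet`. -/
def repCoeff (J : ZSpace l → XSpace N r → XSpace N r) (Q : ZSpace l → Fin n → XSpace N r)
    (U : Set (sphere (0 : ZSpace l) 1)) (ε : ℝ) (P : MvPolynomial (CoordIdx N r) ℂ)
    (m : FrameIdx n →₀ ℕ) : sphere (0 : ZSpace l) 1 → ℂ :=
  (levelSet J Q U ε).indicator fun θ => (frameRep P (realFrame J Q θ)).coeff m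

/-- The set `levelSet` stays away from the zeros of the Gram determinant. -/
def IsGoodLevel (J : ZSpace l → XSpace N r → XSpace N r) (Q : ZSpace l → Fin n → XSpace N r)
    (U : Set (sphere (0 : ZSpace l) 1)) (ε : ℝ) : Prop :=
  ∃ e : ℝ, 0 < e ∧ ∀ θ ∈ U, ε ≤ frameGram J Q θ → e ≤ frameGram J Q θ

namespace FrameData

theorem measurableSet_levelSet (hd : FrameData J Q U C) (ε : ℝ) :
    MeasurableSet (levelSet J Q U ε) := by
  obtain ⟨F, hF, hFU⟩ := continuousOn_iff_isClosed.1 hd.continuousOn_frameGram (Set.Ici ε)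
    isClosed_Ici
  have : levelSet J Q U ε = F ∩ U := by
    rw [← hFU]
    ext θ
    exact and_comm
  rw [this]
  exact hF.measurableSet.inter hd.isOpen.measurableSet

theorem continuousOn_coeff (hd : FrameData J Q U C) (P : MvPolynomial (CoordIdx N r) ℂ)
    (m : FrameIdx n →₀ ℕ) : ContinuousOn
      (fun θ : sphere (0 : ZSpace l) 1 => (frameRep P (realFrame J Q θ)).coeff m) U := by
  intro θ hθ
  have hG := (hd.gram_pos θ hθ).ne'
  rw [frameGram_eq] at hG
  exact (continuousAt_coeff_frameRep P m hG).comp_continuousWithinAt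
    (f := fun θ : sphere (0 : ZSpace l) 1 => realFrame J Q θ) (hd.continuousOn θ hθ)

theorem aestronglyMeasurable_repCoeff (hd : FrameData J Q U C) (ε : ℝ)
    (P : MvPolynomial (CoordIdx N r) ℂ) (m : FrameIdx n →₀ ℕ) :
    AEStronglyMeasurable (repCoeff J Q U ε P m) (sphereVol l) :=
  (hd.aestronglyMeasurable_of_continuousOn (hd.continuousOn_coeff P m)).indicator
    (hd.measurableSet_levelSet ε)

theorem exists_repCoeff_le (hd : FrameData J Q U C) {ε : ℝ} (hε : IsGoodLevel J Q U ε)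
    (P : MvPolynomial (CoordIdx N r) ℂ) (D : ℕ) :
    ∃ K : ℝ, 0 ≤ K ∧ ∀ m ∈ expIdx n D, ∀ θ, ‖repCoeff J Q U ε P m θ‖ ≤ K := by
  obtain ⟨e, he, hUe⟩ := hε
  choose K hK using fun m => exists_coeff_frameRep_le (n := n) P m C e he
  refine ⟨∑ m ∈ expIdx n D, |K m|, Finset.sum_nonneg fun _ _ => abs_nonneg _, fun m hm θ => ?_⟩
  refine le_trans ?_ (Finset.single_le_sum (fun m _ => abs_nonneg (K m)) hm)
  by_cases hθ : θ ∈ levelSet J Q U ε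
  · rw [repCoeff, Set.indicator_of_mem hθ]
    refine (hK m _ (hd.norm_le θ hθ.1) ?_).trans (le_abs_self _)
    rw [← frameGram_eq]
    exact hUe θ hθ.1 hθ.2
  · rw [repCoeff, Set.indicator_of_notMem hθ, norm_zero]
    exact abs_nonneg _

end FrameData

/-- The multiplier by which the twisted Fourier transform represents the approximating functions. -/
def approxKernel (J : ZSpace l → XSpace N r → XSpace N r) (Q : ZSpace l → Fin n → XSpace N r)
    (U : Set (sphere (0 : ZSpace l) 1)) (P : MvPolynomial (CoordIdx N r) ℂ) (ε δ : ℝ)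
    (X : XSpace N r) (V : ZSpace l) : ℂ :=
  ∑ m ∈ expIdx n P.totalDegree,
    tubeKernel (repCoeff J Q U ε P m) δ V * coordMonomial J Q m (unitVec V) X

namespace FrameData

theorem integrable_exp_mul_coordMonomial (hd : FrameData J Q U C) (hl : 1 ≤ l)
    {ψ : ZSpace l → ℂ} (hψ : Integrable ψ) {D : ℕ} {m : FrameIdx n →₀ ℕ} (hm : m ∈ expIdx n D)
    (X : XSpace N r) (Z : ZSpace l) :
    Integrable fun V => Complex.exp (Complex.I * (inner ℝ Z V : ℂ)) * ψ V *
      coordMonomial J Q m (unitVec V) X := by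
  refine Integrable.mul_bdd (c := (2 * C) ^ D * (1 + ‖X‖) ^ D) ?_
    (hd.aestronglyMeasurable_coordMonomial_slice hl m X) ?_
  · refine hψ.bdd_mul (c := 1) ?_ (.of_forall fun V => ?_)
    · exact (by fun_prop : Continuous fun V : ZSpace l =>
        Complex.exp (Complex.I * (inner ℝ Z V : ℂ))).aestronglyMeasurable
    · rw [mul_comm, Complex.norm_exp_ofReal_mul_I]
  · filter_upwards [hd.ae_norm_coordMonomial_le hl] with V hV using hV D m hm X

/-- The coefficients of `P_θ` are functions of `θ` alone, and the monomials evaluated at `V_u` are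
functions of `V` and `X` alone. Fubini thus applies to each monomial separately and leaves a
multiplier of `V` that does not involve `X`. -/
theorem approximant_eq_sum (hd : FrameData J Q U C) (hl : 1 ≤ l) {ε : ℝ}
    (hε : IsGoodLevel J Q U ε) (P : MvPolynomial (CoordIdx N r) ℂ) {φ : ℝ → ZSpace l → ℂ}
    (hφ : ∀ s, 0 ≤ s → Integrable (φ s)) (δ : ℝ) (X : XSpace N r) (Z : ZSpace l) :
    approximant J Q P φ ε δ X Z = ∑ m ∈ expIdx n P.totalDegree,
      ∫ V, (Complex.exp (Complex.I * (inner ℝ Z V : ℂ)) * φ ‖X‖ V *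
        coordMonomial J Q m (unitVec V) X) * tubeKernel (repCoeff J Q U ε P m) δ V := by
  obtain ⟨K, -, hK⟩ := hd.exists_repCoeff_le hε P P.totalDegree
  have hψ := fun m (hm : m ∈ expIdx n P.totalDegree) =>
    hd.integrable_exp_mul_coordMonomial hl (hφ ‖X‖ (norm_nonneg X)) hm X Z
  have hc : ∀ m ∈ expIdx n P.totalDegree, Integrable (repCoeff J Q U ε P m) (sphereVol l) :=
    fun m hm => Integrable.of_bound (hd.aestronglyMeasurable_repCoeff ε P m) K
      (.of_forall (hK m hm))
  -- The domain of integration is controlled only on `U`, so it is replaced by the measurable set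
  -- `levelSet`, which differs from it by a null set.
  have hset : ({θ : sphere (0 : ZSpace l) 1 | ε ≤ frameGram J Q θ} : Set _) =ᵐ[sphereVol l]
      levelSet J Q U ε := by
    filter_upwards [hd.ae_mem] with θ hθ
    exact propext ⟨fun h => ⟨hθ, h⟩, fun h => h.2⟩
  rw [approximant, setIntegral_congr_set hset, ← integral_indicator (hd.measurableSet_levelSet ε)]
  have hpt : ∀ θ : sphere (0 : ZSpace l) 1, (levelSet J Q U ε).indicator (fun θ =>
      ((discVol l δ)⁻¹ : ℂ) * twistedFourierPoly J Q (complexRep J Q P θ)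
        (fun s => (tube δ (θ : ZSpace l)).indicator (φ s)) X Z) θ =
      ∑ m ∈ expIdx n P.totalDegree, repCoeff J Q U ε P m θ * (((discVol l δ)⁻¹ : ℂ) *
        ∫ V, (tube δ (θ : ZSpace l)).indicator (fun V =>
          Complex.exp (Complex.I * (inner ℝ Z V : ℂ)) * φ ‖X‖ V *
            coordMonomial J Q m (unitVec V) X) V) := by
    intro θ
    by_cases hθ : θ ∈ levelSet J Q U ε
    · rw [Set.indicator_of_mem hθ]
      have hrep : ∀ m, repCoeff J Q U ε P m θ = (frameRep P (realFrame J Q θ)).coeff m :=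
        fun m => Set.indicator_of_mem hθ _
      simp_rw [hrep]
      rw [Finset.sum_congr rfl fun m _ => mul_left_comm _ _ _, ← Finset.mul_sum]
      congr 1
      rw [twistedFourierPoly, complexRep_eq hd.card (hd.gram_pos θ hθ.1).ne']
      have hev : ∀ θ' X', evalCoord J Q (frameRep P (realFrame J Q θ)) θ' X' = _ :=
        evalCoord_eq_sum J Q (totalDegree_linSubst_le _ P)
      simp_rw [hev]
      simp_rw [← integral_const_mul]
      rw [← integral_finsetSum _ fun m hm => ?_]
      · congr 1
        ext V
        by_cases hV : V ∈ tube δ (θ : ZSpace l)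
        · simp_rw [Set.indicator_of_mem hV, Finset.mul_sum]
          refine Finset.sum_congr rfl fun m _ => ?_
          ring
        · simp_rw [Set.indicator_of_notMem hV]
          simp
      · refine Integrable.const_mul ?_ _
        refine (hψ m hm).indicator ?_
        exact (measurable_prodMk_left (x := θ)) (measurableSet_tube_prod δ)
    · have hrep : ∀ m, repCoeff J Q U ε P m θ = 0 := fun m => Set.indicator_of_notMem hθ _
      simp [hrep, Set.indicator_of_notMem hθ]
  simp_rw [hpt]
  rw [integral_finsetSum _ fun m hm => ?_]
  · exact Finset.sum_congr rfl fun m hm => integral_mul_integral_tube (hc m hm) (hψ m hm) δ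
  · have hint := ((hc m hm).mul_prod (hψ m hm)).indicator (measurableSet_tube_prod (l := l) δ)
    refine (hint.integral_prod_left.const_mul ((discVol l δ)⁻¹ : ℂ)).congr (.of_forall fun θ => ?_)
    simp only
    rw [mul_left_comm, ← integral_const_mul (repCoeff J Q U ε P m θ)]
    congr 2
    ext V
    by_cases h : V ∈ tube δ (θ : ZSpace l)
    · rw [Set.indicator_of_mem h, Set.indicator_of_mem (by exact h)]
    · rw [Set.indicator_of_notMem h, Set.indicator_of_notMem (by exact h), mul_zero]

end FrameData

end FrameFields

/-! ### Membership of the approximants in the domain of the operator -/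

section Membership

variable {l N r n : ℕ} {J J' : ZSpace l → XSpace N r → XSpace N r}
  {Q : ZSpace l → Fin n → XSpace N r} {U : Set (sphere (0 : ZSpace l) 1)} {C : ℝ}

namespace FrameData

theorem aestronglyMeasurable_kernel (hd : FrameData J Q U C) (ε δ : ℝ)
    (P : MvPolynomial (CoordIdx N r) ℂ) (m : FrameIdx n →₀ ℕ) :
    AEStronglyMeasurable (tubeKernel (repCoeff J Q U ε P m) δ) volume :=
  aestronglyMeasurable_tubeKernel (hd.aestronglyMeasurable_repCoeff ε P m) δ

/-- The kernels compensate the weight `|V| ^ (l - 1)`. -/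
theorem exists_pow_mul_kernel_le (hl : 1 ≤ l) :
    ∃ C₀ : ℝ, 0 ≤ C₀ ∧ ∀ (c : sphere (0 : ZSpace l) 1 → ℂ) (K : ℝ), (∀ θ, ‖c θ‖ ≤ K) →
      ∀ δ : ℝ, 0 < δ → ∀ V : ZSpace l, V ≠ 0 →
        ‖(‖V‖ ^ (l - 1) : ℂ) * tubeKernel c δ V‖ ≤ K * C₀ := by
  obtain ⟨C₀, h0, hC₀⟩ := exists_capDensity_le hl
  refine ⟨C₀, h0, fun c K hc δ hδ V hV => ?_⟩
  have hn : 0 < ‖V‖ ^ (l - 1) := pow_pos (norm_pos_iff.2 hV) _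
  have hK : 0 ≤ K ∨ K < 0 := le_or_gt 0 K
  rw [norm_mul, norm_pow, Complex.norm_real, norm_norm]
  have h1 := norm_tubeKernel_le hc δ V
  rcases hK with hK | hK
  · calc ‖V‖ ^ (l - 1) * ‖tubeKernel c δ V‖
        ≤ ‖V‖ ^ (l - 1) * (K * (C₀ * (‖V‖ ^ (l - 1))⁻¹)) :=
          mul_le_mul_of_nonneg_left (h1.trans (mul_le_mul_of_nonneg_left (hC₀ δ hδ V hV) hK)) hn.le
      _ = K * C₀ := by field_simp
  -- A negative bound `K` on a norm is possible only if the sphere is empty, but it contains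
  -- `unitVec V`.
  · have hempty : IsEmpty (sphere (0 : ZSpace l) 1) :=
      ⟨fun θ => absurd ((norm_nonneg _).trans (hc θ)) (not_le.2 hK)⟩
    exact (hempty.false ⟨unitVec V, mem_sphere_zero_iff_norm.2 (norm_unitVec hV)⟩).elim

theorem exists_amplitude_le (hd : FrameData J Q U C) (hl : 1 ≤ l) {ε : ℝ}
    (hε : IsGoodLevel J Q U ε) (P : MvPolynomial (CoordIdx N r) ℂ) :
    ∃ K : ℝ, ∀ m ∈ expIdx n P.totalDegree, ∀ δ : ℝ, 0 < δ → ∀ᵐ V : ZSpace l,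
      ‖(‖V‖ ^ (l - 1) : ℂ) * tubeKernel (repCoeff J Q U ε P m) δ V‖ ≤ K := by
  obtain ⟨C₀, -, hC₀⟩ := exists_pow_mul_kernel_le hl
  obtain ⟨K, -, hK⟩ := hd.exists_repCoeff_le hε P P.totalDegree
  refine ⟨K * C₀, fun m hm δ hδ => ?_⟩
  filter_upwards [ae_ne_zero hl] with V hV
  exact hC₀ _ K (hK m hm) δ hδ V hV

theorem aestronglyMeasurable_amplitude (hd : FrameData J Q U C) (ε δ : ℝ)
    (P : MvPolynomial (CoordIdx N r) ℂ) (m : FrameIdx n →₀ ℕ) :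
    AEStronglyMeasurable (fun V : ZSpace l =>
      (‖V‖ ^ (l - 1) : ℂ) * tubeKernel (repCoeff J Q U ε P m) δ V) volume :=
  (by fun_prop : Continuous fun V : ZSpace l => (‖V‖ ^ (l - 1) : ℂ)).aestronglyMeasurable.mul
    (hd.aestronglyMeasurable_kernel ε δ P m)

/-- The weight `|V|^(l-1)` times the kernel is bounded, so the amplitude inherits both integrability
conditions from `F`. -/
theorem isDensity_amplitude (hd : FrameData J Q U C) (hl : 1 ≤ l) {ε : ℝ}
    (hε : IsGoodLevel J Q U ε) (P : MvPolynomial (CoordIdx N r) ℂ) {m : FrameIdx n →₀ ℕ}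
    (hm : m ∈ expIdx n P.totalDegree) {δ : ℝ} (hδ : 0 < δ) {F : ZSpace l → ℂ}
    (hF : IsDensity F) :
    IsDensity fun V => ((‖V‖ ^ (l - 1) : ℂ) * F V) * tubeKernel (repCoeff J Q U ε P m) δ V := by
  obtain ⟨K, hK⟩ := hd.exists_amplitude_le hl hε P
  have hmeas := hd.aestronglyMeasurable_amplitude ε δ P m
  have heq : (fun V : ZSpace l => ((‖V‖ ^ (l - 1) : ℂ) * F V) *
      tubeKernel (repCoeff J Q U ε P m) δ V) = fun V => ((‖V‖ ^ (l - 1) : ℂ) *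
        tubeKernel (repCoeff J Q U ε P m) δ V) * F V := by
    ext V; ring
  rw [heq]
  refine ⟨hF.1.bdd_mul hmeas (hK m hm δ hδ), ?_⟩
  refine hF.2.of_le_mul (c := K) (hmeas.mul hF.2.1) ?_
  filter_upwards [hK m hm δ hδ] with V hV
  rw [norm_mul]
  exact mul_le_mul_of_nonneg_right hV (norm_nonneg _)

/-- The kernel multiplies `φ` by a function of `V` only, so each summand is again a twisted
transform of an amplitude in `|X|` and `V`. The number of summands is finite, hence no closure of
the domain is taken. -/
theorem approximant_mem_kappaDomain (hd : FrameData J Q U C) (hl : 1 ≤ l) {ε : ℝ}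
    (hε : IsGoodLevel J Q U ε) (P : MvPolynomial (CoordIdx N r) ℂ) {φ : ℝ → ZSpace l → ℂ}
    (hφ : ∀ s, 0 ≤ s → Integrable (φ s)) (δ : ℝ) (A : Set (ℝ → ZSpace l → ℂ))
    (hA : ∀ m ∈ expIdx n P.totalDegree,
      (fun s V => φ s V * tubeKernel (repCoeff J Q U ε P m) δ V) ∈ A) :
    approximant J Q P φ ε δ ∈ kappaDomain J J' Q A := by
  have h1 : approximant J Q P φ ε δ = ∑ m ∈ expIdx n P.totalDegree,
      twistedFourier J Q (fun i => m (Sum.inl i)) (fun i => m (Sum.inr i))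
        (fun s V => φ s V * tubeKernel (repCoeff J Q U ε P m) δ V) := by
    ext X Z
    rw [hd.approximant_eq_sum hl hε P hφ, Finset.sum_apply, Finset.sum_apply]
    refine Finset.sum_congr rfl fun m _ => ?_
    rw [twistedFourier]
    congr 1
    ext V
    rw [← coordMonomial_eq]
    ring
  rw [h1]
  refine Submodule.sum_mem _ fun m hm => ?_
  exact Submodule.mem_map.2 ⟨_, Submodule.subset_span ⟨_, _, _, hA m hm, rfl⟩, rfl⟩

/-- For fixed `X` the approximant becomes one Fourier integral in `V`, the form to which
Plancherel's formula applies. -/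
theorem approximant_eq_expFourier (hd : FrameData J Q U C) (hl : 1 ≤ l) {ε : ℝ}
    (hε : IsGoodLevel J Q U ε) (P : MvPolynomial (CoordIdx N r) ℂ) {φ : ℝ → ZSpace l → ℂ}
    (hφ : ∀ s, 0 ≤ s → Integrable (φ s)) {δ : ℝ}
    (hA : ∀ s, 0 ≤ s → ∀ m ∈ expIdx n P.totalDegree,
      Integrable fun V => φ s V * tubeKernel (repCoeff J Q U ε P m) δ V)
    (X : XSpace N r) (Z : ZSpace l) :
    approximant J Q P φ ε δ X Z =
      expFourier (fun V => φ ‖X‖ V * approxKernel J Q U P ε δ X V) Z := by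
  rw [hd.approximant_eq_sum hl hε P hφ, expFourier, ← integral_finsetSum _ fun m hm => ?_]
  · congr 1
    ext V
    rw [approxKernel, Finset.mul_sum, Finset.mul_sum]
    exact Finset.sum_congr rfl fun m _ => by ring
  · refine (hd.integrable_exp_mul_coordMonomial hl (hA _ (norm_nonneg X) m hm) hm X Z).congr
      (.of_forall fun V => ?_)
    simp only
    ring

end FrameData

end Membership

/-! ### Shrinking caps as an approximate identity -/

section TubeKernelLimit

variable {l : ℕ}

/-- After rescaling, put `t = ⟨V_u,θ⟩ ∈ [0,1]` and `r = δ / |V|`. Then `|θ - V_u|² = 2(1 - t) ≤ 2(1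
- t²) ≤ 2r²`. -/
theorem dist_sq_le_of_mem_tubeCap {δ : ℝ} (hδ : 0 ≤ δ) {V : ZSpace l} (hV : V ≠ 0)
    {θ : sphere (0 : ZSpace l) 1} (h : θ ∈ tubeCap δ V) :
    ‖(θ : ZSpace l) - unitVec V‖ ^ 2 ≤ 2 * (‖V‖⁻¹ * δ) ^ 2 := by
  have hn : 0 < ‖V‖ := norm_pos_iff.2 hV
  have h1 : θ ∈ tubeCap (‖V‖⁻¹ * δ) (unitVec V) := by
    rw [unitVec, tubeCap_smul hδ (inv_pos.2 hn)]
    exact h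
  have hu := norm_unitVec hV
  have hθ : ‖(θ : ZSpace l)‖ = 1 := mem_sphere_zero_iff_norm.1 θ.2
  rw [mem_tubeCap_iff (by positivity), hu] at h1
  have h2 : inner ℝ (unitVec V) (θ : ZSpace l) ≤ 1 := by
    have := real_inner_le_norm (unitVec V) (θ : ZSpace l)
    rwa [hu, hθ, one_mul] at this
  rw [norm_sub_sq_real, hu, hθ, real_inner_comm]
  nlinarith [h1.1, h1.2]

/-- The normalized caps have mass tending to `1` and shrink to `V_u`, so their averages pick out the
limit of `c` there. A limit within `U` is enough, as the complement of `U` does not affect the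
averages. -/
theorem tendsto_pow_mul_tubeKernel (hl : 1 ≤ l) {U : Set (sphere (0 : ZSpace l) 1)}
    (hU : ∀ᵐ θ ∂(sphereVol l), θ ∈ U) {c : sphere (0 : ZSpace l) 1 → ℂ}
    (hc : Integrable c (sphereVol l)) {V : ZSpace l} (hV : V ≠ 0)
    {u : sphere (0 : ZSpace l) 1} (hu : (u : ZSpace l) = unitVec V) {c₀ : ℂ}
    (hlim : Tendsto c (𝓝[U] u) (𝓝 c₀)) :
    Tendsto (fun δ => (‖V‖ ^ (l - 1) : ℂ) * tubeKernel c δ V) (𝓝[>] 0) (𝓝 c₀) := by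
  have hn : 0 < ‖V‖ ^ (l - 1) := pow_pos (norm_pos_iff.2 hV) _
  have hdens : Tendsto (fun δ => ‖V‖ ^ (l - 1) * capDensity δ V) (𝓝[>] 0) (𝓝 1) := by
    have := (tendsto_capDensity hl hV).const_mul (‖V‖ ^ (l - 1))
    rwa [mul_inv_cancel₀ hn.ne'] at this
  have hmain : Tendsto (fun δ => ((‖V‖ ^ (l - 1) * capDensity δ V : ℝ) : ℂ) * c₀)
      (𝓝[>] 0) (𝓝 c₀) := by
    have := ((Complex.continuous_ofReal.tendsto 1).comp hdens).mul_const c₀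
    simpa using this
  suffices herr : Tendsto (fun δ => (‖V‖ ^ (l - 1) : ℂ) * tubeKernel c δ V -
      ((‖V‖ ^ (l - 1) * capDensity δ V : ℝ) : ℂ) * c₀) (𝓝[>] 0) (𝓝 0) by
    have := herr.add hmain
    simpa using this
  rw [Metric.tendsto_nhds]
  intro η hη
  have hη2 : 0 < η / 2 := by positivity
  have hnear : ∀ᶠ θ in 𝓝 u, θ ∈ U → dist (c θ) c₀ < η / 2 :=
    eventually_nhdsWithin_iff.1 (Metric.tendsto_nhds.1 hlim _ hη2)
  obtain ⟨ρ, hρ, hball⟩ := Metric.eventually_nhds_iff.1 hnear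
  have hsmall : ∀ᶠ δ in 𝓝[>] (0 : ℝ), 2 * (‖V‖⁻¹ * δ) ^ 2 < ρ ^ 2 := by
    have hcont : ContinuousAt (fun δ : ℝ => 2 * (‖V‖⁻¹ * δ) ^ 2) 0 := by fun_prop
    refine (hcont.tendsto.mono_left nhdsWithin_le_nhds).eventually (gt_mem_nhds ?_)
    simpa using pow_pos hρ 2
  filter_upwards [hsmall, self_mem_nhdsWithin, hdens.eventually (gt_mem_nhds one_lt_two)]
    with δ hδ1 hδ2 hδ3
  have hδ0 : 0 < δ := hδ2
  have hd0 : 0 ≤ discVol l δ := measureReal_nonneg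
  have hcap : ∀ᵐ θ ∂(sphereVol l), θ ∈ tubeCap δ V → ‖c θ - c₀‖ ≤ η / 2 := by
    filter_upwards [hU] with θ hθU hθ
    have h1 := dist_sq_le_of_mem_tubeCap hδ0.le hV hθ
    have h2 : dist θ u < ρ := by
      rw [Subtype.dist_eq, hu, dist_eq_norm]
      exact lt_of_pow_lt_pow_left₀ 2 hρ.le (h1.trans_lt hδ1)
    rw [← dist_eq_norm]
    exact (hball h2 hθU).le
  have hdiff : (‖V‖ ^ (l - 1) : ℂ) * tubeKernel c δ V -
      ((‖V‖ ^ (l - 1) * capDensity δ V : ℝ) : ℂ) * c₀ =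
        ((‖V‖ ^ (l - 1) * (discVol l δ)⁻¹ : ℝ) : ℂ) *
          ∫ θ in tubeCap δ V, (c θ - c₀) ∂(sphereVol l) := by
    rw [integral_sub hc.integrableOn (integrable_const _).integrableOn, setIntegral_const,
      tubeKernel, capDensity, capMeasure, Complex.real_smul]
    push_cast
    ring
  rw [dist_zero_right, hdiff, norm_mul, Complex.norm_real, Real.norm_of_nonneg (by positivity)]
  have hint : ‖∫ θ in tubeCap δ V, (c θ - c₀) ∂(sphereVol l)‖ ≤ η / 2 * capMeasure δ V :=
    norm_setIntegral_le_of_norm_le_const_ae (measure_lt_top _ _)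
      ((ae_restrict_iff' (measurableSet_tubeCap δ V)).2 hcap)
  calc ‖V‖ ^ (l - 1) * (discVol l δ)⁻¹ * ‖∫ θ in tubeCap δ V, (c θ - c₀) ∂(sphereVol l)‖
      ≤ ‖V‖ ^ (l - 1) * (discVol l δ)⁻¹ * (η / 2 * capMeasure δ V) :=
        mul_le_mul_of_nonneg_left hint (by positivity)
    _ = η / 2 * (‖V‖ ^ (l - 1) * capDensity δ V) := by rw [capDensity]; ring
    _ < η / 2 * 2 := mul_lt_mul_of_pos_left hδ3 hη2
    _ = η := by ring

end TubeKernelLimit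

/-! ### Dominated convergence in the mean -/

section DominatedL2

theorem tendsto_eLpNorm_two_of_dominated {α ι : Type*} [MeasurableSpace α] {μ : Measure α}
    {𝓕 : Filter ι} [𝓕.IsCountablyGenerated] {g : ι → α → ℂ} {h : α → ℂ} (hh : MemLp h 2 μ)
    (K : ℝ) (hg : ∀ᶠ i in 𝓕, AEStronglyMeasurable (g i) μ)
    (hb : ∀ᶠ i in 𝓕, ∀ᵐ x ∂μ, ‖g i x‖ ≤ K * ‖h x‖)
    (hlim : ∀ᵐ x ∂μ, Tendsto (fun i => g i x) 𝓕 (𝓝 0)) :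
    Tendsto (fun i => eLpNorm (g i) 2 μ) 𝓕 (𝓝 0) := by
  have hK : MemLp (fun x => (K : ℂ) * h x) 2 μ := hh.const_mul _
  have h1 : Tendsto (fun i => ∫⁻ x, ‖g i x‖ₑ ^ 2 ∂μ) 𝓕 (𝓝 (∫⁻ _, 0 ∂μ)) := by
    refine tendsto_lintegral_filter_of_dominated_convergence'
      (fun x => ‖(K : ℂ) * h x‖ₑ ^ 2) ?_ ?_ ?_ ?_
    · filter_upwards [hg] with i hi using hi.enorm.pow_const 2
    · filter_upwards [hb] with i hi
      filter_upwards [hi] with x hx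
      gcongr
      rw [enorm_le_iff_norm_le, norm_mul, Complex.norm_real]
      exact hx.trans (mul_le_mul_of_nonneg_right (le_abs_self K) (norm_nonneg _))
    · rw [← eLpNorm_two_sq]
      exact ENNReal.pow_ne_top hK.2.ne
    · filter_upwards [hlim] with x hx
      have h2 : Tendsto (fun i => ‖g i x‖ₑ ^ 2) 𝓕 (𝓝 (‖(0 : ℂ)‖ₑ ^ 2)) :=
        (ENNReal.continuous_pow 2).continuousAt.tendsto.comp hx.enorm
      simpa using h2
  rw [lintegral_zero] at h1
  simp_rw [← eLpNorm_two_sq] at h1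
  have h3 := (ENNReal.continuous_rpow_const (y := (1 / 2 : ℝ))).continuousAt.tendsto.comp h1
  rw [ENNReal.zero_rpow_of_pos (by norm_num)] at h3
  refine h3.congr fun i => ?_
  simp only [Function.comp_apply]
  rw [← ENNReal.rpow_natCast, ← ENNReal.rpow_mul]
  norm_num

theorem eLpNorm_expFourier_prod' {α : Type*} [MeasurableSpace α] {μ : Measure α}
    [SFinite μ] {l : ℕ} {h : α → ZSpace l → ℂ}
    (hm : MemLp (fun w : α × ZSpace l => h w.1 w.2) 2 (μ.prod volume))
    (hs : ∀ᵐ x ∂μ, Integrable (h x)) :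
    eLpNorm (fun w : α × ZSpace l => expFourier (h w.1) w.2) 2 (μ.prod volume) =
      (plancherelConst (ZSpace l)) ^ (1 / 2 : ℝ) *
        eLpNorm (fun w : α × ZSpace l => h w.1 w.2) 2 (μ.prod volume) := by
  have hroot : ∀ x : ℝ≥0∞, (x ^ 2) ^ (1 / 2 : ℝ) = x := by
    intro x
    rw [← ENNReal.rpow_natCast, ← ENNReal.rpow_mul]
    norm_num
  rw [← hroot (eLpNorm (fun w : α × ZSpace l => expFourier (h w.1) w.2) 2 (μ.prod volume)),
    eLpNorm_expFourier_prod hm hs, ENNReal.mul_rpow_of_nonneg _ _ (by norm_num), hroot]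

end DominatedL2

/-! ### Pointwise limits and uniform bounds of the kernels -/

section Convergence

variable {l N r n : ℕ} {J : ZSpace l → XSpace N r → XSpace N r}
  {Q : ZSpace l → Fin n → XSpace N r} {U : Set (sphere (0 : ZSpace l) 1)} {C : ℝ}

/-- The normalized measure of the part of a cap that lies in `levelSet`. -/
def levelDensity (J : ZSpace l → XSpace N r → XSpace N r) (Q : ZSpace l → Fin n → XSpace N r)
    (U : Set (sphere (0 : ZSpace l) 1)) (ε δ : ℝ) (V : ZSpace l) : ℂ :=
  (‖V‖ ^ (l - 1) : ℂ) * tubeKernel ((levelSet J Q U ε).indicator fun _ => 1) δ V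

/-- The part of the relative error of the approximation which comes from the variation of the
coefficients. -/
def coeffError (J : ZSpace l → XSpace N r → XSpace N r) (Q : ZSpace l → Fin n → XSpace N r)
    (U : Set (sphere (0 : ZSpace l) 1)) (P : MvPolynomial (CoordIdx N r) ℂ) (ε δ : ℝ)
    (X : XSpace N r) (V : ZSpace l) : ℂ :=
  (‖V‖ ^ (l - 1) : ℂ) * approxKernel J Q U P ε δ X V - evalX P X * levelDensity J Q U ε δ V

theorem tubeKernel_sub_const_mul {c d : sphere (0 : ZSpace l) 1 → ℂ}
    (hc : Integrable c (sphereVol l)) (hd : Integrable d (sphereVol l)) (a : ℂ) (δ : ℝ)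
    (V : ZSpace l) :
    tubeKernel (fun θ => c θ - a * d θ) δ V = tubeKernel c δ V - a * tubeKernel d δ V := by
  rw [tubeKernel, tubeKernel, tubeKernel, integral_sub hc.integrableOn (hd.const_mul a).integrableOn,
    integral_const_mul]
  ring

namespace FrameData

theorem integrable_levelIndicator (hd : FrameData J Q U C) (ε : ℝ) :
    Integrable ((levelSet J Q U ε).indicator fun _ => (1 : ℂ)) (sphereVol l) :=
  (integrable_const _).indicator (hd.measurableSet_levelSet ε)

theorem integrable_repCoeff (hd : FrameData J Q U C) {ε : ℝ}
    (hε : IsGoodLevel J Q U ε) (P : MvPolynomial (CoordIdx N r) ℂ) {m : FrameIdx n →₀ ℕ}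
    (hm : m ∈ expIdx n P.totalDegree) : Integrable (repCoeff J Q U ε P m) (sphereVol l) := by
  obtain ⟨K, -, hK⟩ := hd.exists_repCoeff_le hε P P.totalDegree
  exact Integrable.of_bound (hd.aestronglyMeasurable_repCoeff ε P m) K (.of_forall (hK m hm))

/-- The cut-off coefficients are compared with their value at `V_u` times the same cutoff. The
difference tends to zero at `V_u` even if `V_u` is a boundary point of `levelSet`, where the cutoff
itself jumps; this is why the error is measured against `levelDensity`. -/
theorem ae_tendsto_coeffError (hd : FrameData J Q U C) (hl : 1 ≤ l) {ε : ℝ}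
    (hε : IsGoodLevel J Q U ε) (P : MvPolynomial (CoordIdx N r) ℂ) :
    ∀ᵐ V : ZSpace l, ∀ X : XSpace N r,
      Tendsto (fun δ => coeffError J Q U P ε δ X V) (𝓝[>] 0) (𝓝 0) := by
  filter_upwards [hd.ae_unitVec hl] with V hV X
  obtain ⟨hV0, u, huU, hu⟩ := hV
  let c : (FrameIdx n →₀ ℕ) → ℂ := fun m => (frameRep P (realFrame J Q u)).coeff m
  have hP : evalX P X = ∑ m ∈ expIdx n P.totalDegree, c m * coordMonomial J Q m (unitVec V) X := by
    have hev : ∀ θ X, evalCoord J Q (frameRep P (realFrame J Q u)) θ X = _ :=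
      evalCoord_eq_sum J Q (totalDegree_linSubst_le _ P)
    rw [← evalCoord_frameRep hd.card (hd.gram_pos u huU).ne' P X, hev, ← hu]
  have hterm : ∀ m ∈ expIdx n P.totalDegree, Tendsto (fun δ => (‖V‖ ^ (l - 1) : ℂ) *
      tubeKernel (fun θ => repCoeff J Q U ε P m θ - c m *
        (levelSet J Q U ε).indicator (fun _ => 1) θ) δ V) (𝓝[>] 0) (𝓝 0) := by
    intro m hm
    refine tendsto_pow_mul_tubeKernel hl hd.ae_mem
      ((hd.integrable_repCoeff hε P hm).sub ((hd.integrable_levelIndicator ε).const_mul _))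
      hV0 hu ?_
    have hcont : Tendsto (fun θ : sphere (0 : ZSpace l) 1 =>
        (frameRep P (realFrame J Q θ)).coeff m - c m) (𝓝[U] u) (𝓝 0) := by
      have := (hd.continuousOn_coeff P m u huU).tendsto.sub_const (c m)
      rwa [sub_self] at this
    refine squeeze_zero_norm (fun θ => ?_) (tendsto_zero_iff_norm_tendsto_zero.1 hcont)
    change ‖repCoeff J Q U ε P m θ - c m * (levelSet J Q U ε).indicator (fun _ => 1) θ‖ ≤ _
    by_cases hθ : θ ∈ levelSet J Q U ε
    · rw [repCoeff, Set.indicator_of_mem hθ, Set.indicator_of_mem hθ, mul_one]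
    · rw [repCoeff, Set.indicator_of_notMem hθ, Set.indicator_of_notMem hθ, mul_zero, sub_zero,
        norm_zero]
      exact norm_nonneg _
  have hsum := tendsto_finsetSum (expIdx n P.totalDegree) fun m hm =>
    (hterm m hm).mul_const (coordMonomial J Q m (unitVec V) X)
  simp only [zero_mul, Finset.sum_const_zero] at hsum
  refine hsum.congr fun δ => ?_
  rw [coeffError, approxKernel, levelDensity, hP, Finset.mul_sum, Finset.sum_mul,
    ← Finset.sum_sub_distrib]
  refine Finset.sum_congr rfl fun m hm => ?_
  rw [tubeKernel_sub_const_mul (hd.integrable_repCoeff hε P hm) (hd.integrable_levelIndicator ε)]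
  ring

/-- The strict inequality persists on a neighbourhood of `V_u` within `U`, where the cutoff is
constantly `1`. -/
theorem ae_tendsto_levelDensity (hd : FrameData J Q U C) (hl : 1 ≤ l) (ε : ℝ) :
    ∀ᵐ V : ZSpace l, ε < frameGram J Q (unitVec V) →
      Tendsto (fun δ => levelDensity J Q U ε δ V) (𝓝[>] 0) (𝓝 1) := by
  filter_upwards [hd.ae_unitVec hl] with V hV hεV
  obtain ⟨hV0, u, huU, hu⟩ := hV
  refine tendsto_pow_mul_tubeKernel hl hd.ae_mem (hd.integrable_levelIndicator ε) hV0 hu ?_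
  refine tendsto_const_nhds.congr' ?_
  rw [← hu] at hεV
  filter_upwards [(hd.continuousOn_frameGram u huU).eventually (lt_mem_nhds hεV),
    self_mem_nhdsWithin] with θ hθ hθU
  rw [Set.indicator_of_mem]
  exact ⟨hθU, hθ.le⟩

/-- The bound does not depend on `ε`, in contrast to the bounds for the coefficients. The limit `ε →
0` rests on this. -/
theorem exists_levelDensity_le (hl : 1 ≤ l) (J : ZSpace l → XSpace N r → XSpace N r)
    (Q : ZSpace l → Fin n → XSpace N r) (U : Set (sphere (0 : ZSpace l) 1)) :
    ∃ K : ℝ, 0 ≤ K ∧ ∀ ε δ : ℝ, 0 < δ → ∀ᵐ V : ZSpace l, ‖levelDensity J Q U ε δ V‖ ≤ K := by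
  obtain ⟨C₀, h0, hC₀⟩ := exists_pow_mul_kernel_le hl
  refine ⟨C₀, h0, fun ε δ hδ => ?_⟩
  filter_upwards [ae_ne_zero hl] with V hV
  rw [← one_mul C₀]
  refine hC₀ _ 1 (fun θ => ?_) δ hδ V hV
  by_cases hθ : θ ∈ levelSet J Q U ε
  · rw [Set.indicator_of_mem hθ, norm_one]
  · rw [Set.indicator_of_notMem hθ, norm_zero]
    exact zero_le_one

theorem exists_approxKernel_le (hd : FrameData J Q U C) (hl : 1 ≤ l) {ε : ℝ}
    (hε : IsGoodLevel J Q U ε) (P : MvPolynomial (CoordIdx N r) ℂ) :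
    ∃ K : ℝ, ∀ δ : ℝ, 0 < δ → ∀ᵐ V : ZSpace l, ∀ X : XSpace N r,
      ‖(‖V‖ ^ (l - 1) : ℂ) * approxKernel J Q U P ε δ X V‖ ≤
        K * (1 + ‖X‖) ^ P.totalDegree := by
  obtain ⟨K, hK⟩ := hd.exists_amplitude_le hl hε P
  refine ⟨∑ m ∈ expIdx n P.totalDegree, K * (2 * C) ^ P.totalDegree, fun δ hδ => ?_⟩
  have h1 : ∀ᵐ V : ZSpace l, ∀ m ∈ expIdx n P.totalDegree,
      ‖(‖V‖ ^ (l - 1) : ℂ) * tubeKernel (repCoeff J Q U ε P m) δ V‖ ≤ K :=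
    (ae_ball_iff (Finset.countable_toSet _)).2 fun m hm => hK m hm δ hδ
  filter_upwards [h1, hd.ae_norm_coordMonomial_le hl] with V hV1 hV2 X
  rw [approxKernel, Finset.mul_sum, Finset.sum_mul]
  refine norm_sum_le_of_le _ fun m hm => ?_
  rw [← mul_assoc, norm_mul, mul_assoc]
  exact mul_le_mul (hV1 m hm) (hV2 _ m hm X) (norm_nonneg _) ((norm_nonneg _).trans (hV1 m hm))

theorem exists_coeffError_le (hd : FrameData J Q U C) (hl : 1 ≤ l) {ε : ℝ}
    (hε : IsGoodLevel J Q U ε) (P : MvPolynomial (CoordIdx N r) ℂ) :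
    ∃ K : ℝ, ∀ δ : ℝ, 0 < δ → ∀ᵐ V : ZSpace l, ∀ X : XSpace N r,
      ‖coeffError J Q U P ε δ X V‖ ≤ K * (1 + ‖X‖) ^ P.totalDegree := by
  obtain ⟨K₁, hK₁⟩ := hd.exists_approxKernel_le hl hε P
  obtain ⟨K₂, hK₂0, hK₂⟩ := exists_levelDensity_le hl J Q U
  obtain ⟨K₃, hK₃0, hK₃⟩ := exists_norm_evalX_le P
  refine ⟨K₁ + K₃ * K₂, fun δ hδ => ?_⟩
  filter_upwards [hK₁ δ hδ, hK₂ ε δ hδ] with V h1 h2 X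
  rw [coeffError]
  refine (norm_sub_le _ _).trans ?_
  rw [norm_mul (evalX P X), add_mul]
  refine add_le_add (h1 X) ((mul_le_mul (hK₃ X) h2 (norm_nonneg _) (by positivity)).trans_eq ?_)
  ring

theorem aestronglyMeasurable_levelDensity (hd : FrameData J Q U C) (ε δ : ℝ) :
    AEStronglyMeasurable (levelDensity J Q U ε δ) volume :=
  (by fun_prop : Continuous fun V : ZSpace l => (‖V‖ ^ (l - 1) : ℂ)).aestronglyMeasurable.mul
    (aestronglyMeasurable_tubeKernel (hd.integrable_levelIndicator ε).1 δ)

theorem aestronglyMeasurable_approxKernel (hd : FrameData J Q U C) (hl : 1 ≤ l) (ε δ : ℝ)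
    (P : MvPolynomial (CoordIdx N r) ℂ) (μ : Measure (XSpace N r)) [SFinite μ] :
    AEStronglyMeasurable (fun w : XSpace N r × ZSpace l =>
      (‖w.2‖ ^ (l - 1) : ℂ) * approxKernel J Q U P ε δ w.1 w.2) (μ.prod volume) := by
  refine (by fun_prop : Continuous fun w : XSpace N r × ZSpace l =>
    (‖w.2‖ ^ (l - 1) : ℂ)).aestronglyMeasurable.mul ?_
  exact Finset.aestronglyMeasurable_fun_sum _ fun m _ =>
    ((hd.aestronglyMeasurable_kernel ε δ P m).comp_snd).mul
      (hd.aestronglyMeasurable_coordMonomial hl m μ)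

theorem aestronglyMeasurable_coeffError (hd : FrameData J Q U C) (hl : 1 ≤ l) (ε δ : ℝ)
    (P : MvPolynomial (CoordIdx N r) ℂ) (μ : Measure (XSpace N r)) [SFinite μ] :
    AEStronglyMeasurable (fun w : XSpace N r × ZSpace l => coeffError J Q U P ε δ w.1 w.2)
      (μ.prod volume) :=
  (hd.aestronglyMeasurable_approxKernel hl ε δ P μ).sub
    (((continuous_evalX P).comp continuous_fst).aestronglyMeasurable.mul
      (hd.aestronglyMeasurable_levelDensity ε δ).comp_snd)

theorem nullMeasurableSet_gram_le (hd : FrameData J Q U C) (hl : 1 ≤ l) (ε : ℝ)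
    (μ : Measure (XSpace N r)) [SFinite μ] :
    NullMeasurableSet {w : XSpace N r × ZSpace l | frameGram J Q (unitVec w.2) ≤ ε}
      (μ.prod volume) := by
  have h1 : AEStronglyMeasurable (fun V : ZSpace l => frameGram J Q (unitVec V)) volume :=
    aestronglyMeasurable_comp_unitVec hl
      (hd.aestronglyMeasurable_of_continuousOn hd.continuousOn_frameGram)
  exact nullMeasurableSet_le
    (f := fun w : XSpace N r × ZSpace l => frameGram J Q (unitVec w.2)) (g := fun _ => ε)
    (h1.comp_snd).aemeasurable aemeasurable_const

end FrameData

end Convergence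

/-! ### The iterated limit in the mean for a general measure on the X-space -/

section MasterConvergence

variable {l N r n : ℕ} {J : ZSpace l → XSpace N r → XSpace N r}
  {Q : ZSpace l → Fin n → XSpace N r} {U : Set (sphere (0 : ZSpace l) 1)} {C : ℝ}

theorem expFourier_const_mul (c : ℂ) (h : ZSpace l → ℂ) (Z : ZSpace l) :
    expFourier (fun V => c * h V) Z = c * expFourier h Z := by
  rw [expFourier, expFourier, ← integral_const_mul]
  congr 1
  ext V
  ring

theorem integrable_exp_mul {h : ZSpace l → ℂ} (hh : Integrable h) (Z : ZSpace l) :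
    Integrable fun V => Complex.exp (Complex.I * (inner ℝ Z V : ℂ)) * h V := by
  refine hh.bdd_mul (c := 1) ?_ (.of_forall fun V => ?_)
  · exact (by fun_prop : Continuous fun V : ZSpace l =>
      Complex.exp (Complex.I * (inner ℝ Z V : ℂ))).aestronglyMeasurable
  · rw [mul_comm, Complex.norm_exp_ofReal_mul_I]

theorem expFourier_sub {h k : ZSpace l → ℂ} (hh : Integrable h) (hk : Integrable k)
    (Z : ZSpace l) : expFourier (fun V => h V - k V) Z = expFourier h Z - expFourier k Z := by
  rw [expFourier, expFourier, expFourier,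
    ← integral_sub (integrable_exp_mul hh Z) (integrable_exp_mul hk Z)]
  congr 1
  ext V
  ring

theorem ae_snd_of_ae {α : Type*} [MeasurableSpace α] (μ : Measure α) [SFinite μ]
    {p : ZSpace l → Prop} (hp : ∀ᵐ V, p V) :
    ∀ᵐ w : α × ZSpace l ∂(μ.prod volume), p w.2 :=
  Measure.quasiMeasurePreserving_snd.ae hp

namespace FrameData

theorem integrable_mul_approxKernel (hd : FrameData J Q U C) (hl : 1 ≤ l) {ε : ℝ}
    (hε : IsGoodLevel J Q U ε) (P : MvPolynomial (CoordIdx N r) ℂ) {δ : ℝ} (hδ : 0 < δ)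
    {F : ZSpace l → ℂ} (hF : IsDensity F) (X : XSpace N r) :
    Integrable fun V => ((‖V‖ ^ (l - 1) : ℂ) * F V) * approxKernel J Q U P ε δ X V := by
  simp only [approxKernel, Finset.mul_sum]
  refine integrable_finsetSum _ fun m hm => ?_
  have := hd.integrable_exp_mul_coordMonomial hl (hd.isDensity_amplitude hl hε P hm hδ hF).1 hm X 0
  simpa [mul_assoc] using this

/-- On the Fourier side the error is split by the set `S ε` where the Gram determinant is at most
`ε`. Off `S ε`, and for the variation of the coefficients everywhere, dominated convergence works as
`δ → 0`. On `S ε` the remainder is dominated uniformly in `δ` by a constant, independent of `ε`,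
times `h₀`, and `S ε` shrinks to a null set. The measure `μ` is left general so that points, balls,
spheres and the whole X-space are covered together. -/
theorem isIteratedL2Limit (hd : FrameData J Q U C) (hl : 1 ≤ l) {𝓔 : Filter ℝ}
    [𝓔.IsCountablyGenerated] (hlt : ∀ θ ∈ U, ∀ᶠ ε in 𝓔, ε < frameGram J Q θ)
    (hgood : ∀ᶠ ε in 𝓔, IsGoodLevel J Q U ε) (P : MvPolynomial (CoordIdx N r) ℂ)
    (μ : Measure (XSpace N r)) [SFinite μ] {F f : ℝ → ZSpace l → ℂ}
    (hF : ∀ s, 0 ≤ s → IsDensity (F s))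
    (hFw : ∀ s, 0 ≤ s → Integrable fun V => (‖V‖ ^ (l - 1) : ℂ) * F s V)
    (hf : ∀ s, 0 ≤ s → ∀ Z, expFourier (F s) Z = f s Z)
    (hL2 : MemLp (fun w : XSpace N r × ZSpace l =>
      (((1 + ‖w.1‖) ^ P.totalDegree : ℝ) : ℂ) * F ‖w.1‖ w.2) 2 (μ.prod volume)) :
    IsIteratedL2Limit (μ.prod volume) 𝓔
      (fun ε δ w => approximant J Q P (fun s V => (‖V‖ ^ (l - 1) : ℂ) * F s V) ε δ w.1 w.2)
      (fun w => evalX P w.1 * f ‖w.1‖ w.2) := by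
  set h₀ : XSpace N r × ZSpace l → ℂ := fun w =>
    (((1 + ‖w.1‖) ^ P.totalDegree : ℝ) : ℂ) * F ‖w.1‖ w.2 with hh₀
  have hpos : ∀ X : XSpace N r, (0 : ℝ) < (1 + ‖X‖) ^ P.totalDegree := fun X => by positivity
  have hn₀ : ∀ w, ‖h₀ w‖ = (1 + ‖w.1‖) ^ P.totalDegree * ‖F ‖w.1‖ w.2‖ := fun w => by
    rw [hh₀, norm_mul, Complex.norm_real, Real.norm_of_nonneg (hpos _).le]
  have hFm : AEStronglyMeasurable (fun w : XSpace N r × ZSpace l => F ‖w.1‖ w.2)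
      (μ.prod volume) := by
    have hcont : Continuous fun w : XSpace N r × ZSpace l =>
        ((((1 + ‖w.1‖) ^ P.totalDegree)⁻¹ : ℝ) : ℂ) :=
      Complex.continuous_ofReal.comp (Continuous.inv₀ (by fun_prop) fun w => (hpos _).ne')
    refine (hcont.aestronglyMeasurable.mul hL2.1).congr (.of_forall fun w => ?_)
    simp only [hh₀, Pi.mul_apply]
    rw [← mul_assoc, ← Complex.ofReal_mul, inv_mul_cancel₀ (hpos _).ne', Complex.ofReal_one,
      one_mul]
  have hPm : AEStronglyMeasurable (fun w : XSpace N r × ZSpace l => evalX P w.1)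
      (μ.prod volume) := ((continuous_evalX P).comp continuous_fst).aestronglyMeasurable
  obtain ⟨K₂, hK₂0, hK₂⟩ := exists_levelDensity_le hl J Q U
  obtain ⟨K₃, hK₃0, hK₃⟩ := exists_norm_evalX_le P
  have hmulF : ∀ (w : XSpace N r × ZSpace l) (z : ℂ) (K : ℝ),
      ‖z‖ ≤ K * (1 + ‖w.1‖) ^ P.totalDegree → ‖F ‖w.1‖ w.2 * z‖ ≤ K * ‖h₀ w‖ := by
    intro w z K hz
    rw [norm_mul, hn₀, ← mul_assoc, mul_comm]
    exact mul_le_mul_of_nonneg_right hz (norm_nonneg _)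
  -- the limit function
  have hPF : MemLp (fun w : XSpace N r × ZSpace l => evalX P w.1 * F ‖w.1‖ w.2) 2
      (μ.prod volume) := by
    refine hL2.of_le_mul (hPm.mul hFm) (c := K₃) (.of_forall fun w => ?_)
    rw [mul_comm]
    exact hmulF w _ K₃ (hK₃ _)
  have hPFi : ∀ X : XSpace N r, Integrable fun V => evalX P X * F ‖X‖ V := fun X =>
    (hF _ (norm_nonneg _)).1.const_mul _
  have hlimit : ∀ w : XSpace N r × ZSpace l, evalX P w.1 * f ‖w.1‖ w.2 =
      expFourier (fun V => evalX P w.1 * F ‖w.1‖ V) w.2 := fun w => by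
    rw [expFourier_const_mul, hf _ (norm_nonneg _)]
  refine ⟨?_, ?_⟩
  · simp_rw [hlimit]
    exact memLp_expFourier_prod (h := fun X V => evalX P X * F ‖X‖ V) hPF (.of_forall hPFi)
  -- the two parts of the error
  let B : ℝ → ℝ → XSpace N r × ZSpace l → ℂ := fun ε δ w =>
    F ‖w.1‖ w.2 * (evalX P w.1 * (levelDensity J Q U ε δ w.2 - 1))
  let S : ℝ → Set (XSpace N r × ZSpace l) := fun ε => {w | frameGram J Q (unitVec w.2) ≤ ε}
  let g₁ : ℝ → ℝ → XSpace N r × ZSpace l → ℂ := fun ε δ w =>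
    F ‖w.1‖ w.2 * coeffError J Q U P ε δ w.1 w.2 + (S ε)ᶜ.indicator (B ε δ) w
  have hS : ∀ ε, NullMeasurableSet (S ε) (μ.prod volume) := fun ε =>
    hd.nullMeasurableSet_gram_le hl ε μ
  have hBm : ∀ ε δ, AEStronglyMeasurable (B ε δ) (μ.prod volume) := fun ε δ =>
    hFm.mul (hPm.mul ((hd.aestronglyMeasurable_levelDensity ε δ).comp_snd.sub
      aestronglyMeasurable_const))
  have hBle : ∀ ε δ, 0 < δ → ∀ᵐ w ∂(μ.prod volume), ‖B ε δ w‖ ≤ (K₃ * (K₂ + 1)) * ‖h₀ w‖ := by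
    intro ε δ hδ
    filter_upwards [ae_snd_of_ae μ (hK₂ ε δ hδ)] with w hw
    refine hmulF w _ _ ?_
    rw [norm_mul, mul_right_comm]
    refine mul_le_mul (hK₃ _) ((norm_sub_le _ _).trans ?_) (norm_nonneg _) (by positivity)
    rw [norm_one]
    exact add_le_add_left hw 1
  have hg₁m : ∀ ε δ, AEStronglyMeasurable (g₁ ε δ) (μ.prod volume) := fun ε δ =>
    (hFm.mul (hd.aestronglyMeasurable_coeffError hl ε δ P μ)).add
      ((hBm ε δ).indicator₀ (hS ε).compl)
  have hg₁ : ∀ ε, IsGoodLevel J Q U ε →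
      Tendsto (fun δ => eLpNorm (g₁ ε δ) 2 (μ.prod volume)) (𝓝[>] 0) (𝓝 0) := by
    intro ε hε
    obtain ⟨K₁, hK₁⟩ := hd.exists_coeffError_le hl hε P
    refine tendsto_eLpNorm_two_of_dominated hL2 (K₁ + K₃ * (K₂ + 1)) (.of_forall (hg₁m ε)) ?_ ?_
    · filter_upwards [self_mem_nhdsWithin] with δ hδ
      filter_upwards [ae_snd_of_ae μ (hK₁ δ hδ), hBle ε δ hδ] with w hw1 hw2
      refine (norm_add_le _ _).trans ?_
      rw [add_mul]
      exact add_le_add (hmulF w _ K₁ (hw1 w.1)) ((norm_indicator_le_norm_self _ _).trans hw2)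
    · filter_upwards [ae_snd_of_ae μ (hd.ae_tendsto_coeffError hl hε P),
        ae_snd_of_ae μ (hd.ae_tendsto_levelDensity hl ε)] with w hw1 hw2
      have h1 := (hw1 w.1).const_mul (F ‖w.1‖ w.2)
      rw [mul_zero] at h1
      rw [← add_zero (0 : ℂ)]
      refine h1.add ?_
      by_cases hw : w ∈ S ε
      · simp only [Set.indicator_of_notMem (Set.notMem_compl_iff.2 hw)]
        exact tendsto_const_nhds
      · simp only [Set.indicator_of_mem (Set.mem_compl hw)]
        have h2 := (((hw2 (not_le.1 hw)).sub_const 1).const_mul (evalX P w.1)).const_mul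
          (F ‖w.1‖ w.2)
        simpa using h2
  have hg₂ : Tendsto (fun ε => eLpNorm ((S ε).indicator fun w => ((K₃ * (K₂ + 1) : ℝ) : ℂ) * h₀ w) 2
      (μ.prod volume)) 𝓔 (𝓝 0) := by
    refine tendsto_eLpNorm_two_of_dominated hL2 (K₃ * (K₂ + 1))
      (.of_forall fun ε => (hL2.1.const_mul _).indicator₀ (hS ε)) (.of_forall fun ε => ?_) ?_
    · refine .of_forall fun w => (norm_indicator_le_norm_self _ _).trans ?_
      rw [norm_mul, Complex.norm_real, Real.norm_of_nonneg (by positivity)]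
    · filter_upwards [ae_snd_of_ae μ (hd.ae_unitVec hl)] with w hw
      obtain ⟨-, u, huU, hu⟩ := hw
      refine tendsto_const_nhds.congr' ?_
      filter_upwards [hlt u huU] with ε hε
      rw [Set.indicator_of_notMem]
      rw [hu] at hε
      exact not_le.2 hε
  -- conclusion
  intro η hη
  set κ : ℝ≥0∞ := plancherelConst (ZSpace l) ^ (1 / 2 : ℝ) with hκ
  have hκt : κ ≠ ⊤ := ENNReal.rpow_ne_top_of_nonneg (by norm_num) plancherelConst_ne_top
  -- Plancherel multiplies the norm by `κ`, and the two parts of the error share the tolerance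
  -- equally.
  have hη' : 0 < η / κ / 2 := by
    refine ENNReal.half_pos (ENNReal.div_pos hη.ne' hκt).ne'
  -- The level `ε` is fixed first, making the part on `S ε` small for all `δ > 0`; only then is `δ`
  -- chosen, depending on `ε`.
  filter_upwards [hgood, hg₂.eventually (gt_mem_nhds hη')] with ε hε h2
  filter_upwards [self_mem_nhdsWithin, (hg₁ ε hε).eventually (gt_mem_nhds hη')] with δ hδ h1
  rw [Set.mem_Ioi] at hδ
  have hAi : ∀ X : XSpace N r, Integrable fun V =>
      ((‖V‖ ^ (l - 1) : ℂ) * F ‖X‖ V) * approxKernel J Q U P ε δ X V := fun X =>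
    hd.integrable_mul_approxKernel hl hε P hδ (hF _ (norm_nonneg _)) X
  have hAeq : ∀ w : XSpace N r × ZSpace l,
      approximant J Q P (fun s V => (‖V‖ ^ (l - 1) : ℂ) * F s V) ε δ w.1 w.2 =
      expFourier (fun V => ((‖V‖ ^ (l - 1) : ℂ) * F ‖w.1‖ V) * approxKernel J Q U P ε δ w.1 V)
        w.2 := fun w =>
    hd.approximant_eq_expFourier hl hε P hFw
      (fun s hs m hm => (hd.isDensity_amplitude hl hε P hm hδ (hF s hs)).1) w.1 w.2
  constructor
  · simp_rw [hAeq]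
    refine memLp_expFourier_prod
      (h := fun X V => ((‖V‖ ^ (l - 1) : ℂ) * F ‖X‖ V) * approxKernel J Q U P ε δ X V) ?_
      (.of_forall hAi)
    obtain ⟨K, hK⟩ := hd.exists_approxKernel_le hl hε P
    refine hL2.of_le_mul (c := K) ?_ ?_
    · refine (hFm.mul (hd.aestronglyMeasurable_approxKernel hl ε δ P μ)).congr
        (.of_forall fun w => ?_)
      simp only [Pi.mul_apply]
      ring
    · filter_upwards [ae_snd_of_ae μ (hK δ hδ)] with w hw
      rw [mul_comm (_ ^ _ : ℂ), mul_assoc]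
      exact hmulF w _ K (hw w.1)
  -- Multiplied by the weight, the kernel minus `P` is `coeffError` plus `P` times `levelDensity -
  -- 1`; the second term is distributed over `S ε` and its complement.
  have herr : ∀ w : XSpace N r × ZSpace l,
      ((‖w.2‖ ^ (l - 1) : ℂ) * F ‖w.1‖ w.2) * approxKernel J Q U P ε δ w.1 w.2 -
        evalX P w.1 * F ‖w.1‖ w.2 = g₁ ε δ w + (S ε).indicator (B ε δ) w := by
    intro w
    have hB : (S ε)ᶜ.indicator (B ε δ) w + (S ε).indicator (B ε δ) w = B ε δ w :=
      Set.indicator_compl_add_self_apply _ _ _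
    simp only [g₁]
    rw [add_assoc, hB]
    simp only [B, coeffError]
    ring
  have hg₁L : MemLp (g₁ ε δ) 2 (μ.prod volume) :=
    ⟨hg₁m ε δ, h1.trans_le le_top⟩
  have hle : eLpNorm ((S ε).indicator (B ε δ)) 2 (μ.prod volume) < η / κ / 2 := by
    refine (eLpNorm_mono_ae ?_).trans_lt h2
    filter_upwards [hBle ε δ hδ] with w hw
    by_cases hwS : w ∈ S ε
    · rw [Set.indicator_of_mem hwS, Set.indicator_of_mem hwS, norm_mul (Complex.ofReal _),
        Complex.norm_real, Real.norm_of_nonneg (by positivity)]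
      exact hw
    · rw [Set.indicator_of_notMem hwS, Set.indicator_of_notMem hwS]
  have hg₂L : MemLp ((S ε).indicator (B ε δ)) 2 (μ.prod volume) :=
    ⟨(hBm ε δ).indicator₀ (hS ε), hle.trans_le le_top⟩
  have hdiff : ((fun w : XSpace N r × ZSpace l =>
      approximant J Q P (fun s V => (‖V‖ ^ (l - 1) : ℂ) * F s V) ε δ w.1 w.2) -
      fun w => evalX P w.1 * f ‖w.1‖ w.2) = fun w => expFourier
        (fun V => ((‖V‖ ^ (l - 1) : ℂ) * F ‖w.1‖ V) * approxKernel J Q U P ε δ w.1 V -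
          evalX P w.1 * F ‖w.1‖ V) w.2 := by
    ext w
    rw [Pi.sub_apply, hAeq, hlimit, expFourier_sub (hAi w.1) (hPFi w.1)]
  have hsum : (fun w : XSpace N r × ZSpace l =>
      ((‖w.2‖ ^ (l - 1) : ℂ) * F ‖w.1‖ w.2) * approxKernel J Q U P ε δ w.1 w.2 -
        evalX P w.1 * F ‖w.1‖ w.2) = g₁ ε δ + (S ε).indicator (B ε δ) := funext herr
  rw [hdiff, eLpNorm_expFourier_prod' (h := fun X V =>
    ((‖V‖ ^ (l - 1) : ℂ) * F ‖X‖ V) * approxKernel J Q U P ε δ X V - evalX P X * F ‖X‖ V)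
    (by rw [hsum]; exact hg₁L.add hg₂L) (.of_forall fun X => (hAi X).sub (hPFi X)), hsum,
    mul_comm]
  have hfin : eLpNorm (g₁ ε δ + (S ε).indicator (B ε δ)) 2 (μ.prod volume) < η / κ := by
    refine (eLpNorm_add_le hg₁L.1 hg₂L.1 (by norm_num)).trans_lt ?_
    rw [← ENNReal.add_halves (η / κ)]
    exact ENNReal.add_lt_add h1 hle
  exact ENNReal.mul_lt_of_lt_div hfin

end FrameData

end MasterConvergence

/-! ### Transport of iterated limits between measures -/

section IteratedLimits

theorem IsIteratedL2Limit.mono_measure {α : Type*} [MeasurableSpace α] {ν ν' : Measure α}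
    {𝓔 : Filter ℝ} {u : ℝ → ℝ → α → ℂ} {w : α → ℂ} (h : IsIteratedL2Limit ν 𝓔 u w)
    (hν : ν' ≤ ν) : IsIteratedL2Limit ν' 𝓔 u w := by
  refine ⟨h.1.mono_measure hν, fun η hη => ?_⟩
  filter_upwards [h.2 η hη] with ε hε
  filter_upwards [hε] with δ hδ
  exact ⟨hδ.1.mono_measure hν, (eLpNorm_mono_measure _ hν).trans_lt hδ.2⟩

theorem IsIteratedL2Limit.comp_measurableEmbedding {α β : Type*} [MeasurableSpace α]
    [MeasurableSpace β] {ν : Measure α} {e : α → β} (he : MeasurableEmbedding e)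
    {𝓔 : Filter ℝ} {u : ℝ → ℝ → β → ℂ} {w : β → ℂ}
    (h : IsIteratedL2Limit (ν.map e) 𝓔 u w) :
    IsIteratedL2Limit ν 𝓔 (fun ε δ => u ε δ ∘ e) (w ∘ e) := by
  refine ⟨he.memLp_map_measure_iff.1 h.1, fun η hη => ?_⟩
  filter_upwards [h.2 η hη] with ε hε
  filter_upwards [hε] with δ hδ
  refine ⟨he.memLp_map_measure_iff.1 hδ.1, ?_⟩
  have := hδ.2
  rwa [he.eLpNorm_map_measure] at this

end IteratedLimits

/-! ### Fixed points, balls, spheres and the whole X-space -/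

section Specializations

variable {l N r n : ℕ} {J J' : ZSpace l → XSpace N r → XSpace N r}
  {Q : ZSpace l → Fin n → XSpace N r} {U : Set (sphere (0 : ZSpace l) 1)} {C : ℝ}

theorem memLp_weight_mul_of_ae_norm_le {D : ℕ} {μ : Measure (XSpace N r)} [SFinite μ]
    {F : ℝ → ZSpace l → ℂ} {R : ℝ} (hR : ∀ᵐ X ∂μ, ‖X‖ ≤ R)
    (hF : MemLp (fun w : XSpace N r × ZSpace l => F ‖w.1‖ w.2) 2 (μ.prod volume)) :
    MemLp (fun w : XSpace N r × ZSpace l => (((1 + ‖w.1‖) ^ D : ℝ) : ℂ) * F ‖w.1‖ w.2) 2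
      (μ.prod volume) := by
  refine hF.of_le_mul (c := (1 + R) ^ D) ?_ ?_
  · exact (by fun_prop : Continuous fun w : XSpace N r × ZSpace l =>
      (((1 + ‖w.1‖) ^ D : ℝ) : ℂ)).aestronglyMeasurable.mul hF.1
  · filter_upwards [Measure.quasiMeasurePreserving_fst.ae hR] with w hw
    rw [norm_mul, Complex.norm_real, Real.norm_of_nonneg (by positivity)]
    gcongr

instance isFiniteMeasure_sphereMeasure (N r : ℕ) (R : ℝ) :
    IsFiniteMeasure (sphereMeasure N r R) :=
  Measure.smul_finite _ ENNReal.ofReal_ne_top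

theorem ae_sphereMeasure_norm_le (N r : ℕ) {R : ℝ} (hR : 0 ≤ R) :
    ∀ᵐ X ∂(sphereMeasure N r R), ‖X‖ ≤ R := by
  refine Measure.ae_smul_measure ?_ _
  rw [ae_map_iff (by fun_prop) (measurableSet_le measurable_norm measurable_const)]
  refine .of_forall fun θ => ?_
  rw [norm_smul, mem_sphere_zero_iff_norm.1 θ.2, mul_one, Real.norm_of_nonneg hR]

/-- The weight depends on `X` only and commutes with the Fourier transform in `Z`, so Plancherel
carries the weighted integrability from `f` to its density. -/
theorem memLp_weight_mul_spectralDensity {D : ℕ} {μ : Measure (XSpace N r)} [SFinite μ]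
    {f : ℝ → ZSpace l → ℂ} (hfi : ∀ s, 0 ≤ s → Integrable (f s))
    (hf : MemLp (fun w : XSpace N r × ZSpace l =>
      (((1 + ‖w.1‖) ^ D : ℝ) : ℂ) * f ‖w.1‖ w.2) 2 (μ.prod volume)) :
    MemLp (fun w : XSpace N r × ZSpace l =>
      (((1 + ‖w.1‖) ^ D : ℝ) : ℂ) * spectralDensity (f ‖w.1‖) w.2) 2 (μ.prod volume) := by
  have h1 := memLp_expFourier_prod (h := fun X Z => (((1 + ‖X‖) ^ D : ℝ) : ℂ) * f ‖X‖ Z) hf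
    (.of_forall fun X => (hfi _ (norm_nonneg X)).const_mul _)
  have h2 := (h1.comp_measurePreserving ((MeasurePreserving.id μ).prod
    (Measure.measurePreserving_neg (volume : Measure (ZSpace l))))).const_mul
      (((plancherelConst (ZSpace l))⁻¹.toReal : ℂ))
  refine (memLp_congr_ae (.of_forall fun w => ?_)).1 h2
  simp only [Function.comp_apply, Prod.map_fst, Prod.map_snd, id_eq, spectralDensity]
  rw [expFourier_const_mul]
  ring

theorem memLp_spectralDensity_prod {μ : Measure (XSpace N r)} [SFinite μ]
    {f : ℝ → ZSpace l → ℂ} (hfi : ∀ s, 0 ≤ s → Integrable (f s))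
    (hf : MemLp (fun w : XSpace N r × ZSpace l => f ‖w.1‖ w.2) 2 (μ.prod volume)) :
    MemLp (fun w : XSpace N r × ZSpace l => spectralDensity (f ‖w.1‖) w.2) 2
      (μ.prod volume) := by
  have := memLp_weight_mul_spectralDensity (D := 0) hfi (by simpa using hf)
  simpa using this

namespace FrameData

variable {𝓔 : Filter ℝ}

theorem isIteratedL2Limit_slice (hd : FrameData J Q U C) (hl : 1 ≤ l)
    [𝓔.IsCountablyGenerated] (hlt : ∀ θ ∈ U, ∀ᶠ ε in 𝓔, ε < frameGram J Q θ)
    (hgood : ∀ᶠ ε in 𝓔, IsGoodLevel J Q U ε) (P : MvPolynomial (CoordIdx N r) ℂ)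
    {F f : ℝ → ZSpace l → ℂ} (hF : ∀ s, 0 ≤ s → IsDensity (F s))
    (hFw : ∀ s, 0 ≤ s → Integrable fun V => (‖V‖ ^ (l - 1) : ℂ) * F s V)
    (hf : ∀ s, 0 ≤ s → ∀ Z, expFourier (F s) Z = f s Z) (X : XSpace N r) :
    IsIteratedL2Limit volume 𝓔
      (fun ε δ Z => approximant J Q P (fun s V => (‖V‖ ^ (l - 1) : ℂ) * F s V) ε δ X Z)
      (fun Z => evalX P X * f ‖X‖ Z) := by
  have he : MeasurableEmbedding (Prod.mk X : ZSpace l → XSpace N r × ZSpace l) :=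
    measurableEmbedding_prodMk_left X
  -- With a Dirac measure on the X-space, convergence on the product is convergence in `Z` for the
  -- single point `X`.
  have h := hd.isIteratedL2Limit hl hlt hgood P (Measure.dirac X) hF hFw hf (by
    rw [Measure.dirac_prod, he.memLp_map_measure_iff]
    exact (hF _ (norm_nonneg X)).2.const_mul (((1 + ‖X‖) ^ P.totalDegree : ℝ) : ℂ))
  rw [Measure.dirac_prod] at h
  exact h.comp_measurableEmbedding he

theorem product_convergence (hd : FrameData J Q U C) (hl : 1 ≤ l)
    [𝓔.IsCountablyGenerated] (hlt : ∀ θ ∈ U, ∀ᶠ ε in 𝓔, ε < frameGram J Q θ)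
    (hgood : ∀ᶠ ε in 𝓔, IsGoodLevel J Q U ε) {f : ZSpace l → ℂ} (hf : ContDiff ℝ ∞ f)
    (hc : HasCompactSupport f) (P : MvPolynomial (CoordIdx N r) ℂ) :
    (∀ᶠ ε in 𝓔, ∀ δ > 0, approximant J Q P (fun _ => polarDensity f) ε δ ∈
      kappaDomain J J' Q (constAmplitudes l)) ∧
    (∀ X : XSpace N r, IsIteratedL2Limit volume 𝓔
      (fun ε δ Z => approximant J Q P (fun _ => polarDensity f) ε δ X Z)
      (fun Z => evalX P X * f Z)) ∧
    (∀ R : ℝ, IsIteratedL2Limit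
      ((volume.restrict (ball (0 : XSpace N r) R)).prod (volume : Measure (ZSpace l))) 𝓔
      (fun ε δ w => approximant J Q P (fun _ => polarDensity f) ε δ w.1 w.2)
      (fun w => evalX P w.1 * f w.2)) ∧
    (∀ R ρ : ℝ, 0 < R → 0 < ρ → IsIteratedL2Limit
      ((sphereMeasure N r R).prod (volume.restrict (ball (0 : ZSpace l) ρ))) 𝓔
      (fun ε δ w => approximant J Q P (fun _ => polarDensity f) ε δ w.1 w.2)
      (fun w => evalX P w.1 * f w.2)) := by
  have hF : IsDensity (spectralDensity f) :=
    ⟨integrable_spectralDensity hf hc, memLp_spectralDensity hf hc⟩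
  have hFw := integrable_polarDensity hf hc
  have hfinite : ∀ (μ : Measure (XSpace N r)) [IsFiniteMeasure μ] (R : ℝ),
      (∀ᵐ X ∂μ, ‖X‖ ≤ R) → IsIteratedL2Limit (μ.prod (volume : Measure (ZSpace l))) 𝓔
      (fun ε δ w => approximant J Q P (fun _ => polarDensity f) ε δ w.1 w.2)
      (fun w => evalX P w.1 * f w.2) := by
    intro μ _ R hR
    exact hd.isIteratedL2Limit hl hlt hgood P μ (F := fun _ => spectralDensity f)
      (f := fun _ => f) (fun _ _ => hF) (fun _ _ => hFw)
      (fun _ _ Z => expFourier_spectralDensity hf hc Z)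
      (memLp_weight_mul_of_ae_norm_le (F := fun _ => spectralDensity f) hR (hF.2.comp_snd _))
  refine ⟨?_, fun X => ?_, fun R => ?_, fun R ρ hR _ => ?_⟩
  · filter_upwards [hgood] with ε hε δ hδ
    exact hd.approximant_mem_kappaDomain hl hε P (fun _ _ => hFw) δ _ fun m hm =>
      ⟨_, hd.isDensity_amplitude hl hε P hm hδ hF, fun _ _ => rfl⟩
  · exact hd.isIteratedL2Limit_slice hl hlt hgood P (F := fun _ => spectralDensity f)
      (f := fun _ => f) (fun _ _ => hF) (fun _ _ => hFw)
      (fun _ _ Z => expFourier_spectralDensity hf hc Z) X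
  · have : IsFiniteMeasure ((volume : Measure (XSpace N r)).restrict (ball 0 R)) :=
      ⟨by rw [Measure.restrict_apply_univ]; exact measure_ball_lt_top⟩
    refine hfinite _ R ?_
    filter_upwards [ae_restrict_mem measurableSet_ball] with X hX
    exact (mem_ball_zero_iff.1 hX).le
  -- The convergence holds on the sphere times the whole Z-space; restricting to a ball only
  -- decreases the measure.
  · exact (hfinite _ R (ae_sphereMeasure_norm_le N r hR.le)).mono_measure
      (Measure.prod_mono le_rfl Measure.restrict_le_self)

theorem radial_convergence (hd : FrameData J Q U C) (hl : 1 ≤ l)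
    [𝓔.IsCountablyGenerated] (hlt : ∀ θ ∈ U, ∀ᶠ ε in 𝓔, ε < frameGram J Q θ)
    (hgood : ∀ᶠ ε in 𝓔, IsGoodLevel J Q U ε) {f : ℝ → ZSpace l → ℂ}
    (hf : ∀ s, 0 ≤ s → ContDiff ℝ ∞ (f s) ∧ HasCompactSupport (f s))
    (P : MvPolynomial (CoordIdx N r) ℂ) :
    (∀ᶠ ε in 𝓔, ∀ δ > 0, approximant J Q P (fun s => polarDensity (f s)) ε δ ∈
      kappaDomain J J' Q (sliceAmplitudes l)) ∧
    (∀ X : XSpace N r, IsIteratedL2Limit volume 𝓔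
      (fun ε δ Z => approximant J Q P (fun s => polarDensity (f s)) ε δ X Z)
      (fun Z => evalX P X * f ‖X‖ Z)) ∧
    ((∀ R : ℝ, MemLp (fun w : XSpace N r × ZSpace l => f ‖w.1‖ w.2) 2
        ((volume.restrict (ball 0 R)).prod volume)) →
      (∀ᶠ ε in 𝓔, ∀ δ > 0, approximant J Q P (fun s => polarDensity (f s)) ε δ ∈
        kappaDomain J J' Q (localAmplitudes l N r)) ∧
      (∀ R : ℝ, IsIteratedL2Limit
        ((volume.restrict (ball (0 : XSpace N r) R)).prod (volume : Measure (ZSpace l))) 𝓔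
        (fun ε δ w => approximant J Q P (fun s => polarDensity (f s)) ε δ w.1 w.2)
        (fun w => evalX P w.1 * f ‖w.1‖ w.2))) ∧
    (MemLp (fun w : XSpace N r × ZSpace l =>
        (((1 + ‖w.1‖) ^ P.totalDegree : ℝ) : ℂ) * f ‖w.1‖ w.2) 2 volume →
      IsIteratedL2Limit (volume : Measure (XSpace N r × ZSpace l)) 𝓔
        (fun ε δ w => approximant J Q P (fun s => polarDensity (f s)) ε δ w.1 w.2)
        (fun w => evalX P w.1 * f ‖w.1‖ w.2)) := by
  have hF : ∀ s, 0 ≤ s → IsDensity (spectralDensity (f s)) := fun s hs =>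
    ⟨integrable_spectralDensity (hf s hs).1 (hf s hs).2,
      memLp_spectralDensity (hf s hs).1 (hf s hs).2⟩
  have hFw : ∀ s, 0 ≤ s → Integrable (polarDensity (f s)) := fun s hs =>
    integrable_polarDensity (hf s hs).1 (hf s hs).2
  have hinv : ∀ s, 0 ≤ s → ∀ Z, expFourier (spectralDensity (f s)) Z = f s Z := fun s hs Z =>
    expFourier_spectralDensity (hf s hs).1 (hf s hs).2 Z
  have hfi : ∀ s, 0 ≤ s → Integrable (f s) := fun s hs =>
    (hf s hs).1.continuous.integrable_of_hasCompactSupport (hf s hs).2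
  refine ⟨?_, fun X => ?_, fun hloc => ⟨?_, fun R => ?_⟩, fun hL2 => ?_⟩
  · filter_upwards [hgood] with ε hε δ hδ
    exact hd.approximant_mem_kappaDomain hl hε P hFw δ _ fun m hm s hs =>
      hd.isDensity_amplitude hl hε P hm hδ (hF s hs)
  · exact hd.isIteratedL2Limit_slice hl hlt hgood P hF hFw hinv X
  · filter_upwards [hgood] with ε hε δ hδ
    refine hd.approximant_mem_kappaDomain hl hε P hFw δ _ fun m hm =>
      ⟨fun s hs => hd.isDensity_amplitude hl hε P hm hδ (hF s hs), fun R => ?_⟩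
    obtain ⟨K, hK⟩ := hd.exists_amplitude_le hl hε P
    have hFL := memLp_spectralDensity_prod hfi (hloc R)
    have heq : (fun w : XSpace N r × ZSpace l => polarDensity (f ‖w.1‖) w.2 *
        tubeKernel (repCoeff J Q U ε P m) δ w.2) = fun w => ((‖w.2‖ ^ (l - 1) : ℂ) *
          tubeKernel (repCoeff J Q U ε P m) δ w.2) * spectralDensity (f ‖w.1‖) w.2 := by
      ext w
      rw [polarDensity]
      ring
    rw [heq]
    refine hFL.of_le_mul (c := K)
      ((hd.aestronglyMeasurable_amplitude ε δ P m).comp_snd.mul hFL.1) ?_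
    filter_upwards [ae_snd_of_ae _ (hK m hm δ hδ)] with w hw
    rw [norm_mul]
    exact mul_le_mul_of_nonneg_right hw (norm_nonneg _)
  · refine hd.isIteratedL2Limit hl hlt hgood P _ hF hFw hinv
      (memLp_weight_mul_of_ae_norm_le (F := fun s => spectralDensity (f s)) (R := R) ?_
        (memLp_spectralDensity_prod hfi (hloc R)))
    filter_upwards [ae_restrict_mem measurableSet_ball] with X hX
    exact (mem_ball_zero_iff.1 hX).le
  · exact hd.isIteratedL2Limit hl hlt hgood P volume hF hFw hinv
      (memLp_weight_mul_spectralDensity hfi hL2)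

end FrameData

end Specializations

/-! ### Changing and constant bases as frame fields -/

section Frames

variable {l N r n a : ℕ} {j : ZSpace l →ₗ[ℝ] Matrix (Fin r) (Fin r) ℝ}

theorem continuous_hTypeJ (j : ZSpace l →ₗ[ℝ] Matrix (Fin r) (Fin r) ℝ) (a : ℕ) :
    Continuous fun w : ZSpace l × XSpace N r => hTypeJ j a w.1 w.2 := by
  have hj : ∀ i k, Continuous fun V : ZSpace l => j V i k := fun i k =>
    LinearMap.continuous_of_finiteDimensional ((Matrix.entryLinearMap ℝ ℝ i k).comp j)
  unfold hTypeJ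
  refine (PiLp.continuous_toLp 2 _).comp (continuous_pi fun c => ?_)
  simp only [Matrix.mulVec, dotProduct]
  refine continuous_const.mul (continuous_finsetSum _ fun i _ => ?_)
  exact ((hj _ _).comp continuous_fst).mul (by fun_prop)

theorem hTypeJ_add (V W : ZSpace l) (X : XSpace N r) :
    hTypeJ j a (V + W) X = hTypeJ j a V X + hTypeJ j a W X := by
  ext c
  simp [hTypeJ, Matrix.add_mulVec, mul_add]

theorem hTypeJ_smul (t : ℝ) (V : ZSpace l) (X : XSpace N r) :
    hTypeJ j a (t • V) X = t • hTypeJ j a V X := by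
  ext c
  simp [hTypeJ, Matrix.smul_mulVec, mul_left_comm]

theorem frameGram_eq_det_gram (J : ZSpace l → XSpace N r → XSpace N r)
    (Q : ZSpace l → Fin n → XSpace N r) (θ : ZSpace l) :
    frameGram J Q θ = (Matrix.gram ℝ (realFrame J Q θ)).det := rfl

theorem frameGram_nonneg (J : ZSpace l → XSpace N r → XSpace N r)
    (Q : ZSpace l → Fin n → XSpace N r) (θ : ZSpace l) : 0 ≤ frameGram J Q θ := by
  rw [frameGram_eq_det_gram]
  exact (Matrix.posSemidef_gram (𝕜 := ℝ) (realFrame J Q θ)).det_nonneg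

theorem frameGram_ne_zero_iff {J : ZSpace l → XSpace N r → XSpace N r}
    {Q : ZSpace l → Fin n → XSpace N r} {θ : ZSpace l} :
    frameGram J Q θ ≠ 0 ↔ LinearIndependent ℝ (realFrame J Q θ) := by
  rw [frameGram_eq_det_gram, Matrix.det_gram_ne_zero_iff_linearIndependent]

theorem frameGram_eq_one {J : ZSpace l → XSpace N r → XSpace N r}
    {Q : ZSpace l → Fin n → XSpace N r} {θ : ZSpace l} (h : Orthonormal ℝ (realFrame J Q θ)) :
    frameGram J Q θ = 1 := by
  rw [frameGram_eq_det_gram, Matrix.gram_eq_one_iff_orthonormal.2 h, Matrix.det_one]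

theorem card_frame {J : ZSpace l → XSpace N r → XSpace N r}
    {Q : ZSpace l → Fin n → XSpace N r} {θ : ZSpace l} (h : IsComplexBasisAt J Q θ) :
    n + n = N * r := by
  have h1 := Module.finrank_eq_card_basis (Module.Basis.mk h.1 h.2.ge)
  rw [finrank_euclideanSpace] at h1
  simpa using h1.symm

theorem exists_frameData_of_isChangingBasis {J' : ZSpace l → XSpace N r → XSpace N r}
    {Q : ZSpace l → Fin n → XSpace N r} (hl : 1 ≤ l)
    (hQ : IsChangingBasis (hTypeJ j a) J' Q) :
    ∃ U C, FrameData (hTypeJ j a) Q U C ∧ ∀ θ ∈ U, frameGram (hTypeJ j a) Q θ = 1 := by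
  obtain ⟨U, hU, hdense, hnull, hcont, hbasis⟩ := hQ
  have hone : ∀ θ ∈ U, frameGram (hTypeJ j a) Q θ = 1 := fun θ hθ =>
    frameGram_eq_one (hbasis θ hθ).1.1
  have : Nonempty (sphere (0 : ZSpace l) 1) := by
    have : Nonempty (Fin l) := ⟨⟨0, hl⟩⟩
    exact (NormedSpace.sphere_nonempty.2 zero_le_one).to_subtype
  obtain ⟨θ₀, hθ₀⟩ := hdense.nonempty
  refine ⟨U, 1, ⟨hU, compl_mem_ae_iff.2 hnull |> fun h => by simpa using h, ?_, ?_, le_rfl, ?_, ?_⟩,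
    hone⟩
  · have hQi : ∀ i, ContinuousOn (fun θ : sphere (0 : ZSpace l) 1 => Q θ i) U :=
      fun i => continuousOn_pi.1 hcont i
    refine continuousOn_pi.2 fun u => ?_
    rcases u with i | i
    · exact hQi i
    · exact (continuous_hTypeJ j a).comp_continuousOn
        (continuous_subtype_val.continuousOn.prodMk (hQi i))
  · exact fun θ hθ u => ((hbasis θ hθ).1.1.1 u).le
  · exact fun θ hθ => by rw [hone θ hθ]; exact one_pos
  · exact card_frame ⟨(hbasis θ₀ hθ₀).1.1.linearIndependent, (hbasis θ₀ hθ₀).1.2⟩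

section Constant

variable {q : Fin n → XSpace N r}

theorem continuous_realFrame_const (j : ZSpace l →ₗ[ℝ] Matrix (Fin r) (Fin r) ℝ) (a : ℕ)
    (q : Fin n → XSpace N r) :
    Continuous fun V : ZSpace l => realFrame (hTypeJ j a) (fun _ => q) V := by
  refine continuous_pi fun u => ?_
  rcases u with i | i
  · exact continuous_const
  · exact (continuous_hTypeJ j a).comp (continuous_id.prodMk continuous_const)

theorem continuous_frameGram_const (j : ZSpace l →ₗ[ℝ] Matrix (Fin r) (Fin r) ℝ) (a : ℕ)
    (q : Fin n → XSpace N r) :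
    Continuous fun V : ZSpace l => frameGram (hTypeJ j a) (fun _ => q) V := by
  have h := continuous_pi_iff.1 (continuous_realFrame_const j a q)
  unfold frameGram
  refine Continuous.matrix_det (continuous_matrix fun u v => ?_)
  exact (h u).inner (h v)

/-- Scaling `V` rescales the vectors `J_V(Q_i)` and leaves the `Q_i` alone, so independence is a
property of the line through `V`. -/
theorem frameGram_smul_ne_zero_iff {t : ℝ} (ht : t ≠ 0) (V : ZSpace l) :
    frameGram (hTypeJ j a) (fun _ => q) (t • V) ≠ 0 ↔
      frameGram (hTypeJ j a) (fun _ => q) V ≠ 0 := by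
  rw [frameGram_ne_zero_iff, frameGram_ne_zero_iff]
  let w : Fin n ⊕ Fin n → ℝˣ := Sum.elim (fun _ => 1) (fun _ => Units.mk0 t ht)
  have hw : realFrame (hTypeJ j a) (fun _ => q) (t • V) =
      w • realFrame (hTypeJ j a) (fun _ => q) V := by
    ext u c
    rcases u with i | i
    · simp [realFrame, w]
    · simp [realFrame, w, hTypeJ_smul, Units.smul_def]
  rw [hw, LinearIndependent.units_smul_iff]

/-- By linearity of `J` in `V` the frame vectors are affine in `t`, so the determinant is a
polynomial in `t`. -/
theorem analyticOnNhd_frameGram_line (V W : ZSpace l) :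
    AnalyticOnNhd ℝ (fun t : ℝ => frameGram (hTypeJ j a) (fun _ => q) (V + t • W)) Set.univ := by
  have hv : ∀ u : Fin n ⊕ Fin n, ∃ x y : XSpace N r,
      ∀ t : ℝ, realFrame (hTypeJ j a) (fun _ => q) (V + t • W) u = x + t • y := by
    intro u
    rcases u with i | i
    · exact ⟨q i, 0, fun t => by simp [realFrame]⟩
    · exact ⟨hTypeJ j a V (q i), hTypeJ j a W (q i), fun t => by
        simp [realFrame, hTypeJ_add, hTypeJ_smul]⟩
  choose x y hxy using hv
  intro t _
  simp only [frameGram, Matrix.det_apply, Matrix.of_apply, hxy, inner_add_left, inner_add_right,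
    inner_smul_left, inner_smul_right]
  refine Finset.analyticAt_fun_sum _ fun σ _ => ?_
  have hprod : AnalyticAt ℝ (fun t : ℝ => ∏ u, (inner ℝ (x (σ u)) (x u) +
      t * inner ℝ (y (σ u)) (x u) + t * (inner ℝ (x (σ u)) (y u) + t * inner ℝ (y (σ u)) (y u)))) t :=
    Finset.analyticAt_fun_prod _ fun u _ => by fun_prop
  simp only [Units.smul_def, zsmul_eq_mul, conj_trivial]
  exact AnalyticAt.fun_mul analyticAt_const hprod

/-- By Fubini in the direction `V₀` it suffices to treat each line `y + ℝ V₀`. Points far out on it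
have directions close to that of `V₀`, so the determinant is not identically zero there, and by
analyticity its zeros on the line are discrete. -/
theorem ae_frameGram_ne_zero {V₀ : ZSpace l}
    (h₀ : frameGram (hTypeJ j a) (fun _ => q) V₀ ≠ 0) :
    ∀ᵐ V : ZSpace l, frameGram (hTypeJ j a) (fun _ => q) V ≠ 0 := by
  have hc := continuous_frameGram_const j a q
  refine ae_mem_of_ae_add_linearMap_mem (LinearMap.toSpanSingleton ℝ (ZSpace l) V₀)
    (volume : Measure ℝ) volume (s := {V | frameGram (hTypeJ j a) (fun _ => q) V ≠ 0})
    (hc.measurable (measurableSet_singleton 0).compl) fun y => ?_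
  have hlim : Tendsto (fun t : ℝ => frameGram (hTypeJ j a) (fun _ => q) (t • y + V₀))
      (𝓝[>] 0) (𝓝 (frameGram (hTypeJ j a) (fun _ => q) V₀)) := by
    have : Continuous fun t : ℝ => frameGram (hTypeJ j a) (fun _ => q) (t • y + V₀) :=
      hc.comp (by fun_prop)
    simpa using (this.tendsto 0).mono_left nhdsWithin_le_nhds
  obtain ⟨t, ht, ht0⟩ := ((hlim.eventually_ne h₀).and self_mem_nhdsWithin).exists
  have hx : frameGram (hTypeJ j a) (fun _ => q) (y + t⁻¹ • V₀) ≠ 0 := by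
    rw [← frameGram_smul_ne_zero_iff ht0.ne', smul_add, smul_inv_smul₀ ht0.ne']
    exact ht
  have hmem := (analyticOnNhd_frameGram_line (j := j) (a := a) (q := q) y
    V₀).preimage_zero_mem_codiscrete hx
  have hae := ae_restrict_le_codiscreteWithin (μ := (volume : Measure ℝ)) MeasurableSet.univ hmem
  rw [Measure.restrict_univ] at hae
  filter_upwards [hae] with s hs using hs

/-- The set where the Gram determinant is positive is open and of full measure; the bound on the
frame comes from compactness of the sphere. -/
theorem exists_frameData_of_const (hl : 1 ≤ l) {V₀ : ZSpace l}
    (h₀ : IsComplexBasisAt (hTypeJ j a) (fun _ => q) V₀) :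
    ∃ U C, FrameData (hTypeJ j a) (fun _ : ZSpace l => q) U C := by
  have hcont : Continuous fun θ : sphere (0 : ZSpace l) 1 =>
      realFrame (hTypeJ j a) (fun _ => q) θ :=
    (continuous_realFrame_const j a q).comp continuous_subtype_val
  have hG : Continuous fun θ : sphere (0 : ZSpace l) 1 =>
      frameGram (hTypeJ j a) (fun _ => q) θ :=
    (continuous_frameGram_const j a q).comp continuous_subtype_val
  obtain ⟨C, hC⟩ := isCompact_univ.exists_bound_of_continuousOn hcont.continuousOn
  refine ⟨{θ | 0 < frameGram (hTypeJ j a) (fun _ => q) θ}, max C 1,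
    isOpen_lt continuous_const hG, ?_, hcont.continuousOn, fun θ _ u => ?_, le_max_right _ _,
    fun θ hθ => hθ, card_frame h₀⟩
  · have h1 : ∀ᵐ V : ZSpace l, frameGram (hTypeJ j a) (fun _ => q) (unitVec V) ≠ 0 := by
      filter_upwards [ae_frameGram_ne_zero (frameGram_ne_zero_iff.2 h₀.1), ae_ne_zero hl]
        with V hV hV0
      rw [unitVec, frameGram_smul_ne_zero_iff (inv_ne_zero (norm_ne_zero_iff.2 hV0))]
      exact hV
    have h2 := (ae_unitVec_iff hl fun θ => frameGram (hTypeJ j a) (fun _ => q) θ ≠ 0).1 h1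
    filter_upwards [h2] with θ hθ
    exact (frameGram_nonneg _ _ _).lt_of_ne' hθ
  · exact (norm_le_pi_norm _ u).trans ((hC θ (Set.mem_univ _)).trans (le_max_left _ _))

end Constant

theorem exists_frameData {J' : ZSpace l → XSpace N r → XSpace N r}
    {Q : ZSpace l → Fin n → XSpace N r} (hl : 1 ≤ l) {𝓔 : Filter ℝ}
    (hQ : (IsChangingBasis (hTypeJ j a) J' Q ∧ 𝓔 = pure 0) ∨
      (IsConstantBasis (hTypeJ j a) J' Q ∧ 𝓔 = 𝓝[>] 0)) :
    𝓔.IsCountablyGenerated ∧ ∃ U C, FrameData (hTypeJ j a) Q U C ∧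
      (∀ θ ∈ U, ∀ᶠ ε in 𝓔, ε < frameGram (hTypeJ j a) Q θ) ∧
      ∀ᶠ ε in 𝓔, IsGoodLevel (hTypeJ j a) Q U ε := by
  rcases hQ with ⟨hQ, rfl⟩ | ⟨⟨hconst, -, V₀, -, h₀⟩, rfl⟩
  · obtain ⟨U, C, hd, hone⟩ := exists_frameData_of_isChangingBasis hl hQ
    refine ⟨inferInstance, U, C, hd, fun θ hθ => ?_, ?_⟩
    · rw [eventually_pure]
      exact hd.gram_pos θ hθ
    · rw [eventually_pure]
      -- Orthonormal frames have Gram determinant `1`, so no cutoff is needed at `ε = 0`; for a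
      -- constant basis the lower bound is `ε` itself.
      exact ⟨1, one_pos, fun θ hθ _ => (hone θ hθ).ge⟩
  · obtain ⟨q, rfl⟩ : ∃ q, Q = fun _ => q := ⟨Q 0, funext fun θ => hconst θ 0⟩
    obtain ⟨U, C, hd⟩ := exists_frameData_of_const hl h₀
    refine ⟨inferInstance, U, C, hd, fun θ hθ => ?_, ?_⟩
    · exact mem_nhdsWithin_of_mem_nhds (gt_mem_nhds (hd.gram_pos θ hθ))
    · filter_upwards [self_mem_nhdsWithin] with ε hε
      exact ⟨ε, hε, fun θ _ h => h⟩

end Frames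

/-! ### Gaussian weights and the uniqueness of moments -/

section GaussianWeights

variable {E : Type*} [NormedAddCommGroup E] [InnerProductSpace ℝ E] [FiniteDimensional ℝ E]
  [MeasurableSpace E] [BorelSpace E]

theorem integrable_exp_neg_norm_sq : Integrable fun X : E => Real.exp (-‖X‖ ^ 2) := by
  have h := (GaussianFourier.integrable_cexp_neg_mul_sq_norm_add (V := E) (b := 1) (by simp)
    0 0).norm
  refine h.congr (.of_forall fun X => ?_)
  simp only [Complex.norm_exp]
  congr 1
  simp [← Complex.ofReal_pow]

theorem memLp_exp_mul_norm_sub_sq (c : ℝ) :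
    MemLp (fun X : E => ((Real.exp (c * ‖X‖ - ‖X‖ ^ 2) : ℝ) : ℂ)) 2 volume := by
  have hm : AEStronglyMeasurable (fun X : E => ((Real.exp (c * ‖X‖ - ‖X‖ ^ 2) : ℝ) : ℂ)) volume :=
    (by fun_prop : Continuous fun X : E =>
      ((Real.exp (c * ‖X‖ - ‖X‖ ^ 2) : ℝ) : ℂ)).aestronglyMeasurable
  rw [memLp_two_iff_integrable_sq_norm hm]
  refine (integrable_exp_neg_norm_sq.const_mul (Real.exp (c ^ 2))).mono' (hm.norm.pow 2)
    (.of_forall fun X => ?_)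
  rw [Complex.norm_real, Real.norm_of_nonneg (Real.exp_pos _).le, Real.norm_of_nonneg (by positivity),
    ← Real.exp_nat_mul, ← Real.exp_add, Real.exp_le_exp]
  push_cast
  -- Completing the square: `2(c s - s²) ≤ c² - s²`.
  nlinarith [sq_nonneg (c - ‖X‖)]

/-- The polynomial is absorbed by `x ^ k ≤ k! e ^ x` at `x = 1 + s`, at the price of a linear term
in the exponent, which the Gaussian still dominates. -/
theorem one_add_pow_mul_exp_le (k : ℕ) {s : ℝ} (hs : 0 ≤ s) :
    (1 + s) ^ k * Real.exp (-s ^ 2) ≤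
      (k.factorial * Real.exp 1) * Real.exp (1 * s - s ^ 2) := by
  have h1 : (1 + s) ^ k ≤ k.factorial * Real.exp (1 + s) := by
    have := Real.pow_div_factorial_le_exp (1 + s) (by positivity) k
    rwa [div_le_iff₀ (by positivity), mul_comm] at this
  refine (mul_le_mul_of_nonneg_right h1 (Real.exp_pos _).le).trans_eq ?_
  rw [mul_assoc, mul_assoc, ← Real.exp_add, ← Real.exp_add]
  ring_nf

/-- The function `g = e^{-|X|²} h` remains integrable against `e^{c|X|}` for every `c`, so its
Fourier integral may be expanded termwise. All terms are moments and vanish, hence the transform of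
`g` is zero and Plancherel gives `g = 0`. -/
theorem ae_eq_zero_of_forall_integral_inner_pow {h : E → ℂ} (hh : MemLp h 2 volume)
    (hz : ∀ (ξ : E) (k : ℕ),
      ∫ X, (inner ℝ ξ X : ℂ) ^ k * ((Real.exp (-‖X‖ ^ 2) : ℂ) * h X) = 0) : h =ᵐ[volume] 0 := by
  set g : E → ℂ := fun X => (Real.exp (-‖X‖ ^ 2) : ℂ) * h X with hg
  have hgn : ∀ X, ‖g X‖ = Real.exp (-‖X‖ ^ 2) * ‖h X‖ := fun X => by
    rw [hg, norm_mul, Complex.norm_real, Real.norm_of_nonneg (Real.exp_pos _).le]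
  have hgm : AEStronglyMeasurable g volume :=
    (by fun_prop : Continuous fun X : E => (Real.exp (-‖X‖ ^ 2) : ℂ)).aestronglyMeasurable.mul hh.1
  have hexp : ∀ c : ℝ, Integrable fun X => Real.exp (c * ‖X‖) * ‖g X‖ := by
    intro c
    have := ((memLp_exp_mul_norm_sub_sq (E := E) c).integrable_mul hh).norm
    refine this.congr (.of_forall fun X => ?_)
    simp only [Pi.mul_apply]
    rw [norm_mul, Complex.norm_real, Real.norm_of_nonneg (Real.exp_pos _).le, hgn, ← mul_assoc,
      ← Real.exp_add, sub_eq_add_neg]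
  have hgi : Integrable g := by
    rw [← integrable_norm_iff hgm]
    simpa using hexp 0
  have hg2 : MemLp g 2 volume := by
    refine hh.mono hgm (.of_forall fun X => ?_)
    rw [hgn]
    exact mul_le_of_le_one_left (norm_nonneg _) (Real.exp_le_one_iff.2 (by simp))
  have hft : ∀ Z, expFourier g Z = 0 := by
    intro Z
    have hsum : HasSum (fun k : ℕ => ∫ X, (Complex.I * (inner ℝ Z X : ℂ)) ^ k / k.factorial * g X)
        (∫ X, Complex.exp (Complex.I * (inner ℝ Z X : ℂ)) * g X) := by
      refine hasSum_integral_of_dominated_convergence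
        (fun k X => (‖Z‖ * ‖X‖) ^ k / k.factorial * ‖g X‖) (fun k => ?_)
        (fun k => .of_forall fun X => ?_) (.of_forall fun X => ?_) ?_ (.of_forall fun X => ?_)
      · exact (by fun_prop : Continuous fun X : E =>
          (Complex.I * (inner ℝ Z X : ℂ)) ^ k / k.factorial).aestronglyMeasurable.mul hgm
      · rw [norm_mul, norm_div, norm_pow, norm_mul, Complex.norm_I, one_mul, Complex.norm_real,
          Complex.norm_natCast]
        gcongr
        exact norm_inner_le_norm Z X
      · exact (Real.summable_pow_div_factorial _).mul_right _
      · refine (hexp ‖Z‖).congr (.of_forall fun X => ?_)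
        simp only
        rw [tsum_mul_right, Real.exp_eq_exp_ℝ, NormedSpace.exp_eq_tsum_div]
      · have := (NormedSpace.expSeries_div_hasSum_exp (𝔸 := ℂ)
          (Complex.I * (inner ℝ Z X : ℂ))).mul_right (g X)
        rwa [← Complex.exp_eq_exp_ℂ] at this
    have hzero : ∀ k : ℕ, ∫ X, (Complex.I * (inner ℝ Z X : ℂ)) ^ k / k.factorial * g X = 0 := by
      intro k
      have : ∀ X, (Complex.I * (inner ℝ Z X : ℂ)) ^ k / k.factorial * g X =
          (Complex.I ^ k / k.factorial) * ((inner ℝ Z X : ℂ) ^ k * g X) := fun X => by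
        rw [mul_pow]
        ring
      simp_rw [this]
      rw [integral_const_mul, hz, mul_zero]
    simp_rw [hzero] at hsum
    exact hsum.unique hasSum_zero
  have h0 := lintegral_expFourier_sq hgi hg2
  simp only [hft, enorm_zero] at h0
  rw [eq_comm, show (0 : ℝ≥0∞) ^ 2 = 0 by norm_num, lintegral_zero, mul_eq_zero,
    or_iff_right plancherelConst_ne_zero, lintegral_eq_zero_iff' (hgm.enorm.pow_const 2)] at h0
  filter_upwards [h0] with X hX
  have hX' : g X = 0 := by simpa using hX
  exact (mul_eq_zero.1 hX').resolve_left (by simp)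

end GaussianWeights

/-! ### Square integrability of the Gaussian part of the domain -/

section GaussDomain

variable {l N r n : ℕ} {J J' : ZSpace l → XSpace N r → XSpace N r}
  {Q : ZSpace l → Fin n → XSpace N r} {U : Set (sphere (0 : ZSpace l) 1)} {C : ℝ}

theorem memLp_mul_prod {α β : Type*} [MeasurableSpace α] [MeasurableSpace β] {μ : Measure α}
    {ν : Measure β} [SFinite μ] [SFinite ν] {f : α → ℂ} {g : β → ℂ} (hf : MemLp f 2 μ)
    (hg : MemLp g 2 ν) : MemLp (fun w : α × β => f w.1 * g w.2) 2 (μ.prod ν) := by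
  refine ⟨hf.1.comp_fst.mul hg.1.comp_snd, ?_⟩
  have h1 : eLpNorm (fun w : α × β => f w.1 * g w.2) 2 (μ.prod ν) ^ 2 =
      eLpNorm f 2 μ ^ 2 * eLpNorm g 2 ν ^ 2 := by
    simp only [eLpNorm_two_sq, enorm_mul, mul_pow]
    exact lintegral_prod_mul (hf.1.enorm.pow_const 2) (hg.1.enorm.pow_const 2)
  have h2 : eLpNorm (fun w : α × β => f w.1 * g w.2) 2 (μ.prod ν) ^ 2 < ⊤ := by
    rw [h1]
    exact ENNReal.mul_lt_top (ENNReal.pow_lt_top hf.2) (ENNReal.pow_lt_top hg.2)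
  exact (ENNReal.pow_lt_top_iff.1 h2).resolve_right two_ne_zero

theorem FrameData.memLp_gauss_mul_coordMonomial (hd : FrameData J Q U C) (hl : 1 ≤ l) (i : ℕ)
    (m : FrameIdx n →₀ ℕ) {ψ : ZSpace l → ℂ} (hψ : MemLp ψ 2 volume) :
    MemLp (fun w : XSpace N r × ZSpace l => ((Real.exp (-‖w.1‖ ^ 2) : ℂ) *
      ((‖w.1‖ : ℂ) ^ i * ψ w.2)) * coordMonomial J Q m (unitVec w.2) w.1) 2
      (volume.prod volume) := by
  have hC : 0 ≤ C := zero_le_one.trans hd.one_le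
  refine (memLp_mul_prod (memLp_exp_mul_norm_sub_sq (E := XSpace N r) 1) hψ).of_le_mul
    (c := (2 * C) ^ m.degree * ((i + m.degree).factorial * Real.exp 1)) ?_ ?_
  · refine AEStronglyMeasurable.mul ?_ (hd.aestronglyMeasurable_coordMonomial hl m volume)
    refine (by fun_prop : Continuous fun w : XSpace N r × ZSpace l =>
      (Real.exp (-‖w.1‖ ^ 2) : ℂ)).aestronglyMeasurable.mul ?_
    exact (by fun_prop : Continuous fun w : XSpace N r × ZSpace l =>
      (‖w.1‖ : ℂ) ^ i).aestronglyMeasurable.mul hψ.1.comp_snd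
  · filter_upwards [ae_snd_of_ae volume (hd.ae_norm_coordMonomial_le hl)] with w hw
    have h1 := hw m.degree m (mem_expIdx.2 le_rfl) w.1
    have h2 := one_add_pow_mul_exp_le (i + m.degree) (norm_nonneg w.1)
    have hX := norm_nonneg w.1
    simp only [norm_mul, norm_pow, Complex.norm_real, Real.norm_eq_abs, Real.abs_exp, abs_norm]
    calc Real.exp (-‖w.1‖ ^ 2) * (‖w.1‖ ^ i * ‖ψ w.2‖) * ‖coordMonomial J Q m (unitVec w.2) w.1‖
        ≤ Real.exp (-‖w.1‖ ^ 2) * ((1 + ‖w.1‖) ^ i * ‖ψ w.2‖) *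
          ((2 * C) ^ m.degree * (1 + ‖w.1‖) ^ m.degree) := by
          gcongr
          linarith
      _ = (2 * C) ^ m.degree * ((1 + ‖w.1‖) ^ (i + m.degree) * Real.exp (-‖w.1‖ ^ 2)) *
          ‖ψ w.2‖ := by
          rw [pow_add]
          ring
      _ ≤ (2 * C) ^ m.degree * (((i + m.degree).factorial * Real.exp 1) *
          Real.exp (1 * ‖w.1‖ - ‖w.1‖ ^ 2)) * ‖ψ w.2‖ := by gcongr
      _ = (2 * C) ^ m.degree * ((i + m.degree).factorial * Real.exp 1) *
          (Real.exp (1 * ‖w.1‖ - ‖w.1‖ ^ 2) * ‖ψ w.2‖) := by ring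

theorem twistedFourier_eq_expFourier (p q : Fin n → ℕ) (φ : ℝ → ZSpace l → ℂ) (X : XSpace N r)
    (Z : ZSpace l) : twistedFourier J Q p q φ X Z = expFourier (fun V => φ ‖X‖ V *
      coordMonomial J Q (Finsupp.equivFunOnFinite.symm (Sum.elim p q)) (unitVec V) X) Z := by
  rw [twistedFourier, expFourier]
  congr 1
  ext V
  rw [coordMonomial_eq]
  simp only [Finsupp.equivFunOnFinite_symm_apply_apply, Sum.elim_inl, Sum.elim_inr]
  ring

theorem FrameData.integrable_mul_coordMonomial (hd : FrameData J Q U C) (hl : 1 ≤ l)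
    {ψ : ZSpace l → ℂ} (hψ : Integrable ψ) (m : FrameIdx n →₀ ℕ) (X : XSpace N r) :
    Integrable fun V => ψ V * coordMonomial J Q m (unitVec V) X := by
  simpa using hd.integrable_exp_mul_coordMonomial hl hψ (mem_expIdx.2 le_rfl : m ∈ expIdx n _) X 0

/-- The Gaussian beats the growth of the powers of `|X|` and of the coordinates, so the generators
are transforms of square integrable functions; the property passes to the span. -/
theorem FrameData.memLp_of_mem_kappaDomain (hd : FrameData J Q U C) (hl : 1 ≤ l)
    {u : XSpace N r → ZSpace l → ℂ} (hu : u ∈ kappaDomain J J' Q (gaussAmplitudes l)) :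
    MemLp (fun w : XSpace N r × ZSpace l => u w.1 w.2) 2 volume := by
  obtain ⟨w, hw, rfl⟩ := Submodule.mem_map.1 hu
  clear hu
  induction hw using Submodule.span_induction with
  | mem x hx =>
    obtain ⟨p, q, φ, ⟨k, ψ, hψ, hφ⟩, rfl⟩ := hx
    simp only [LinearMap.fst_apply, twistedFourier_eq_expFourier]
    set m : FrameIdx n →₀ ℕ := Finsupp.equivFunOnFinite.symm (Sum.elim p q)
    have heq : ∀ s V, φ s V =
        ∑ i ∈ Finset.range k, (Real.exp (-s ^ 2) : ℂ) * ((s : ℂ) ^ i * ψ i V) := fun s V => by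
      rw [hφ, Finset.mul_sum]
    refine memLp_expFourier_prod
      (h := fun X V => φ ‖X‖ V * coordMonomial J Q m (unitVec V) X) ?_ (.of_forall fun X => ?_)
    · simp only [heq, Finset.sum_mul]
      exact memLp_finsetSum _ fun i _ => hd.memLp_gauss_mul_coordMonomial hl i m (hψ i).2
    · refine hd.integrable_mul_coordMonomial hl ?_ m X
      have : φ ‖X‖ = fun V =>
          ∑ i ∈ Finset.range k, (Real.exp (-‖X‖ ^ 2) : ℂ) * ((‖X‖ : ℂ) ^ i * ψ i V) :=
        funext (heq _)
      rw [this]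
      exact integrable_finsetSum _ fun i _ => ((hψ i).1.const_mul _).const_mul _
  | zero => exact MemLp.zero
  | add x y _ _ hx hy => exact hx.add hy
  | smul c x _ hx => exact hx.const_smul c

end GaussDomain

/-! ### Density of the Gaussian part of the domain -/

section GaussDensity

variable {l N r n : ℕ} {J J' : ZSpace l → XSpace N r → XSpace N r}
  {Q : ZSpace l → Fin n → XSpace N r} {U : Set (sphere (0 : ZSpace l) 1)} {C : ℝ}

/-- The functions whose Fourier transforms in `V` span a dense part of the domain. -/
def gaussMonomial (J : ZSpace l → XSpace N r → XSpace N r) (Q : ZSpace l → Fin n → XSpace N r)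
    (m : FrameIdx n →₀ ℕ) (ψ : ZSpace l → ℂ) (X : XSpace N r) (V : ZSpace l) : ℂ :=
  ((Real.exp (-‖X‖ ^ 2) : ℂ) * ψ V) * coordMonomial J Q m (unitVec V) X

/-- Among the amplitudes `e^{-|X|²} ∑ |X|^j φ_j` the single term `j = 0` already suffices for
density, since the coordinates supply all polynomials in `X`. -/
theorem expFourier_gaussMonomial_mem (m : FrameIdx n →₀ ℕ) {ψ : ZSpace l → ℂ}
    (hψ : IsDensity ψ) : (fun X Z => expFourier (gaussMonomial J Q m ψ X) Z) ∈
      kappaDomain J J' Q (gaussAmplitudes l) := by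
  have h1 : (fun X Z => expFourier (gaussMonomial J Q m ψ X) Z) = twistedFourier J Q
      (fun i => m (Sum.inl i)) (fun i => m (Sum.inr i))
      (fun s V => (Real.exp (-s ^ 2) : ℂ) * ∑ i ∈ Finset.range 1, (s : ℂ) ^ i * ψ V) := by
    ext X Z
    rw [twistedFourier, expFourier]
    congr 1
    ext V
    rw [gaussMonomial, ← coordMonomial_eq]
    simp
    ring
  rw [h1]
  exact Submodule.mem_map.2 ⟨_, Submodule.subset_span
    ⟨_, _, _, ⟨1, fun _ => ψ, fun _ => hψ, fun _ _ => rfl⟩, rfl⟩, rfl⟩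

theorem continuous_coordMonomial (J : ZSpace l → XSpace N r → XSpace N r)
    (Q : ZSpace l → Fin n → XSpace N r) (m : FrameIdx n →₀ ℕ) (θ : ZSpace l) :
    Continuous (coordMonomial J Q m θ) := by
  have : coordMonomial J Q m θ = fun X => _ := funext fun X => coordMonomial_eq J Q m θ X
  rw [this]
  unfold zCoord
  refine continuous_finsetProd _ fun i _ => ?_
  have hz : Continuous fun X : XSpace N r =>
      (inner ℝ (Q θ i) X : ℂ) + Complex.I * (inner ℝ (J θ (Q θ i)) X : ℂ) := by fun_prop
  exact (hz.pow _).mul ((Complex.continuous_conj.comp hz).pow _)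

theorem isClosedEmbedding_prodMk {α β : Type*} [TopologicalSpace α] [T1Space α]
    [TopologicalSpace β] (x : α) : IsClosedEmbedding (Prod.mk x : β → α × β) := by
  refine ⟨isEmbedding_prodMkRight x, ?_⟩
  have : Set.range (Prod.mk x : β → α × β) = Prod.fst ⁻¹' {x} := by
    ext ⟨y, z⟩
    simp [eq_comm]
  rw [this]
  exact isClosed_singleton.preimage continuous_fst

theorem evalX_inner_pow (ξ X : XSpace N r) (k : ℕ) :
    evalX ((∑ c, MvPolynomial.C (ξ c : ℂ) * MvPolynomial.X c) ^ k) X = (inner ℝ ξ X : ℂ) ^ k := by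
  simp [evalX, PiLp.inner_apply, mul_comm]

namespace FrameData

theorem memLp_gaussMonomial (hd : FrameData J Q U C) (hl : 1 ≤ l) (m : FrameIdx n →₀ ℕ)
    {ψ : ZSpace l → ℂ} (hψ : IsDensity ψ) :
    MemLp (fun w : XSpace N r × ZSpace l => gaussMonomial J Q m ψ w.1 w.2) 2
      (volume.prod volume) := by
  have := hd.memLp_gauss_mul_coordMonomial hl 0 m hψ.2
  simpa [gaussMonomial] using this

theorem ae_memLp_gauss_slice (hd : FrameData J Q U C) (hl : 1 ≤ l) :
    ∀ᵐ V : ZSpace l, ∀ m : FrameIdx n →₀ ℕ, MemLp (fun X : XSpace N r =>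
      (Real.exp (-‖X‖ ^ 2) : ℂ) * coordMonomial J Q m (unitVec V) X) 2 volume := by
  have hC : 0 ≤ C := zero_le_one.trans hd.one_le
  filter_upwards [hd.ae_norm_coordMonomial_le hl] with V hV m
  refine (memLp_exp_mul_norm_sub_sq (E := XSpace N r) 1).of_le_mul
    (c := (2 * C) ^ m.degree * (m.degree.factorial * Real.exp 1)) ?_ (.of_forall fun X => ?_)
  · have := continuous_coordMonomial J Q m (unitVec V)
    exact (by fun_prop : Continuous fun X : XSpace N r => (Real.exp (-‖X‖ ^ 2) : ℂ) *
      coordMonomial J Q m (unitVec V) X).aestronglyMeasurable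
  · have h1 := hV m.degree m (mem_expIdx.2 le_rfl) X
    have h2 := one_add_pow_mul_exp_le m.degree (norm_nonneg X)
    simp only [norm_mul, Complex.norm_real, Real.norm_eq_abs, Real.abs_exp]
    calc Real.exp (-‖X‖ ^ 2) * ‖coordMonomial J Q m (unitVec V) X‖
        ≤ Real.exp (-‖X‖ ^ 2) * ((2 * C) ^ m.degree * (1 + ‖X‖) ^ m.degree) := by gcongr
      _ = (2 * C) ^ m.degree * ((1 + ‖X‖) ^ m.degree * Real.exp (-‖X‖ ^ 2)) := by ring
      _ ≤ (2 * C) ^ m.degree * ((m.degree.factorial * Real.exp 1) *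
          Real.exp (1 * ‖X‖ - ‖X‖ ^ 2)) := by gcongr
      _ = (2 * C) ^ m.degree * (m.degree.factorial * Real.exp 1) *
          Real.exp (1 * ‖X‖ - ‖X‖ ^ 2) := by ring

/-- Indicators of sets of finite measure as `ψ` localize the orthogonality: for almost every `V` it
holds on the slice, for all of the countably many monomials at once. There the monomials at `V_u`
span all polynomials in `X`, in particular the powers `⟨ξ,X⟩ ^ k`. -/
theorem ae_eq_zero_of_forall_integral_gaussMonomial (hd : FrameData J Q U C) (hl : 1 ≤ l)
    {h : XSpace N r × ZSpace l → ℂ} (hh : MemLp h 2 (volume.prod volume))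
    (hz : ∀ (m : FrameIdx n →₀ ℕ) (ψ : ZSpace l → ℂ), IsDensity ψ →
      ∫ w, gaussMonomial J Q m ψ w.1 w.2 * h w ∂(volume.prod volume) = 0) :
    h =ᵐ[volume.prod volume] 0 := by
  let I : (FrameIdx n →₀ ℕ) → ZSpace l → ℂ := fun m V =>
    ∫ X, ((Real.exp (-‖X‖ ^ 2) : ℂ) * coordMonomial J Q m (unitVec V) X) * h (X, V)
  have hI : ∀ m, I m =ᵐ[volume] 0 := by
    intro m
    have key : ∀ s : Set (ZSpace l), MeasurableSet s → volume s < ⊤ →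
        Integrable (s.indicator (I m)) ∧ ∫ V, s.indicator (I m) V = 0 := by
      intro s hs hfin
      have hψ : IsDensity (s.indicator fun _ => (1 : ℂ)) :=
        ⟨(integrable_indicator_iff hs).2 (integrableOn_const hfin.ne),
          memLp_indicator_const 2 hs 1 (Or.inr hfin.ne)⟩
      have hint := (hd.memLp_gaussMonomial hl m hψ).integrable_mul hh
      have heq : (fun V => ∫ X, gaussMonomial J Q m (s.indicator fun _ => (1 : ℂ)) X V *
          h (X, V)) = s.indicator (I m) := by
        ext V
        by_cases hV : V ∈ s
        · simp only [gaussMonomial, Set.indicator_of_mem hV, mul_one, I]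
        · simp [gaussMonomial, Set.indicator_of_notMem hV]
      rw [← heq]
      refine ⟨hint.integral_prod_right, ?_⟩
      exact (integral_prod_symm _ hint).symm.trans (hz m _ hψ)
    refine ae_eq_zero_of_forall_setIntegral_eq_of_sigmaFinite (fun s hs hfin => ?_)
      fun s hs hfin => ?_
    · exact (integrable_indicator_iff hs).1 (key s hs hfin).1
    · rw [← integral_indicator hs]
      exact (key s hs hfin).2
  have hswap : MemLp (fun w : ZSpace l × XSpace N r => h (w.2, w.1)) 2 (volume.prod volume) :=
    hh.comp_measurePreserving Measure.measurePreserving_swap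
  have hslice : ∀ᵐ V : ZSpace l, ∀ᵐ X : XSpace N r, h (X, V) = 0 := by
    filter_upwards [ae_all_iff.2 hI, hd.ae_unitVec hl, hd.ae_memLp_gauss_slice hl,
      hswap.1.prodMk_left, ae_memLp_slice (h := fun V X => h (X, V)) hswap] with V hIV hV hG hm hf
    obtain ⟨-, u, huU, hu⟩ := hV
    have hhV : MemLp (fun X => h (X, V)) 2 volume := ⟨hm, hf⟩
    refine ae_eq_zero_of_forall_integral_inner_pow hhV fun ξ k => ?_
    set P : MvPolynomial (CoordIdx N r) ℂ :=
      (∑ c, MvPolynomial.C (ξ c : ℂ) * MvPolynomial.X c) ^ k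
    have hev : ∀ θ X, evalCoord J Q (frameRep P (realFrame J Q u)) θ X = _ :=
      evalCoord_eq_sum J Q (totalDegree_linSubst_le _ P)
    have hP : ∀ X, (inner ℝ ξ X : ℂ) ^ k * ((Real.exp (-‖X‖ ^ 2) : ℂ) * h (X, V)) =
        ∑ m ∈ expIdx n P.totalDegree, (frameRep P (realFrame J Q u)).coeff m *
          (((Real.exp (-‖X‖ ^ 2) : ℂ) * coordMonomial J Q m (unitVec V) X) * h (X, V)) := by
      intro X
      rw [← evalX_inner_pow, ← evalCoord_frameRep hd.card (hd.gram_pos u huU).ne' P X, hev, hu,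
        Finset.sum_mul]
      exact Finset.sum_congr rfl fun m _ => by ring
    simp_rw [hP]
    have hint : ∀ m, Integrable fun X => (frameRep P (realFrame J Q u)).coeff m *
        (((Real.exp (-‖X‖ ^ 2) : ℂ) * coordMonomial J Q m (unitVec V) X) * h (X, V)) :=
      fun m => ((hG m).integrable_mul hhV).const_mul _
    rw [integral_finsetSum _ fun m _ => hint m]
    refine Finset.sum_eq_zero fun m _ => ?_
    rw [integral_const_mul]
    exact mul_eq_zero_of_right _ (hIV m)
  have h0 : ∫⁻ w, ‖h w‖ₑ ∂(volume.prod volume) = 0 := by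
    rw [lintegral_prod_symm _ hh.1.enorm]
    rw [lintegral_eq_zero_of_ae_eq_zero]
    filter_upwards [hslice] with V hV
    refine lintegral_eq_zero_of_ae_eq_zero ?_
    filter_upwards [hV] with X hX
    simp [hX]
  rw [lintegral_eq_zero_iff' hh.1.enorm] at h0
  filter_upwards [h0] with w hw
  simpa using hw

theorem exists_gauss_approx (hd : FrameData J Q U C) (hl : 1 ≤ l)
    {h : XSpace N r × ZSpace l → ℂ} (hh : MemLp h 2 (volume.prod volume)) {η : ℝ≥0∞}
    (hη : 0 < η) : ∃ k : XSpace N r → ZSpace l → ℂ, (∀ X, Integrable (k X)) ∧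
      MemLp (fun w : XSpace N r × ZSpace l => k w.1 w.2) 2 (volume.prod volume) ∧
      (fun X Z => expFourier (k X) Z) ∈ kappaDomain J J' Q (gaussAmplitudes l) ∧
      eLpNorm (fun w => h w - k w.1 w.2) 2 (volume.prod volume) < η := by
  let S : Set (Lp ℂ 2 ((volume : Measure (XSpace N r)).prod (volume : Measure (ZSpace l)))) :=
    {x | ∃ m ψ, IsDensity ψ ∧ x =ᵐ[volume.prod volume] fun w => gaussMonomial J Q m ψ w.1 w.2}
  have horth : (Submodule.span ℂ S)ᗮ = ⊥ := by
    rw [Submodule.eq_bot_iff]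
    intro x hx
    -- The inner product is sesquilinear whereas the vanishing criterion is bilinear, hence the
    -- conjugate of `x`.
    have hz := (Lp.memLp x).star
    have h0 := hd.ae_eq_zero_of_forall_integral_gaussMonomial hl hz fun m ψ hψ => by
      have hmem : (hd.memLp_gaussMonomial hl m hψ).toLp ∈ S := ⟨m, ψ, hψ, MemLp.coeFn_toLp _⟩
      have h1 := Submodule.inner_left_of_mem_orthogonal (Submodule.subset_span hmem) hx
      rw [L2.inner_def] at h1
      rw [← h1]
      refine integral_congr_ae ?_
      filter_upwards [MemLp.coeFn_toLp (hd.memLp_gaussMonomial hl m hψ)] with w hw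
      rw [hw]
      simp
    refine Lp.eq_zero_iff_ae_eq_zero.2 ?_
    filter_upwards [h0] with w hw
    simpa using hw
  have htop := Submodule.topologicalClosure_eq_top_iff.2 horth
  have hcl : hh.toLp ∈ closure ((Submodule.span ℂ S : Submodule ℂ _) : Set _) := by
    rw [← Submodule.topologicalClosure_coe, htop]
    trivial
  obtain ⟨b, hb, hlt⟩ := EMetric.mem_closure_iff.1 hcl η hη
  -- The domain consists of actual functions, not of classes. The element `b` of the span therefore
  -- gets a representative that is integrable in `V` for every `X`, so that its Fourier integral is
  -- additive pointwise.
  have hex : ∃ k : XSpace N r → ZSpace l → ℂ, (∀ X, Integrable (k X)) ∧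
      (fun X Z => expFourier (k X) Z) ∈ kappaDomain J J' Q (gaussAmplitudes l) ∧
      b =ᵐ[volume.prod volume] fun w => k w.1 w.2 := by
    clear hlt
    induction hb using Submodule.span_induction with
    | mem x hx =>
      obtain ⟨m, ψ, hψ, hx⟩ := hx
      exact ⟨gaussMonomial J Q m ψ,
        fun X => hd.integrable_mul_coordMonomial hl (hψ.1.const_mul _) m X,
        expFourier_gaussMonomial_mem m hψ, hx⟩
    | zero =>
      refine ⟨0, fun X => integrable_zero _ _ _, ?_, Lp.coeFn_zero _ _ _⟩
      have : (fun X Z => expFourier ((0 : XSpace N r → ZSpace l → ℂ) X) Z) = 0 := by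
        ext X Z
        simp [expFourier]
      rw [this]
      exact Submodule.zero_mem _
    | add x y _ _ hx hy =>
      obtain ⟨k, hki, hkm, hkx⟩ := hx
      obtain ⟨k', hki', hkm', hky⟩ := hy
      refine ⟨k + k', fun X => (hki X).add (hki' X), ?_, ?_⟩
      · have : (fun X Z => expFourier ((k + k') X) Z) =
            (fun X Z => expFourier (k X) Z) + fun X Z => expFourier (k' X) Z := by
          ext X Z
          simp only [Pi.add_apply, expFourier, mul_add]
          exact integral_add (integrable_exp_mul (hki X) Z) (integrable_exp_mul (hki' X) Z)
        rw [this]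
        exact Submodule.add_mem _ hkm hkm'
      · filter_upwards [Lp.coeFn_add x y, hkx, hky] with w h1 h2 h3
        rw [h1, Pi.add_apply, h2, h3]
        rfl
    | smul c x _ hx =>
      obtain ⟨k, hki, hkm, hkx⟩ := hx
      refine ⟨c • k, fun X => (hki X).smul c, ?_, ?_⟩
      · have : (fun X Z => expFourier ((c • k) X) Z) = c • fun X Z => expFourier (k X) Z := by
          ext X Z
          exact expFourier_const_mul c (k X) Z
        rw [this]
        exact Submodule.smul_mem _ c hkm
      · filter_upwards [Lp.coeFn_smul c x, hkx] with w h1 h2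
        rw [h1, Pi.smul_apply, h2]
        rfl
  obtain ⟨k, hki, hkm, hkb⟩ := hex
  refine ⟨k, hki, (memLp_congr_ae hkb).1 (Lp.memLp b), hkm, ?_⟩
  rw [Lp.edist_def] at hlt
  refine (eLpNorm_congr_ae ?_).trans_lt hlt
  filter_upwards [hkb, hh.coeFn_toLp] with w h1 h2
  rw [Pi.sub_apply, h1, h2]

/-- A smooth function of compact support is inserted first, because its slices in `Z` satisfy the
inversion formula pointwise. The approximation then takes place on the Fourier side and is carried
back by Plancherel. -/
theorem exists_mem_kappaDomain_approx (hd : FrameData J Q U C) (hl : 1 ≤ l)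
    {v : XSpace N r × ZSpace l → ℂ} (hv : MemLp v 2 volume) {η : ℝ≥0∞} (hη : 0 < η) :
    ∃ u ∈ kappaDomain J J' Q (gaussAmplitudes l),
      eLpNorm (fun w => v w - u w.1 w.2) 2 volume < η := by
  -- The minimum with `1` keeps the tolerance finite, as its conversion to a real number requires.
  have hη₁ : 0 < min η 1 / 2 := ENNReal.half_pos (lt_min hη one_pos).ne'
  have hη₁t : min η 1 / 2 ≠ ⊤ :=
    ENNReal.div_ne_top (ne_top_of_le_ne_top ENNReal.one_ne_top (min_le_right _ _)) two_ne_zero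
  obtain ⟨g, hgc, hgd, hg⟩ := hv.exist_eLpNorm_sub_le (by norm_num) (by norm_num)
    (ENNReal.toReal_pos hη₁.ne' hη₁t)
  rw [ENNReal.ofReal_toReal hη₁t] at hg
  have hgL : MemLp g 2 volume := hgd.continuous.memLp_of_hasCompactSupport hgc
  have hgX : ∀ X : XSpace N r, ContDiff ℝ ∞ (fun Z : ZSpace l => g (X, Z)) ∧
      HasCompactSupport fun Z : ZSpace l => g (X, Z) := fun X =>
    ⟨hgd.comp (contDiff_const.prodMk contDiff_id),
      hgc.comp_isClosedEmbedding (isClosedEmbedding_prodMk X)⟩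
  have hhL : MemLp (fun w : XSpace N r × ZSpace l => spectralDensity (fun Z => g (w.1, Z)) w.2) 2
      (volume.prod volume) :=
    ((memLp_expFourier_prod (h := fun (X : XSpace N r) (Z : ZSpace l) => g (X, Z)) hgL
      (.of_forall fun X => (hgX X).1.continuous.integrable_of_hasCompactSupport
        (hgX X).2)).comp_measurePreserving ((MeasurePreserving.id volume).prod
          (Measure.measurePreserving_neg (volume : Measure (ZSpace l))))).const_mul
      ((plancherelConst (ZSpace l))⁻¹.toReal : ℂ)
  have hκt : plancherelConst (ZSpace l) ^ (1 / 2 : ℝ) ≠ ⊤ :=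
    ENNReal.rpow_ne_top_of_nonneg (by norm_num) plancherelConst_ne_top
  obtain ⟨k, hki, hkL, hkm, hk⟩ := hd.exists_gauss_approx (J' := J') hl hhL
    (ENNReal.div_pos hη₁.ne' hκt)
  refine ⟨_, hkm, ?_⟩
  have hgi : ∀ X : XSpace N r, Integrable (spectralDensity fun Z : ZSpace l => g (X, Z)) :=
    fun X => integrable_spectralDensity (hgX X).1 (hgX X).2
  have hsub : ∀ w : XSpace N r × ZSpace l, g w - expFourier (k w.1) w.2 = expFourier
      (fun V => spectralDensity (fun Z => g (w.1, Z)) V - k w.1 V) w.2 := fun w => by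
    rw [expFourier_sub (hgi w.1) (hki w.1), expFourier_spectralDensity (hgX w.1).1 (hgX w.1).2]
  have hsecond : eLpNorm (fun w : XSpace N r × ZSpace l => g w - expFourier (k w.1) w.2) 2 volume <
      min η 1 / 2 := by
    simp_rw [hsub]
    rw [Measure.volume_eq_prod, eLpNorm_expFourier_prod'
      (h := fun (X : XSpace N r) V => spectralDensity (fun Z => g (X, Z)) V - k X V)
      (hhL.sub hkL) (.of_forall fun X => (hgi X).sub (hki X)), mul_comm]
    exact ENNReal.mul_lt_of_lt_div hk
  have hum := hd.memLp_of_mem_kappaDomain hl hkm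
  have hsplit : (fun w : XSpace N r × ZSpace l => v w - expFourier (k w.1) w.2) =
      (v - g) + fun w => g w - expFourier (k w.1) w.2 := by
    ext w
    simp
  rw [hsplit]
  refine (eLpNorm_add_le (hv.sub hgL).1 (hgL.sub hum).1 (by norm_num)).trans_lt ?_
  refine (ENNReal.add_lt_add_of_le_of_lt (ne_top_of_le_ne_top hη₁t hg) hg hsecond).trans_le ?_
  rw [ENNReal.add_halves]
  exact min_le_left _ _

end FrameData

end GaussDensity

end

theorem mainTheorem8 (l N r n a a' : ℕ) (hl : 1 ≤ l) (ha : a ≤ N) (ha' : a' ≤ N)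
    (j : ZSpace l →ₗ[ℝ] Matrix (Fin r) (Fin r) ℝ) (hj : IsCliffordModule j)
    (J J' : ZSpace l → XSpace N r → XSpace N r) (hJ : J = hTypeJ j a) (hJ' : J' = hTypeJ j a')
    (Q : ZSpace l → Fin n → XSpace N r) (𝓔 : Filter ℝ)
    (hQ : (IsChangingBasis J J' Q ∧ 𝓔 = pure 0) ∨ (IsConstantBasis J J' Q ∧ 𝓔 = 𝓝[>] 0)) :
    -- the products `P(X) f(Z)`
    (∀ f : ZSpace l → ℂ, ContDiff ℝ ∞ f → HasCompactSupport f →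
      ∃ φ : ZSpace l → ℂ, IsInverseTransform f φ ∧ ∀ P : MvPolynomial (Fin N × Fin r) ℂ,
        (∀ᶠ ε in 𝓔, ∀ δ > 0,
          approximant J Q P (fun _ => φ) ε δ ∈ kappaDomain J J' Q (constAmplitudes l)) ∧
        (∀ X : XSpace N r, IsIteratedL2Limit volume 𝓔
          (fun ε δ Z => approximant J Q P (fun _ => φ) ε δ X Z) (fun Z => evalX P X * f Z)) ∧
        (∀ R : ℝ, IsIteratedL2Limit
          ((volume.restrict (ball (0 : XSpace N r) R)).prod (volume : Measure (ZSpace l))) 𝓔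
          (fun ε δ w => approximant J Q P (fun _ => φ) ε δ w.1 w.2)
          (fun w => evalX P w.1 * f w.2)) ∧
        -- restrictions to the sphere × ball-type domains
        (∀ R ρ : ℝ, 0 < R → 0 < ρ → IsIteratedL2Limit
          ((sphereMeasure N r R).prod (volume.restrict (ball (0 : ZSpace l) ρ))) 𝓔
          (fun ε δ w => approximant J Q P (fun _ => φ) ε δ w.1 w.2)
          (fun w => evalX P w.1 * f w.2))) ∧
    -- the products `P(X) f(|X|, Z)`
    (∀ f : ℝ → ZSpace l → ℂ, (∀ s, 0 ≤ s → ContDiff ℝ ∞ (f s) ∧ HasCompactSupport (f s)) →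
      ∃ φ : ℝ → ZSpace l → ℂ, (∀ s, 0 ≤ s → IsInverseTransform (f s) (φ s)) ∧
        ∀ P : MvPolynomial (Fin N × Fin r) ℂ,
        (∀ᶠ ε in 𝓔, ∀ δ > 0,
          approximant J Q P φ ε δ ∈ kappaDomain J J' Q (sliceAmplitudes l)) ∧
        (∀ X : XSpace N r, IsIteratedL2Limit volume 𝓔
          (fun ε δ Z => approximant J Q P φ ε δ X Z) (fun Z => evalX P X * f ‖X‖ Z)) ∧
        ((∀ R : ℝ, MemLp (fun w : XSpace N r × ZSpace l => f ‖w.1‖ w.2) 2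
            ((volume.restrict (ball 0 R)).prod volume)) →
          (∀ᶠ ε in 𝓔, ∀ δ > 0,
            approximant J Q P φ ε δ ∈ kappaDomain J J' Q (localAmplitudes l N r)) ∧
          (∀ R : ℝ, IsIteratedL2Limit
            ((volume.restrict (ball (0 : XSpace N r) R)).prod (volume : Measure (ZSpace l))) 𝓔
            (fun ε δ w => approximant J Q P φ ε δ w.1 w.2)
            (fun w => evalX P w.1 * f ‖w.1‖ w.2))) ∧
        (MemLp (fun w : XSpace N r × ZSpace l =>
            (((1 + ‖w.1‖) ^ P.totalDegree : ℝ) : ℂ) * f ‖w.1‖ w.2) 2 volume →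
          IsIteratedL2Limit (volume : Measure (XSpace N r × ZSpace l)) 𝓔
            (fun ε δ w => approximant J Q P φ ε δ w.1 w.2)
            (fun w => evalX P w.1 * f ‖w.1‖ w.2))) ∧
    -- density of the domain
    (∀ u ∈ kappaDomain J J' Q (gaussAmplitudes l),
      MemLp (fun w : XSpace N r × ZSpace l => u w.1 w.2) 2 volume) ∧
    (∀ v : XSpace N r × ZSpace l → ℂ, MemLp v 2 volume → ∀ η : ℝ≥0∞, 0 < η →
      ∃ u ∈ kappaDomain J J' Q (gaussAmplitudes l),
        eLpNorm (fun w => v w - u w.1 w.2) 2 volume < η) := by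
  subst hJ
  obtain ⟨h𝓔, U, C, hd, hlt, hgood⟩ := exists_frameData hl hQ
  refine ⟨fun f hf hc => ⟨polarDensity f, isInverseTransform_polarDensity hf hc hl, fun P =>
      hd.product_convergence hl hlt hgood hf hc P⟩,
    fun f hf => ⟨fun s => polarDensity (f s),
      fun s hs => isInverseTransform_polarDensity (hf s hs).1 (hf s hs).2 hl, fun P =>
      hd.radial_convergence hl hlt hgood hf P⟩,
    fun u hu => hd.memLp_of_mem_kappaDomain hl hu,
    fun v hv η hη => hd.exists_mem_kappaDomain_approx hl hv hη⟩
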